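/- **Squeezing Theorem.** Let $X$ be a finite-dimensional locally finite simplicial complex. There are $\varepsilon=\varepsilon(X)>0$ and an integer $i(X,\varepsilon)\ge 0$ such that the following holds for every additive category $\mathbb A$, every family $(r_j)_{j\ge 0}$ of retractions as in (3) below, every integer $i\ge i(X,\varepsilon)$, for $\mathbb A(X)$ meaning either $\mathbb A^*(X)$ or $\mathbb A_*(X)$, and for all finite chain complexes $C,D$ in $\mathbb A(X)$. Put $r=r_0\circ r_1\circ\cdots\circ r_{i-1}\colon Sd^i X\to X$. If there is a chain equivalence $Sd_r\,C\to Sd_r\,D$ in $\mathbb G_{Sd^iX}(\mathbb A)$ with control at most $\varepsilon$ measured in $X$, then there is a chain equivalence $C\to D$ in $\mathbb A(X)$. Here the following definitions are used. (1) *Categories.* An object of $\mathbb G_X(\mathbb A)$ is a family $\{M(\sigma)\}_{\sigma\in X}$ of objects of $\mathbb A$ indexed by the simplices of $X$; a morphism $f\colon M\to N$ is a matrix of morphisms $f_{\tau,\sigma}\colon M(\sigma)\to N(\tau)$ such that for each $\sigma$ only finitely many $f_{\tau,\sigma}$ are nonzero, and composition is matrix multiplication. $\mathbb A^*(X)$ (respectively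 $\mathbb A_*(X)$) has the same objects and those morphisms with $f_{\tau,\sigma}=0$ unless $\tau\le\sigma$ (respectively $\tau\ge\sigma$). Chain complexes are indexed by $\mathbb Z$ with differential of degree $-1$, and are finite if only finitely many of their objects are nonzero. (2) *Metric and control.* $X$ carries the standard path metric $d_X$, which restricts to the Euclidean metric of the standard simplex on each simplex and is infinite between different components. $Sd^iX$ is the $i$-th barycentric subdivision, with the same underlying space as $X$, and $\widehat\sigma$ denotes the barycentre of $\sigma$. The bound of a morphism, chain map or chain homotopy $f$ over $Sd^iX$ is $\sup\{d_X(\widehat\sigma,\widehat\tau): f_{\tau,\sigma}\ne 0\}$. A chain equivalence has control at most $\varepsilon$ if it, some chain homotopy inverse of it, and two chain homotopies from the two composites to the identities all have bound at most $\varepsilon$. (3) *Retractions.* $r_j\colon Sd^{j+1}X\to Sd^jX$ is a simplicial approximation to the identity, given by choosing a vertex $r_j(\widehat\tau)\in\tau$ for each simplex $\tau$ of $Sd^jX$. For $j=0$ the choices are arbitrary. For $j\ge1$ let $\widehat\sigma_0\cdots\widehat\sigma_n$, with $\sigma_0<\dots<\sigma_n$, be the simplex of $Sd\,X$ whose interior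 contains the interior of $\tau$; if $n\ge 1$, then $r_j(\widehat\tau)$ is required to be a vertex of $\tau$ at minimal $d_X$-distance from the face $\widehat\sigma_0\cdots\widehat\sigma_{n-1}$. (4) *Algebraic subdivision.* Let $X'$ be obtained from $X$ by simultaneously starring, at their barycentres, a set of simplices $\sigma$ with pairwise disjoint open stars, and let $r\colon X'\to X$ be given by choices $r(\widehat\sigma)\in\sigma$. For a simplex $s$ of $X'$ put $\delta(s)=|s|-|r(s)|$, where $|\cdot|$ is the dimension. For $C$ in $\mathbb A^*(X)$ put $Sd_r(C)(s)_n=C(r(s))_{n-\delta(s)}$, and let the component of $d_{Sd_rC}$ on degree $n$ from $s$ to $t$ be: the component of $d_C$ from $r(s)$ to $r(t)$ in degree $n-\delta(s)$, if $t\le s$ and $\delta(s)=\delta(t)$; $(-1)^n\mathrm{id}$, if $s=t*r(\widehat\sigma)$ and $\widehat\sigma\in t$ for a starred $\sigma$; $(-1)^{n+1}\mathrm{id}$, if $s=t*\widehat\sigma$ and $r(\widehat\sigma)\in t$ for a starred $\sigma$; and $0$ otherwise. For $C$ in $\mathbb A_*(X)$ put $Sd_r(C)(s)_n=C(r(s))_{n+\delta(s)}$,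 and let the component of $d_{Sd_rC}$ on degree $n$ from $t$ to $s$ be given by the same three cases and $0$ otherwise (in the first case it is the component of $d_C$ from $r(t)$ to $r(s)$ in degree $n+\delta(s)$). The barycentric subdivision is the composite of such steps, starring first all simplices of dimension $\dim X$, then those of dimension $\dim X-1$, and so on down to dimension $1$; for $r_j\colon Sd^{j+1}X\to Sd^jX$ as in (3), $Sd_{r_j}$ is the composite of the corresponding subdivisions, and $Sd_r=Sd_{r_{i-1}}\circ\cdots\circ Sd_{r_0}$. -/

import Mathlib

open CategoryTheory CategoryTheory.Limits

universe w u v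

noncomputable section

/-! ### Graded categories -/

/-- Collections `{M(i)}` of objects of `A` indexed by `I`.  The relation `R` only plays a role for
the morphisms: `R i j` says that a morphism may have a nonzero component `M(i) ⟶ N(j)`. -/
structure Graded (I : Type w) (R : I → I → Prop) (A : Type u) where
  /-- The object over the index `i`. -/
  obj : I → A

namespace Graded

variable {I : Type w} {R : I → I → Prop} {A : Type u} [Category.{v} A] [Preadditive A]

/-- A morphism of graded objects is a matrix of morphisms of `A` all of whose columns (the
components leaving a fixed index) are finite, and whose nonzero components are allowed by `R`.
Here `comp i j : M(i) ⟶ N(j)` is the component usually written `f_{j,i}`. -/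
@[ext]
structure Hom (M N : Graded I R A) where
  /-- The component from the index `i` to the index `j`. -/
  comp : ∀ i j, M.obj i ⟶ N.obj j
  finite_column : ∀ i, {j | comp i j ≠ 0}.Finite
  allowed : ∀ i j, comp i j ≠ 0 → R i j

namespace Hom

variable {L M N : Graded I R A}

/-- Matrix multiplication; the sum runs over the finitely many nonzero entries of a column. -/
def compSum (f : Hom L M) (g : Hom M N) (i k : I) : L.obj i ⟶ N.obj k :=
  ∑ j ∈ (f.finite_column i).toFinset, f.comp i j ≫ g.comp j k

theorem compSum_eq_sum (f : Hom L M) (g : Hom M N) (i k : I) (T : Finset I)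
    (hT : ∀ j, f.comp i j ≠ 0 → j ∈ T) :
    compSum f g i k = ∑ j ∈ T, f.comp i j ≫ g.comp j k := by
  refine Finset.sum_subset (fun j hj => hT j (by simpa using hj)) ?_
  intro j _ hj
  have : f.comp i j = 0 := by simpa using hj
  simp [this]

theorem compSum_eq_finsum (f : Hom L M) (g : Hom M N) (i k : I) :
    compSum f g i k = ∑ᶠ j, f.comp i j ≫ g.comp j k := by
  unfold compSum
  rw [finsum_eq_sum_of_support_subset]
  intro j hj
  have : f.comp i j ≠ 0 := fun h => hj (by simp [h])
  simpa using this

theorem exists_of_compSum_ne_zero {f : Hom L M} {g : Hom M N} {i k : I}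
    (h : compSum f g i k ≠ 0) : ∃ j, f.comp i j ≠ 0 ∧ g.comp j k ≠ 0 := by
  obtain ⟨j, -, hj⟩ := Finset.exists_ne_zero_of_sum_ne_zero h
  exact ⟨j, fun h => hj (by simp [h]), fun h => hj (by simp [h])⟩

theorem finite_compSum (f : Hom L M) (g : Hom M N) (i : I) :
    {k | compSum f g i k ≠ 0}.Finite := by
  refine ((f.finite_column i).biUnion fun j _ => g.finite_column j).subset ?_
  intro k hk
  obtain ⟨j, h1, h2⟩ := exists_of_compSum_ne_zero hk
  simp only [Set.mem_iUnion]
  exact ⟨j, h1, h2⟩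

open Classical in
/-- The identity matrix. -/
def idComp (M : Graded I R A) (i j : I) : M.obj i ⟶ M.obj j :=
  if h : i = j then eqToHom (congrArg M.obj h) else 0

theorem idComp_self (M : Graded I R A) (i : I) : idComp M i i = 𝟙 _ := by simp [idComp]

theorem idComp_ne (M : Graded I R A) {i j : I} (h : i ≠ j) : idComp M i j = 0 := by
  simp [idComp, h]

theorem eq_of_idComp_ne_zero {M : Graded I R A} {i j : I} (h : idComp M i j ≠ 0) : i = j := by
  by_contra hij
  exact h (idComp_ne M hij)

/-- The identity morphism. -/
def id [IsPreorder I R] (M : Graded I R A) : Hom M M where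
  comp := idComp M
  finite_column i := (Set.finite_singleton i).subset fun _ hj => (eq_of_idComp_ne_zero hj).symm
  allowed i j h := by
    obtain rfl := eq_of_idComp_ne_zero h
    exact refl_of R i

/-- Composition of morphisms, `(g ∘ f)_{k,i} = ∑_j g_{k,j} f_{j,i}`. -/
def comp' [IsPreorder I R] (f : Hom L M) (g : Hom M N) : Hom L N where
  comp := compSum f g
  finite_column := finite_compSum f g
  allowed i k h := by
    obtain ⟨j, h1, h2⟩ := exists_of_compSum_ne_zero h
    exact trans_of R (f.allowed i j h1) (g.allowed j k h2)

end Hom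

variable [IsPreorder I R]

instance : Category (Graded I R A) where
  Hom := Hom
  id := Hom.id
  comp := Hom.comp'
  id_comp {M N} f := by
    refine Hom.ext ?_
    funext i k
    have := Hom.compSum_eq_sum (Hom.id M) f i k {i} fun j hj =>
      by simpa using (Hom.eq_of_idComp_ne_zero hj).symm
    refine this.trans ?_
    simp [Hom.id, Hom.idComp_self]
  comp_id {M N} f := by
    classical
    refine Hom.ext ?_
    funext i k
    have := Hom.compSum_eq_sum f (Hom.id N) i k (insert k (f.finite_column i).toFinset) fun j hj =>
      by simp [hj]
    refine this.trans ?_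
    rw [Finset.sum_eq_single k]
    · simp [Hom.id, Hom.idComp_self]
    · intro j _ hj
      simp [Hom.id, Hom.idComp_ne _ hj]
    · simp
  assoc {K L M N} f g h := by
    refine Hom.ext ?_
    funext i l
    have e1 := Hom.compSum_eq_sum (Hom.comp' f g) h i l
      ((f.finite_column i).biUnion fun j _ => g.finite_column j).toFinset (by
        intro k hk
        obtain ⟨j, h1, h2⟩ := Hom.exists_of_compSum_ne_zero hk
        simp only [Set.Finite.mem_toFinset, Set.mem_iUnion]
        exact ⟨j, h1, h2⟩)
    refine e1.trans ?_
    change _ = Hom.compSum f (Hom.comp' g h) i l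
    unfold Hom.compSum
    simp only [Hom.comp', Preadditive.sum_comp, Hom.compSum, Category.assoc]
    rw [Finset.sum_comm]
    refine Finset.sum_congr rfl fun j hj => ?_
    rw [← Preadditive.comp_sum]
    congr 1
    symm
    refine Hom.compSum_eq_sum g h j l _ fun k hk => ?_
    simp only [Set.Finite.mem_toFinset, Set.mem_iUnion]
    exact ⟨j, by simpa using hj, hk⟩

@[ext]
theorem hom_ext {M N : Graded I R A} {f g : M ⟶ N} (h : ∀ i j, f.comp i j = g.comp i j) :
    f = g :=
  Hom.ext (funext fun i => funext fun j => h i j)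

theorem comp_comp {L M N : Graded I R A} (f : L ⟶ M) (g : M ⟶ N) (i k : I) :
    (f ≫ g).comp i k = ∑ᶠ j, f.comp i j ≫ g.comp j k :=
  Hom.compSum_eq_finsum f g i k

instance {M N : Graded I R A} : Zero (M ⟶ N) where
  zero :=
    { comp := fun _ _ => 0
      finite_column := fun i => by simp
      allowed := fun i j h => (h rfl).elim }

instance {M N : Graded I R A} : Add (M ⟶ N) where
  add f g :=
    { comp := fun i j => f.comp i j + g.comp i j
      finite_column := fun i => ((f.finite_column i).union (g.finite_column i)).subset fun j hj => by
        by_contra hc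
        simp only [Set.mem_union, Set.mem_ofPred_eq, not_or, not_not] at hc
        exact hj (by simp [hc.1, hc.2])
      allowed := fun i j h => by
        by_cases hf : f.comp i j = 0
        · exact g.allowed i j fun hg => h (by simp [hf, hg])
        · exact f.allowed i j hf }

instance {M N : Graded I R A} : Neg (M ⟶ N) where
  neg f :=
    { comp := fun i j => -f.comp i j
      finite_column := fun i => (f.finite_column i).subset fun j hj => by simpa using hj
      allowed := fun i j h => f.allowed i j (by simpa using h) }

theorem zero_comp_apply {M N : Graded I R A} (i j : I) : (0 : M ⟶ N).comp i j = 0 := rfl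

theorem add_comp_apply {M N : Graded I R A} (f g : M ⟶ N) (i j : I) :
    (f + g).comp i j = f.comp i j + g.comp i j := rfl

theorem neg_comp_apply {M N : Graded I R A} (f : M ⟶ N) (i j : I) :
    (-f).comp i j = -f.comp i j := rfl

instance {M N : Graded I R A} : AddCommGroup (M ⟶ N) where
  add_assoc f g h := hom_ext fun i j => add_assoc _ _ _
  zero_add f := hom_ext fun i j => zero_add _
  add_zero f := hom_ext fun i j => add_zero _
  nsmul := nsmulRec
  zsmul := zsmulRec
  neg_add_cancel f := hom_ext fun i j => neg_add_cancel _
  add_comm f g := hom_ext fun i j => add_comm _ _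

/-- Morphisms are added entry by entry. -/
instance : Preadditive (Graded I R A) where
  add_comp L M N f f' g := by
    classical
    ext i k
    rw [add_comp_apply]
    let T := (f.finite_column i).toFinset ∪ (f'.finite_column i).toFinset
    have e1 := Hom.compSum_eq_sum f g i k T fun j hj => by simp [T, hj]
    have e2 := Hom.compSum_eq_sum f' g i k T fun j hj => by simp [T, hj]
    have e3 := Hom.compSum_eq_sum (f + f') g i k T fun j hj => by
      by_contra hc
      simp only [T, Finset.mem_union, Set.Finite.mem_toFinset, Set.mem_ofPred_eq, not_or,
        not_not] at hc
      exact hj (by rw [add_comp_apply, hc.1, hc.2, add_zero])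
    change Hom.compSum (f + f') g i k = Hom.compSum f g i k + Hom.compSum f' g i k
    rw [e1, e2, e3, ← Finset.sum_add_distrib]
    simp [add_comp_apply]
  comp_add L M N f g g' := by
    ext i k
    change Hom.compSum f (g + g') i k = Hom.compSum f g i k + Hom.compSum f g' i k
    simp [Hom.compSum, add_comp_apply, Finset.sum_add_distrib]

instance isPreorder_true (I : Type w) : IsPreorder I fun _ _ => True where
  refl _ := trivial
  trans _ _ _ _ _ := trivial

/-- The inclusion of the category with restricted morphisms in the category of all graded
morphisms. -/
def forget (I : Type w) (R : I → I → Prop) [IsPreorder I R] (A : Type u) [Category.{v} A]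
    [Preadditive A] :
    Graded I R A ⥤ Graded I (fun _ _ => True) A where
  obj M := ⟨M.obj⟩
  map f :=
    { comp := f.comp
      finite_column := f.finite_column
      allowed := fun _ _ _ => trivial }
  map_id _ := rfl
  map_comp _ _ := rfl

/-- Reindexing along a bijection of the index sets. -/
def reindex {I J : Type w} (e : I ≃ J) (R : I → I → Prop) (S : J → J → Prop) [IsPreorder I R]
    [IsPreorder J S] (hRS : ∀ i j, R i j → S (e i) (e j)) (A : Type u) [Category.{v} A]
    [Preadditive A] : Graded I R A ⥤ Graded J S A where
  obj M := ⟨fun j => M.obj (e.symm j)⟩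
  map f :=
    { comp := fun i j => f.comp (e.symm i) (e.symm j)
      finite_column := fun i => (f.finite_column (e.symm i)).preimage e.symm.injective.injOn
      allowed := fun i j h => by simpa using hRS _ _ (f.allowed _ _ h) }
  map_id M := by
    refine hom_ext fun i j => ?_
    change Hom.idComp M (e.symm i) (e.symm j) = Hom.idComp ⟨fun j => M.obj (e.symm j)⟩ i j
    by_cases hij : i = j
    · subst hij
      rw [Hom.idComp_self, Hom.idComp_self]
    · rw [Hom.idComp_ne _ hij, Hom.idComp_ne _ fun h => hij (e.symm.injective h)]
  map_comp f g := by
    refine hom_ext fun i j => ?_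
    refine Eq.trans ?_ (comp_comp _ _ i j).symm
    exact (comp_comp f g (e.symm i) (e.symm j)).trans
      (finsum_comp_equiv e.symm (f := fun k => f.comp (e.symm i) k ≫ g.comp k (e.symm j))).symm

end Graded

instance Graded.reindex_preservesZeroMorphisms {I J : Type w} (e : I ≃ J) (R : I → I → Prop)
    (S : J → J → Prop) [IsPreorder I R] [IsPreorder J S] (hRS : ∀ i j, R i j → S (e i) (e j))
    (A : Type u) [Category.{v} A] [Preadditive A] :
    (Graded.reindex e R S hRS A).PreservesZeroMorphisms where
  map_zero _ _ := rfl

instance Graded.forget_preservesZeroMorphisms (I : Type w) (R : I → I → Prop) [IsPreorder I R]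
    (A : Type u) [Category.{v} A] [Preadditive A] :
    (Graded.forget I R A).PreservesZeroMorphisms where
  map_zero _ _ := rfl

/-! ### Simplicial complexes and stellar subdivision -/

/-- The type of simplices of a simplicial complex (all of them nonempty). -/
abbrev Face {W : Type w} (K : PreAbstractSimplicialComplex W) : Type w := {s // s ∈ K.faces}

/-- Finite-dimensional and locally finite. -/
structure IsFDLF {W : Type w} (K : PreAbstractSimplicialComplex W) : Prop where
  finite_dimensional : ∃ n : ℕ, ∀ s ∈ K.faces, s.card ≤ n + 1
  locally_finite : ∀ v : W, {s | s ∈ K.faces ∧ v ∈ s}.Finite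

/-- The dimension of a finite-dimensional simplicial complex (`0` for the empty complex). -/
def complexDim {W : Type w} (K : PreAbstractSimplicialComplex W) : ℕ :=
  sSup ((fun s : Finset W => s.card - 1) '' K.faces)

theorem card_le_complexDim {W : Type w} {K : PreAbstractSimplicialComplex W} (hK : IsFDLF K)
    {s : Finset W} (hs : s ∈ K.faces) : s.card ≤ complexDim K + 1 := by
  obtain ⟨n, hn⟩ := hK.finite_dimensional
  have : s.card - 1 ≤ complexDim K := by
    refine le_csSup ⟨n, ?_⟩ ⟨s, hs, rfl⟩
    rintro _ ⟨t, ht, rfl⟩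
    have := hn t ht
    dsimp only
    omega
  omega

theorem Face.nonempty {W : Type w} {K : PreAbstractSimplicialComplex W} {s : Finset W}
    (hs : s ∈ K.faces) : s.Nonempty := (K.isRelLowerSet_faces hs).1

theorem Face.down {W : Type w} {K : PreAbstractSimplicialComplex W} {s t : Finset W}
    (hs : s ∈ K.faces) (hts : t ⊆ s) (ht : t.Nonempty) : t ∈ K.faces :=
  (K.isRelLowerSet_faces hs).2 hts ht

section Stellar

set_option linter.unusedSectionVars false

variable {W : Type w} [DecidableEq W]

/-- The complex obtained from `K` by starring all the simplices `base x`, `x ∈ N`; the element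
`x` is the new vertex (the barycentre of `base x`).  Each simplex `base x * τ` is replaced by
`x * ∂(base x) * τ`: the new complex consists of the simplices of `K` that contain none of the
starred simplices, and of the simplices `x * ρ` where `ρ` contains no starred simplex
and spans a simplex of `K` together with `base x`. -/
def stellar (K : PreAbstractSimplicialComplex W) (N : Set W) (base : W → Finset W) :
    PreAbstractSimplicialComplex W where
  faces := {s | (s ∈ K.faces ∧ ∀ x ∈ N, ¬ base x ⊆ s) ∨
    ∃ x ∈ N, ∃ ρ : Finset W, s = insert x ρ ∧ ρ ∪ base x ∈ K.faces ∧ ∀ y ∈ N, ¬ base y ⊆ ρ}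
  isRelLowerSet_faces := by
    rintro s (⟨hs, hN⟩ | ⟨x, hx, ρ, rfl, hρ, hN⟩)
    · exact ⟨Face.nonempty hs, fun t hts ht =>
        Or.inl ⟨Face.down hs hts ht, fun x hx h => hN x hx (h.trans hts)⟩⟩
    · refine ⟨Finset.insert_nonempty _ _, fun t hts ht => ?_⟩
      by_cases hxt : x ∈ t
      · have hsub : t.erase x ⊆ ρ := by
          intro y hy
          have := hts (Finset.mem_of_mem_erase hy)
          exact (Finset.mem_insert.1 this).resolve_left (Finset.ne_of_mem_erase hy)
        refine Or.inr ⟨x, hx, t.erase x, (Finset.insert_erase hxt).symm, ?_,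
          fun y hy h => hN y hy (h.trans hsub)⟩
        refine Face.down hρ (Finset.union_subset_union_left hsub) ?_
        have : (base x).Nonempty := by
          rw [Finset.nonempty_iff_ne_empty]
          intro h
          exact hN x hx (by simp [h])
        exact this.mono Finset.subset_union_right
      · have hsub : t ⊆ ρ := fun y hy =>
          (Finset.mem_insert.1 (hts hy)).resolve_left fun h => hxt (h ▸ hy)
        exact Or.inl ⟨Face.down hρ (hsub.trans Finset.subset_union_left) ht,
          fun y hy h => hN y hy (h.trans hsub)⟩

/-- The conditions under which `stellar K N base` is a simultaneous disjoint stellar subdivision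
of `K`: the elements of `N` are not vertices of `K`, they are attached to simplices of `K`, and
these simplices have pairwise disjoint open stars (no simplex of `K` contains two of them). -/
structure IsDisjointStellar (K : PreAbstractSimplicialComplex W) (N : Set W)
    (base : W → Finset W) : Prop where
  base_mem : ∀ x ∈ N, base x ∈ K.faces
  fresh : ∀ x ∈ N, ∀ s ∈ K.faces, x ∉ s
  disjoint : ∀ s ∈ K.faces, ∀ x ∈ N, ∀ y ∈ N, base x ⊆ s → base y ⊆ s → x = y

open Classical in
/-- The vertex map `stellar K N base → K` which sends the new vertex `x` to `c x` and fixes the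
vertices of `K`. -/
def retr (N : Set W) (c : W → W) (x : W) : W := if x ∈ N then c x else x

variable {K : PreAbstractSimplicialComplex W} {N : Set W} {base : W → Finset W} {c : W → W}

theorem retr_of_mem {x : W} (hx : x ∈ N) : retr N c x = c x := by simp [retr, hx]

theorem retr_of_notMem {x : W} (hx : x ∉ N) : retr N c x = x := by simp [retr, hx]

namespace IsDisjointStellar

theorem subsingleton (h : IsDisjointStellar K N base) {s : Finset W}
    (hs : s ∈ (stellar K N base).faces) {x y : W} (hx : x ∈ N) (hy : y ∈ N) (hxs : x ∈ s)
    (hys : y ∈ s) : x = y := by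
  rcases hs with ⟨hs, -⟩ | ⟨z, hz, ρ, rfl, hρ, -⟩
  · exact (h.fresh x hx s hs hxs).elim
  · have key : ∀ u ∈ N, u ∈ insert z ρ → u = z := fun u hu hus =>
      (Finset.mem_insert.1 hus).resolve_right fun huρ =>
        h.fresh u hu _ hρ (Finset.mem_union_left _ huρ)
    rw [key x hx hxs, key y hy hys]

theorem notMem_of_mem_base (h : IsDisjointStellar K N base) {x y : W} (hx : x ∈ N)
    (hy : y ∈ base x) : y ∉ N := fun hyN => h.fresh y hyN _ (h.base_mem x hx) hy

/-- The vertex map `retr N c` is simplicial. -/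
theorem image_mem (h : IsDisjointStellar K N base) (hc : ∀ x ∈ N, c x ∈ base x) {s : Finset W}
    (hs : s ∈ (stellar K N base).faces) : s.image (retr N c) ∈ K.faces := by
  have hne := (Face.nonempty hs).image (retr N c)
  rcases hs with ⟨hs, -⟩ | ⟨z, hz, ρ, rfl, hρ, -⟩
  · refine Face.down hs ?_ hne
    intro y hy
    obtain ⟨x, hx, rfl⟩ := Finset.mem_image.1 hy
    rwa [retr_of_notMem fun hxN => h.fresh x hxN s hs hx]
  · refine Face.down hρ ?_ hne
    intro y hy
    obtain ⟨x, hx, rfl⟩ := Finset.mem_image.1 hy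
    rcases Finset.mem_insert.1 hx with rfl | hx
    · rw [retr_of_mem hz]
      exact Finset.mem_union_right _ (hc x hz)
    · rw [retr_of_notMem fun hxN => h.fresh x hxN _ hρ (Finset.mem_union_left _ hx)]
      exact Finset.mem_union_left _ hx

/-- Simultaneous disjoint stellar subdivision preserves finite dimension and local finiteness. -/
theorem isFDLF (h : IsDisjointStellar K N base) (hK : IsFDLF K) :
    IsFDLF (stellar K N base) := by
  -- every simplex is contained in `F ∪ {x | base x ⊆ F}` for a simplex `F` of `K`
  constructor
  · obtain ⟨n, hn⟩ := hK.finite_dimensional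
    refine ⟨n, ?_⟩
    rintro s (⟨hs, -⟩ | ⟨x, hx, ρ, rfl, hρ, hN⟩)
    · exact hn s hs
    · have h1 : ρ.card < (ρ ∪ base x).card := by
        refine Finset.card_lt_card (Finset.ssubset_iff_subset_ne.2
          ⟨Finset.subset_union_left, fun he => hN x hx ?_⟩)
        rw [he]
        exact Finset.subset_union_right
      have h2 := hn _ hρ
      have h3 := Finset.card_insert_le x ρ
      omega
  · intro v
    have hU : ∀ F ∈ K.faces, ({x | x ∈ F} ∪ {x | x ∈ N ∧ base x ⊆ F}).Finite := by
      intro F hF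
      refine (Finset.finite_toSet F).union (Set.Subsingleton.finite ?_)
      rintro x ⟨hx, hxF⟩ y ⟨hy, hyF⟩
      exact h.disjoint F hF x hx y hy hxF hyF
    -- `u` is a vertex of `K` contained in every such `F` for `s ∋ v`
    obtain ⟨u, hu⟩ : ∃ u : W, (v ∈ N → u ∈ base v) ∧ (v ∉ N → u = v) := by
      by_cases hv : v ∈ N
      · obtain ⟨u, hu⟩ := Face.nonempty (h.base_mem v hv)
        exact ⟨u, fun _ => hu, fun h => (h hv).elim⟩
      · exact ⟨v, fun h => (hv h).elim, fun _ => rfl⟩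
    have hfin := hK.locally_finite u
    have : (⋃ F ∈ {F | F ∈ K.faces ∧ u ∈ F},
        {s : Finset W | (s : Set W) ⊆ {x | x ∈ F} ∪ {x | x ∈ N ∧ base x ⊆ F}}).Finite := by
      refine hfin.biUnion fun F hF => ?_
      have h1 := (hU F hF.1).finite_subsets
      exact Set.Finite.preimage Finset.coe_injective.injOn h1
    refine this.subset ?_
    rintro s ⟨hs, hvs⟩
    simp only [Set.mem_iUnion]
    rcases hs with ⟨hs, -⟩ | ⟨x, hx, ρ, rfl, hρ, hN⟩
    · refine ⟨s, ⟨hs, ?_⟩, fun y hy => Or.inl hy⟩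
      rw [hu.2 fun hv => h.fresh v hv s hs hvs]
      exact hvs
    · refine ⟨ρ ∪ base x, ⟨hρ, ?_⟩, fun y hy => ?_⟩
      · by_cases hv : v ∈ N
        · have hvx : v = x := (Finset.mem_insert.1 hvs).resolve_right fun hvρ =>
            h.fresh v hv _ hρ (Finset.mem_union_left _ hvρ)
          exact Finset.mem_union_right _ (hvx ▸ hu.1 hv)
        · rw [hu.2 hv]
          refine Finset.mem_union_left _ ((Finset.mem_insert.1 hvs).resolve_left ?_)
          rintro rfl
          exact hv hx
      · rcases Finset.mem_insert.1 hy with rfl | hy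
        · exact Or.inr ⟨hx, Finset.subset_union_right⟩
        · exact Or.inl (Finset.mem_union_left _ hy)

end IsDisjointStellar

/-- The simplicial map `stellar K N base → K` on simplices. -/
def retrFace (h : IsDisjointStellar K N base) (hc : ∀ x ∈ N, c x ∈ base x)
    (s : Face (stellar K N base)) : Face K := ⟨s.1.image (retr N c), h.image_mem hc s.2⟩

/-- `|s| - |r(s)|`, the drop of dimension under `r = retr N c`. -/
def defect (N : Set W) (c : W → W) (s : Finset W) : ℤ := s.card - (s.image (retr N c)).card

open Classical in
/-- The sign pattern of the identity components in the differential of a subdivided complex: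
`1` if `l = s * c x` for a new vertex `x ∈ s`, `-1` if `l = s * x` for a new vertex `x` with
`c x ∈ s`, and `0` otherwise. -/
def joinSign (N : Set W) (c : W → W) (s l : Finset W) : ℤ :=
  if ∃ x ∈ N, x ∈ s ∧ c x ∉ s ∧ l = insert (c x) s then 1
  else if ∃ x ∈ N, c x ∈ s ∧ x ∉ s ∧ l = insert x s then -1
  else 0

end Stellar
section StellarCombinatorics

variable {W : Type w} [DecidableEq W] {K : PreAbstractSimplicialComplex W} {N : Set W}
  {base : W → Finset W} {c : W → W}

namespace IsDisjointStellar

theorem defect_eq_one (h : IsDisjointStellar K N base) (hc : ∀ x ∈ N, c x ∈ base x)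
    {s : Finset W} (hs : s ∈ (stellar K N base).faces) {x : W} (hx : x ∈ N) (hxs : x ∈ s)
    (hcs : c x ∈ s) : defect N c s = 1 := by
  have hcN : c x ∉ N := h.notMem_of_mem_base hx (hc x hx)
  have hne : c x ≠ x := fun he => hcN (by rw [he]; exact hx)
  have himg : s.image (retr N c) = s.erase x := by
    ext y
    simp only [Finset.mem_image, Finset.mem_erase]
    constructor
    · rintro ⟨z, hz, rfl⟩
      by_cases hzN : z ∈ N
      · obtain rfl := h.subsingleton hs hx hzN hxs hz
        rw [retr_of_mem hx]
        exact ⟨hne, hcs⟩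
      · rw [retr_of_notMem hzN]
        exact ⟨fun he => hzN (he ▸ hx), hz⟩
    · rintro ⟨hyx, hys⟩
      refine ⟨y, hys, retr_of_notMem fun hyN => hyx (h.subsingleton hs hyN hx hys hxs)⟩
  have h1 := Finset.card_erase_add_one hxs
  rw [defect, himg]
  omega

theorem defect_eq_zero (h : IsDisjointStellar K N base) {s : Finset W}
    (hs : s ∈ (stellar K N base).faces) (hN : ∀ x ∈ N, x ∈ s → c x ∉ s) : defect N c s = 0 := by
  have hinj : Set.InjOn (retr N c) (s : Set W) := by
    intro x hx y hy hxy
    by_cases hxN : x ∈ N <;> by_cases hyN : y ∈ N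
    · exact h.subsingleton hs hxN hyN hx hy
    · rw [retr_of_mem hxN, retr_of_notMem hyN] at hxy
      exact (hN x hxN hx (hxy ▸ hy)).elim
    · rw [retr_of_mem hyN, retr_of_notMem hxN] at hxy
      exact (hN y hyN hy (hxy ▸ hx)).elim
    · rwa [retr_of_notMem hxN, retr_of_notMem hyN] at hxy
  rw [defect, Finset.card_image_of_injOn hinj, sub_self]

theorem defect_cases (h : IsDisjointStellar K N base) (hc : ∀ x ∈ N, c x ∈ base x)
    {s : Finset W} (hs : s ∈ (stellar K N base).faces) :
    (defect N c s = 1 ∧ ∃ x ∈ N, x ∈ s ∧ c x ∈ s) ∨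
      (defect N c s = 0 ∧ ∀ x ∈ N, x ∈ s → c x ∉ s) := by
  by_cases hx : ∃ x ∈ N, x ∈ s ∧ c x ∈ s
  · obtain ⟨x, hxN, hxs, hcs⟩ := hx
    exact Or.inl ⟨h.defect_eq_one hc hs hxN hxs hcs, x, hxN, hxs, hcs⟩
  · push Not at hx
    exact Or.inr ⟨h.defect_eq_zero hs hx, hx⟩

theorem defect_mono (h : IsDisjointStellar K N base) (hc : ∀ x ∈ N, c x ∈ base x)
    {s t : Finset W} (hs : s ∈ (stellar K N base).faces) (ht : t ∈ (stellar K N base).faces)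
    (hst : s ⊆ t) : defect N c s ≤ defect N c t := by
  rcases h.defect_cases hc hs with ⟨h1, x, hx, hxs, hcs⟩ | ⟨h1, -⟩
  · rw [h1, h.defect_eq_one hc ht hx (hst hxs) (hst hcs)]
  · rcases h.defect_cases hc ht with ⟨h2, -⟩ | ⟨h2, -⟩ <;> rw [h1, h2]
    exact zero_le_one

theorem joinSign_spec (h : IsDisjointStellar K N base) (hc : ∀ x ∈ N, c x ∈ base x)
    {s l : Finset W} (hs : s ∈ (stellar K N base).faces) (hl : l ∈ (stellar K N base).faces)
    (hsl : joinSign N c s l ≠ 0) :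
    s ⊆ l ∧ s.image (retr N c) = l.image (retr N c) ∧ defect N c s = 0 ∧ defect N c l = 1 := by
  obtain ⟨x, hx, y, hys, hl', hy⟩ : ∃ x ∈ N, ∃ y ∉ s, l = insert y s ∧
      ((y = c x ∧ x ∈ s) ∨ (y = x ∧ c x ∈ s)) := by
    unfold joinSign at hsl
    split_ifs at hsl with h1 h2
    · obtain ⟨x, hx, hxs, hcs, hl'⟩ := h1
      exact ⟨x, hx, c x, hcs, hl', Or.inl ⟨rfl, hxs⟩⟩
    · obtain ⟨x, hx, hcs, hxs, hl'⟩ := h2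
      exact ⟨x, hx, x, hxs, hl', Or.inr ⟨rfl, hcs⟩⟩
    · exact (hsl rfl).elim
  have hsub : s ⊆ l := hl' ▸ Finset.subset_insert y s
  have hyl : y ∈ l := hl' ▸ Finset.mem_insert_self y s
  have hxl : x ∈ l := by
    rcases hy with ⟨-, hxs⟩ | ⟨rfl, -⟩
    · exact hsub hxs
    · exact hyl
  have hcl : c x ∈ l := by
    rcases hy with ⟨rfl, -⟩ | ⟨-, hcs⟩
    · exact hyl
    · exact hsub hcs
  have hcN : c x ∉ N := h.notMem_of_mem_base hx (hc x hx)
  refine ⟨hsub, ?_, h.defect_eq_zero hs ?_, h.defect_eq_one hc hl hx hxl hcl⟩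
  · rw [hl', Finset.image_insert, Finset.insert_eq_of_mem]
    rcases hy with ⟨rfl, hxs⟩ | ⟨rfl, hcs⟩
    · rw [retr_of_notMem hcN]
      exact Finset.mem_image.2 ⟨x, hxs, retr_of_mem hx⟩
    · rw [retr_of_mem hx]
      exact Finset.mem_image.2 ⟨c y, hcs, retr_of_notMem hcN⟩
  · intro z hz hzs hczs
    obtain rfl := h.subsingleton hl hz hx (hsub hzs) hxl
    rcases hy with ⟨rfl, -⟩ | ⟨rfl, -⟩
    · exact hys hczs
    · exact hys hzs

/-- `r` induces a bijection between the simplices between `s` and `l` and the simplices between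
`r(s)` and `r(l)` if `s ≤ l` have the same defect. -/
theorem bijOn_between (h : IsDisjointStellar K N base) (hc : ∀ x ∈ N, c x ∈ base x)
    {s l : Face (stellar K N base)} (hsl : s.1 ⊆ l.1) (hd : defect N c s.1 = defect N c l.1) :
    Set.BijOn (retrFace h hc) {b | s.1 ⊆ b.1 ∧ b.1 ⊆ l.1}
      {t | (retrFace h hc s).1 ⊆ t.1 ∧ t.1 ⊆ (retrFace h hc l).1} := by
  have key : ∀ x ∈ l.1, ∀ y ∈ l.1, retr N c x = retr N c y → x ≠ y → x ∈ s.1 := by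
    intro x hx y hy hxy hne
    have hex : ∃ z ∈ N, z ∈ l.1 ∧ c z ∈ l.1 ∧ (x = z ∨ x = c z) := by
      by_cases hxN : x ∈ N <;> by_cases hyN : y ∈ N
      · exact (hne (h.subsingleton l.2 hxN hyN hx hy)).elim
      · rw [retr_of_mem hxN, retr_of_notMem hyN] at hxy
        exact ⟨x, hxN, hx, hxy ▸ hy, Or.inl rfl⟩
      · rw [retr_of_mem hyN, retr_of_notMem hxN] at hxy
        exact ⟨y, hyN, hy, hxy ▸ hx, Or.inr hxy⟩
      · rw [retr_of_notMem hxN, retr_of_notMem hyN] at hxy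
        exact (hne hxy).elim
    obtain ⟨z, hz, hzl, hczl, hxz⟩ := hex
    rw [h.defect_eq_one hc l.2 hz hzl hczl] at hd
    rcases h.defect_cases hc s.2 with ⟨-, u, hu, hus, hcus⟩ | ⟨h0, -⟩
    · obtain rfl := h.subsingleton l.2 hu hz (hsl hus) hzl
      rcases hxz with rfl | rfl <;> assumption
    · omega
  refine ⟨?_, ?_, ?_⟩
  · rintro b ⟨h1, h2⟩
    exact ⟨Finset.image_subset_image h1, Finset.image_subset_image h2⟩
  · rintro b ⟨hb1, hb2⟩ b' ⟨hb1', hb2'⟩ hbb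
    have hbb' : b.1.image (retr N c) = b'.1.image (retr N c) := congrArg Subtype.val hbb
    have aux : ∀ b b' : Finset W, b ⊆ l.1 → s.1 ⊆ b' → b' ⊆ l.1 →
        b.image (retr N c) = b'.image (retr N c) → b ⊆ b' := by
      intro b b' hb hb1' hb2' he x hx
      have : retr N c x ∈ b'.image (retr N c) := he ▸ Finset.mem_image_of_mem _ hx
      obtain ⟨y, hy, hyx⟩ := Finset.mem_image.1 this
      by_cases hxy : x = y
      · exact hxy ▸ hy
      · exact hb1' (key x (hb hx) y (hb2' hy) hyx.symm hxy)
    exact Subtype.ext ((aux _ _ hb2 hb1' hb2' hbb').antisymm (aux _ _ hb2' hb1 hb2 hbb'.symm))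
  · rintro t ⟨ht1, ht2⟩
    have hsb : s.1 ⊆ l.1.filter fun x => retr N c x ∈ t.1 := fun x hx =>
      Finset.mem_filter.2 ⟨hsl hx, ht1 (Finset.mem_image_of_mem _ hx)⟩
    have hb : (l.1.filter fun x => retr N c x ∈ t.1) ∈ (stellar K N base).faces :=
      Face.down l.2 (Finset.filter_subset _ _) ((Face.nonempty s.2).mono hsb)
    refine ⟨⟨_, hb⟩, ⟨hsb, Finset.filter_subset _ _⟩, Subtype.ext ?_⟩
    ext y
    simp only [retrFace, Finset.mem_image, Finset.mem_filter]
    constructor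
    · rintro ⟨x, ⟨-, hx⟩, rfl⟩
      exact hx
    · intro hy
      obtain ⟨x, hx, rfl⟩ := Finset.mem_image.1 (ht2 hy)
      exact ⟨x, ⟨hx, hy⟩, rfl⟩

open Classical in
/-- The two ways of passing from `s` to `l` through one identity component and one component of
the original differential cancel. -/
theorem sum_joinSign (h : IsDisjointStellar K N base) (hc : ∀ x ∈ N, c x ∈ base x)
    (s l : Face (stellar K N base)) :
    ∑ᶠ b : Face (stellar K N base),
      ((if s.1 ⊆ b.1 ∧ defect N c s.1 = defect N c b.1 then 1 else 0) * joinSign N c b.1 l.1 -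
        joinSign N c s.1 b.1 * (if b.1 ⊆ l.1 ∧ defect N c b.1 = defect N c l.1 then 1 else 0))
      = 0 := by
  by_cases hgood : s.1 ⊆ l.1 ∧ defect N c s.1 = 0 ∧ defect N c l.1 = 1
  swap
  · refine finsum_eq_zero_of_forall_eq_zero fun b => ?_
    have h1 : (if s.1 ⊆ b.1 ∧ defect N c s.1 = defect N c b.1 then (1 : ℤ) else 0) *
        joinSign N c b.1 l.1 = 0 := by
      by_contra hne
      obtain ⟨h1, h2⟩ := mul_ne_zero_iff.1 hne
      obtain ⟨h3, -, h4, h5⟩ := h.joinSign_spec hc b.2 l.2 h2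
      split_ifs at h1 with hif
      · exact hgood ⟨hif.1.trans h3, hif.2.trans h4, h5⟩
      · exact h1 rfl
    have h2 : joinSign N c s.1 b.1 *
        (if b.1 ⊆ l.1 ∧ defect N c b.1 = defect N c l.1 then (1 : ℤ) else 0) = 0 := by
      by_contra hne
      obtain ⟨h1, h2⟩ := mul_ne_zero_iff.1 hne
      obtain ⟨h3, -, h4, h5⟩ := h.joinSign_spec hc s.2 b.2 h1
      split_ifs at h2 with hif
      · exact hgood ⟨h3.trans hif.1, h4, hif.2 ▸ h5⟩
      · exact h2 rfl
    rw [h1, h2, sub_zero]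
  obtain ⟨hsl, hds, hdl⟩ := hgood
  obtain ⟨x, hx, hxl, hcl⟩ : ∃ x ∈ N, x ∈ l.1 ∧ c x ∈ l.1 := by
    rcases h.defect_cases hc l.2 with ⟨-, hh⟩ | ⟨h0, -⟩
    · exact hh
    · omega
  have hS : ∀ z ∈ N, z ∈ s.1 → c z ∉ s.1 := by
    rcases h.defect_cases hc s.2 with ⟨h0, -⟩ | ⟨-, hh⟩
    · omega
    · exact hh
  have hcN : c x ∉ N := h.notMem_of_mem_base hx (hc x hx)
  have hne : c x ≠ x := fun he => hcN (by rw [he]; exact hx)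
  have huniq : ∀ z ∈ N, z ∈ l.1 → z = x := fun z hz hzl => h.subsingleton l.2 hz hx hzl hxl
  have ne1 : (l.1.erase (c x)).Nonempty := ⟨x, Finset.mem_erase.2 ⟨hne.symm, hxl⟩⟩
  have ne2 : (l.1.erase x).Nonempty := ⟨c x, Finset.mem_erase.2 ⟨hne, hcl⟩⟩
  let b1 : Face (stellar K N base) := ⟨_, Face.down l.2 (Finset.erase_subset (c x) l.1) ne1⟩
  let b2 : Face (stellar K N base) := ⟨_, Face.down l.2 (Finset.erase_subset x l.1) ne2⟩
  let b3 : Face (stellar K N base) := ⟨insert (c x) s.1, Face.down l.2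
    (Finset.insert_subset hcl hsl) (Finset.insert_nonempty _ _)⟩
  let b4 : Face (stellar K N base) := ⟨insert x s.1, Face.down l.2
    (Finset.insert_subset hxl hsl) (Finset.insert_nonempty _ _)⟩
  have hb12 : b1 ≠ b2 := fun he => by
    have : x ∈ b2.1 := he ▸ Finset.mem_erase.2 ⟨hne.symm, hxl⟩
    exact (Finset.mem_erase.1 this).1 rfl
  -- the identity components into and out of the intermediate simplices
  have hout : ∀ b : Face (stellar K N base), joinSign N c b.1 l.1 =
      (if b = b1 then 1 else 0) - (if b = b2 then 1 else 0) := by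
    intro b
    have e1 : (∃ y ∈ N, y ∈ b.1 ∧ c y ∉ b.1 ∧ l.1 = insert (c y) b.1) ↔ b = b1 := by
      constructor
      · rintro ⟨y, hy, hyb, hcb, he⟩
        obtain rfl := huniq y hy (he ▸ Finset.mem_insert_of_mem hyb)
        refine Subtype.ext ?_
        change b.1 = l.1.erase (c y)
        rw [he, Finset.erase_insert hcb]
      · rintro rfl
        exact ⟨x, hx, Finset.mem_erase.2 ⟨hne.symm, hxl⟩, Finset.notMem_erase _ _,
          (Finset.insert_erase hcl).symm⟩
    have e2 : (∃ y ∈ N, c y ∈ b.1 ∧ y ∉ b.1 ∧ l.1 = insert y b.1) ↔ b = b2 := by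
      constructor
      · rintro ⟨y, hy, hcb, hyb, he⟩
        obtain rfl := huniq y hy (he ▸ Finset.mem_insert_self _ _)
        refine Subtype.ext ?_
        change b.1 = l.1.erase y
        rw [he, Finset.erase_insert hyb]
      · rintro rfl
        exact ⟨x, hx, Finset.mem_erase.2 ⟨hne, hcl⟩, Finset.notMem_erase _ _,
          (Finset.insert_erase hxl).symm⟩
    unfold joinSign
    simp only [e1, e2]
    by_cases h1 : b = b1
    · subst h1
      simp [hb12]
    · by_cases h2 : b = b2
      · rw [if_neg h1, if_pos h2, if_neg h1, if_pos h2, zero_sub]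
      · rw [if_neg h1, if_neg h2, if_neg h1, if_neg h2, sub_zero]
  have hin : ∀ b : Face (stellar K N base), joinSign N c s.1 b.1 *
      (if b.1 ⊆ l.1 ∧ defect N c b.1 = defect N c l.1 then 1 else 0) =
      (if x ∈ s.1 then (if b = b3 then 1 else 0) else 0) -
        (if c x ∈ s.1 then (if b = b4 then 1 else 0) else 0) := by
    intro b
    by_cases hbl : b.1 ⊆ l.1
    · have e1 : (∃ y ∈ N, y ∈ s.1 ∧ c y ∉ s.1 ∧ b.1 = insert (c y) s.1) ↔
          (x ∈ s.1 ∧ b = b3) := by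
        constructor
        · rintro ⟨y, hy, hys, hcs, he⟩
          obtain rfl := huniq y hy (hsl hys)
          exact ⟨hys, Subtype.ext he⟩
        · rintro ⟨hxs, rfl⟩
          exact ⟨x, hx, hxs, hS x hx hxs, rfl⟩
      have e2 : (∃ y ∈ N, c y ∈ s.1 ∧ y ∉ s.1 ∧ b.1 = insert y s.1) ↔
          (c x ∈ s.1 ∧ b = b4) := by
        constructor
        · rintro ⟨y, hy, hcs, hys, he⟩
          obtain rfl := huniq y hy (hbl (he ▸ Finset.mem_insert_self _ _))
          exact ⟨hcs, Subtype.ext he⟩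
        · rintro ⟨hcs, rfl⟩
          exact ⟨x, hx, hcs, fun hxs => hS x hx hxs hcs, rfl⟩
      have hdef : joinSign N c s.1 b.1 ≠ 0 → defect N c b.1 = defect N c l.1 := fun hj => by
        rw [(h.joinSign_spec hc s.2 b.2 hj).2.2.2, hdl]
      have : joinSign N c s.1 b.1 *
          (if b.1 ⊆ l.1 ∧ defect N c b.1 = defect N c l.1 then 1 else 0) =
          joinSign N c s.1 b.1 := by
        by_cases hj : joinSign N c s.1 b.1 = 0
        · rw [hj, zero_mul]
        · rw [if_pos ⟨hbl, hdef hj⟩, mul_one]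
      rw [this]
      unfold joinSign
      simp only [e1, e2]
      by_cases hxs : x ∈ s.1
      · have hcs := hS x hx hxs
        simp [hxs, hcs]
      · by_cases hcs : c x ∈ s.1
        · by_cases hb : b = b4 <;> simp [hxs, hcs, hb]
        · simp [hxs, hcs]
    · have hb3 : b ≠ b3 := by
        rintro rfl
        exact hbl (Finset.insert_subset hcl hsl)
      have hb4 : b ≠ b4 := by
        rintro rfl
        exact hbl (Finset.insert_subset hxl hsl)
      simp [hbl, hb3, hb4]
  have hout' : ∀ b : Face (stellar K N base),
      (if s.1 ⊆ b.1 ∧ defect N c s.1 = defect N c b.1 then 1 else 0) * joinSign N c b.1 l.1 =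
      (if c x ∈ s.1 then 0 else (if b = b1 then 1 else 0)) -
        (if x ∈ s.1 then 0 else (if b = b2 then 1 else 0)) := by
    intro b
    have hdef : joinSign N c b.1 l.1 ≠ 0 → defect N c s.1 = defect N c b.1 := fun hj => by
      rw [(h.joinSign_spec hc b.2 l.2 hj).2.2.1, hds]
    have e1 : s.1 ⊆ b1.1 ↔ c x ∉ s.1 := by
      change s.1 ⊆ l.1.erase (c x) ↔ _
      rw [Finset.subset_erase]
      exact ⟨fun hh => hh.2, fun hh => ⟨hsl, hh⟩⟩
    have e2 : s.1 ⊆ b2.1 ↔ x ∉ s.1 := by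
      change s.1 ⊆ l.1.erase x ↔ _
      rw [Finset.subset_erase]
      exact ⟨fun hh => hh.2, fun hh => ⟨hsl, hh⟩⟩
    have : (if s.1 ⊆ b.1 ∧ defect N c s.1 = defect N c b.1 then 1 else 0) *
        joinSign N c b.1 l.1 = (if s.1 ⊆ b.1 then 1 else 0) * joinSign N c b.1 l.1 := by
      by_cases hj : joinSign N c b.1 l.1 = 0
      · rw [hj, mul_zero, mul_zero]
      · simp [hdef hj]
    rw [this, hout b]
    by_cases hb1 : b = b1
    · subst hb1
      by_cases hcs : c x ∈ s.1
      · rw [if_neg (fun hh => e1.1 hh hcs), if_pos hcs, if_neg hb12, zero_mul, ite_self, sub_zero]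
      · rw [if_pos (e1.2 hcs), if_neg hcs, if_neg hb12, one_mul, ite_self]
    · by_cases hb2 : b = b2
      · subst hb2
        by_cases hxs : x ∈ s.1
        · rw [if_neg (fun hh => e2.1 hh hxs), if_pos hxs, if_neg hb1, zero_mul, ite_self, sub_zero]
        · rw [if_pos (e2.2 hxs), if_neg hxs, if_neg hb1, one_mul, ite_self]
      · rw [if_neg hb1, if_neg hb2, ite_self, ite_self, sub_zero, mul_zero]
  have hsingle : ∀ t : Face (stellar K N base),
      (∑ᶠ b : Face (stellar K N base), if b = t then (1 : ℤ) else 0) = 1 := by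
    intro t
    rw [finsum_eq_single _ t (fun b hb => if_neg hb), if_pos rfl]
  have hfin : ∀ t : Face (stellar K N base),
      (Function.support fun b : Face (stellar K N base) => if b = t then (1 : ℤ) else 0).Finite :=
    fun t => (Set.finite_singleton t).subset fun b hb => by
      by_contra hbt
      exact hb (if_neg hbt)
  have hf0 : (Function.support fun _ : Face (stellar K N base) => (0 : ℤ)).Finite := by simp
  simp only [hin, hout']
  by_cases hxs : x ∈ s.1
  · have hcs := hS x hx hxs
    simp only [hxs, hcs, if_true, if_false, sub_zero]
    rw [finsum_sub_distrib (hfin b1) (hfin b3), hsingle, hsingle, sub_self]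
  · by_cases hcs : c x ∈ s.1
    · simp only [hxs, hcs, if_true, if_false, zero_sub, sub_neg_eq_add]
      have e : (fun b : Face (stellar K N base) =>
          -(if b = b2 then (1 : ℤ) else 0) + (if b = b4 then 1 else 0)) =
          fun b => (if b = b4 then (1 : ℤ) else 0) - (if b = b2 then 1 else 0) := by
        funext b
        ring
      rw [e, finsum_sub_distrib (hfin b4) (hfin b2), hsingle, hsingle, sub_self]
    · simp only [hxs, hcs, if_false, sub_zero]
      rw [finsum_sub_distrib (hfin b1) (hfin b2), hsingle, hsingle, sub_self]

end IsDisjointStellar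

end StellarCombinatorics
/-! ### The categories of complexes over `X` and algebraic subdivision -/

/-- The two possible meanings of `A(X)`: `lower` stands for `A^*(X)`, whose morphisms have
components from `σ` to `τ` only for `τ ≤ σ`, and `upper` for `A_*(X)`, with `τ ≥ σ`. -/
inductive Variance
  | lower
  | upper

namespace Variance

/-- `v.allows s t`: a morphism may have a nonzero component from the simplex `s` to `t`. -/
def allows {W : Type w} : Variance → Finset W → Finset W → Prop
  | lower, s, t => t ⊆ s
  | upper, s, t => s ⊆ t

/-- The relation `allows` on the simplices of a complex. -/
def rel {W : Type w} (v : Variance) (K : PreAbstractSimplicialComplex W) (s t : Face K) : Prop :=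
  v.allows s.1 t.1

instance {W : Type w} (v : Variance) (K : PreAbstractSimplicialComplex W) :
    IsPreorder (Face K) (v.rel K) where
  refl s := by cases v <;> exact Finset.Subset.refl s.1
  trans a b c h1 h2 := by
    cases v
    · exact Finset.Subset.trans (s₁ := c.1) h2 h1
    · exact Finset.Subset.trans (s₁ := a.1) h1 h2

/-- Degrees in a subdivided complex are shifted by `- defect` for `A^*(X)` and by `+ defect` for
`A_*(X)`. -/
def shift : Variance → ℤ
  | lower => -1
  | upper => 1

/-- The sign pattern of the identity component from `s` to `t`; in `A^*(X)` it goes from the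
larger to the smaller simplex, in `A_*(X)` from the smaller to the larger one. -/
def joinSign {W : Type w} [DecidableEq W] (N : Set W) (c : W → W) :
    Variance → Finset W → Finset W → ℤ
  | lower, s, t => _root_.joinSign N c t s
  | upper, s, t => _root_.joinSign N c s t

end Variance

section Complexes

variable {W : Type w} (A : Type u) [Category.{v} A] [Preadditive A]

/-- The `X`-graded category `G_X(A)`. -/
abbrev GCat (K : PreAbstractSimplicialComplex W) : Type (max w u) :=
  Graded (Face K) (fun _ _ => True) A

/-- The category `A(X)`, that is `A^*(X)` or `A_*(X)`. -/
abbrev ACat (var : Variance) (K : PreAbstractSimplicialComplex W) : Type (max w u) :=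
  Graded (Face K) (var.rel K) A

/-- Chain complexes in `A(X)`, indexed by `ℤ`, with differential of degree `-1`. -/
abbrev ACplx (var : Variance) (K : PreAbstractSimplicialComplex W) : Type (max w u v) :=
  HomologicalComplex (ACat A var K) (ComplexShape.down ℤ)

/-- The functor from chain complexes in `A(X)` to chain complexes in `G_X(A)`. -/
abbrev toG (var : Variance) (K : PreAbstractSimplicialComplex W) :
    ACplx A var K ⥤ HomologicalComplex (GCat A K) (ComplexShape.down ℤ) :=
  (Graded.forget (Face K) (var.rel K) A).mapHomologicalComplex _

end Complexes

section SubdividedComplex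

set_option linter.unusedSectionVars false

variable {W : Type w} [DecidableEq W] {A : Type u} [Category.{v} A] [Preadditive A]
  {K : PreAbstractSimplicialComplex W} {N : Set W} {base : W → Finset W} {c : W → W}
  {var : Variance}

theorem Variance.joinSign_spec (h : IsDisjointStellar K N base) (hc : ∀ x ∈ N, c x ∈ base x)
    {s t : Face (stellar K N base)} (hst : var.joinSign N c s.1 t.1 ≠ 0) :
    var.rel _ s t ∧ retrFace h hc s = retrFace h hc t ∧
      1 + var.shift * (defect N c s.1 - defect N c t.1) = 0 ∧
      defect N c s.1 ≠ defect N c t.1 ∧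
      (defect N c s.1, defect N c t.1) = (match var with | .lower => (1, 0) | .upper => (0, 1)) := by
  cases var
  · obtain ⟨h1, h2, h3, h4⟩ := h.joinSign_spec hc t.2 s.2 hst
    refine ⟨h1, Subtype.ext h2.symm, ?_, ?_, ?_⟩ <;> rw [h3, h4] <;> simp [Variance.shift]
  · obtain ⟨h1, h2, h3, h4⟩ := h.joinSign_spec hc s.2 t.2 hst
    refine ⟨h1, Subtype.ext h2, ?_, ?_, ?_⟩ <;> rw [h3, h4] <;> simp [Variance.shift]

open Classical in
/-- The component from `s` to `t` of the differential from degree `i` to degree `j` of the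
subdivided complex, `r = retr N c`:
* `d_C : C(r(s)) → C(r(t))` if `s` and `t` are comparable and have the same defect;
* `(-1)^i id` if the larger of the simplices `s`, `t` is the join of the smaller one, which
  contains a new vertex `x`, with `r(x)`;
* `(-1)^(i+1) id` if the larger is the join of the smaller one, which contains `r(x)`, with the
  new vertex `x`;
* `0` otherwise.
(In the second and third cases the two objects agree as soon as `j + 1 = i`.) -/
def subdivD (h : IsDisjointStellar K N base) (hc : ∀ x ∈ N, c x ∈ base x) (C : ACplx A var K)
    (i j : ℤ) (s t : Face (stellar K N base)) :
    (C.X (i + var.shift * defect N c s.1)).obj (retrFace h hc s) ⟶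
      (C.X (j + var.shift * defect N c t.1)).obj (retrFace h hc t) :=
  if var.rel _ s t ∧ defect N c s.1 = defect N c t.1 then
    (C.d (i + var.shift * defect N c s.1) (j + var.shift * defect N c t.1)).comp
      (retrFace h hc s) (retrFace h hc t)
  else if hst : j + 1 = i ∧ i + var.shift * defect N c s.1 = j + var.shift * defect N c t.1 ∧
      retrFace h hc s = retrFace h hc t then
    ((i.negOnePow : ℤ) * var.joinSign N c s.1 t.1) • eqToHom (by rw [hst.2.1, hst.2.2])
  else 0

theorem subdivD_of_same (h : IsDisjointStellar K N base) (hc : ∀ x ∈ N, c x ∈ base x)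
    (C : ACplx A var K) (i j : ℤ) {s t : Face (stellar K N base)} (h1 : var.rel _ s t)
    (h2 : defect N c s.1 = defect N c t.1) :
    subdivD h hc C i j s t = (C.d (i + var.shift * defect N c s.1)
      (j + var.shift * defect N c t.1)).comp (retrFace h hc s) (retrFace h hc t) :=
  if_pos ⟨h1, h2⟩

/-- The sign pattern does give the identity components it is meant to give. -/
theorem subdivD_of_joinSign (h : IsDisjointStellar K N base) (hc : ∀ x ∈ N, c x ∈ base x)
    (C : ACplx A var K) (i j : ℤ) (hij : j + 1 = i) {s t : Face (stellar K N base)}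
    (hst : var.joinSign N c s.1 t.1 ≠ 0) :
    ∃ e : (C.X (i + var.shift * defect N c s.1)).obj (retrFace h hc s) =
      (C.X (j + var.shift * defect N c t.1)).obj (retrFace h hc t),
    subdivD h hc C i j s t =
      ((i.negOnePow : ℤ) * var.joinSign N c s.1 t.1) • eqToHom e := by
  obtain ⟨-, h2, h3, h4, -⟩ := Variance.joinSign_spec h hc hst
  have h5 : i + var.shift * defect N c s.1 = j + var.shift * defect N c t.1 := by
    rw [mul_sub] at h3
    omega
  refine ⟨by rw [h5, h2], ?_⟩
  rw [subdivD, if_neg fun hh => h4 hh.2, dif_pos ⟨hij, h5, h2⟩]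

theorem subdivD_of_not (h : IsDisjointStellar K N base) (hc : ∀ x ∈ N, c x ∈ base x)
    (C : ACplx A var K) (i j : ℤ) {s t : Face (stellar K N base)}
    (h1 : ¬(var.rel _ s t ∧ defect N c s.1 = defect N c t.1))
    (h2 : var.joinSign N c s.1 t.1 = 0) : subdivD h hc C i j s t = 0 := by
  rw [subdivD, if_neg h1]
  split_ifs
  · rw [h2, mul_zero, zero_smul]
  · rfl

theorem rel_of_subdivD_ne_zero (h : IsDisjointStellar K N base) (hc : ∀ x ∈ N, c x ∈ base x)
    (C : ACplx A var K) (i j : ℤ) {s t : Face (stellar K N base)}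
    (hne : subdivD h hc C i j s t ≠ 0) : var.rel _ s t := by
  by_cases h1 : var.rel _ s t ∧ defect N c s.1 = defect N c t.1
  · exact h1.1
  · by_cases h2 : var.joinSign N c s.1 t.1 = 0
    · exact (hne (subdivD_of_not h hc C i j h1 h2)).elim
    · exact (Variance.joinSign_spec h hc h2).1

theorem finite_rel (hK : IsFDLF K) (s : Face K) : {t | var.rel K s t}.Finite := by
  cases var
  · exact ((Finset.finite_toSet s.1).finite_subsets.preimage
      (Finset.coe_injective.comp Subtype.val_injective).injOn).subset fun t ht => ht
  · obtain ⟨x, hx⟩ := Face.nonempty s.2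
    exact ((hK.locally_finite x).preimage Subtype.val_injective.injOn).subset
      fun t ht => ⟨t.2, ht hx⟩

theorem ACplx_eqToHom_d (C : ACplx A var K) {p p' : ℤ} (q : ℤ) {a a' : Face K} (b : Face K)
    (hp : p = p') (ha : a = a') (e : (C.X p).obj a = (C.X p').obj a') :
    eqToHom e ≫ (C.d p' q).comp a' b = (C.d p q).comp a b := by
  subst hp ha
  simp

theorem ACplx_d_eqToHom (C : ACplx A var K) (p : ℤ) {q q' : ℤ} (a : Face K) {b b' : Face K}
    (hq : q = q') (hb : b = b') (e : (C.X q).obj b = (C.X q').obj b') :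
    (C.d p q).comp a b ≫ eqToHom e = (C.d p q').comp a b' := by
  subst hq hb
  simp

theorem ACplx_d_d_congr (C : ACplx A var K) (p r : ℤ) {q q' : ℤ} (a b b' : Face K)
    (hq : q = q') : (C.d p q).comp a b ≫ (C.d q r).comp b b' =
      (C.d p q').comp a b ≫ (C.d q' r).comp b b' := by
  subst hq
  rfl

/-- The morphism of `A(X')` with components `subdivD`. -/
def subdivHom (h : IsDisjointStellar K N base) (hc : ∀ x ∈ N, c x ∈ base x) (hK : IsFDLF K)
    (C : ACplx A var K) (i j : ℤ) :
    (⟨fun s => (C.X (i + var.shift * defect N c s.1)).obj (retrFace h hc s)⟩ :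
      ACat A var (stellar K N base)) ⟶
    ⟨fun s => (C.X (j + var.shift * defect N c s.1)).obj (retrFace h hc s)⟩ where
  comp := subdivD h hc C i j
  finite_column s := (finite_rel (var := var) (h.isFDLF hK) s).subset fun _ ht =>
    rel_of_subdivD_ne_zero h hc C i j ht
  allowed _ _ hst := rel_of_subdivD_ne_zero h hc C i j hst

theorem finsum_subdivD_same (h : IsDisjointStellar K N base) (hc : ∀ x ∈ N, c x ∈ base x)
    (C : ACplx A var K) (i j k : ℤ) (s t : Face (stellar K N base))
    (hd : defect N c s.1 = defect N c t.1) :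
    ∑ᶠ b, subdivD h hc C i j s b ≫ subdivD h hc C j k b t = 0 := by
  classical
  have hzero : ∀ b, ¬(var.rel _ s b ∧ var.rel _ b t) →
      subdivD h hc C i j s b ≫ subdivD h hc C j k b t = 0 := by
    intro b hb
    by_contra hne
    refine hb ⟨rel_of_subdivD_ne_zero h hc C i j fun h0 => hne ?_,
      rel_of_subdivD_ne_zero h hc C j k fun h0 => hne ?_⟩ <;> simp [h0]
  by_cases hst : var.rel _ s t
  swap
  · exact finsum_eq_zero_of_forall_eq_zero fun b => hzero b fun hb =>
      hst (trans_of (var.rel _) hb.1 hb.2)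
  have hdb : ∀ b, var.rel _ s b → var.rel _ b t → defect N c s.1 = defect N c b.1 := by
    intro b h1 h2
    cases var
    · exact le_antisymm (hd.trans_le (h.defect_mono hc t.2 b.2 h2)) (h.defect_mono hc b.2 s.2 h1)
    · exact le_antisymm (h.defect_mono hc s.2 b.2 h1)
        ((h.defect_mono hc b.2 t.2 h2).trans_eq hd.symm)
  let G : Face K → ((C.X (i + var.shift * defect N c s.1)).obj (retrFace h hc s) ⟶
      (C.X (k + var.shift * defect N c t.1)).obj (retrFace h hc t)) := fun τ =>
    (C.d (i + var.shift * defect N c s.1) (j + var.shift * defect N c s.1)).comp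
      (retrFace h hc s) τ ≫
    (C.d (j + var.shift * defect N c s.1) (k + var.shift * defect N c t.1)).comp
      τ (retrFace h hc t)
  have hG : ∑ᶠ τ, G τ = 0 := by
    have := Graded.comp_comp (C.d (i + var.shift * defect N c s.1)
      (j + var.shift * defect N c s.1)) (C.d (j + var.shift * defect N c s.1)
      (k + var.shift * defect N c t.1)) (retrFace h hc s) (retrFace h hc t)
    rw [HomologicalComplex.d_comp_d] at this
    exact this.symm
  have hbij : Set.BijOn (retrFace h hc) {b | var.rel _ s b ∧ var.rel _ b t}
      {τ | var.rel _ (retrFace h hc s) τ ∧ var.rel _ τ (retrFace h hc t)} := by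
    cases var
    · have := h.bijOn_between hc hst hd.symm
      have e1 : {b : Face (stellar K N base) | Variance.lower.rel _ s b ∧
          Variance.lower.rel _ b t} = {b | t.1 ⊆ b.1 ∧ b.1 ⊆ s.1} :=
        Set.ext fun b => and_comm
      have e2 : {τ : Face K | Variance.lower.rel _ (retrFace h hc s) τ ∧
          Variance.lower.rel _ τ (retrFace h hc t)} =
          {τ | (retrFace h hc t).1 ⊆ τ.1 ∧ τ.1 ⊆ (retrFace h hc s).1} :=
        Set.ext fun b => and_comm
      rw [e1, e2]
      exact this
    · exact h.bijOn_between hc hst hd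
  have hterm : ∀ b, b ∈ {b | var.rel (stellar K N base) s b ∧ var.rel _ b t} →
      subdivD h hc C i j s b ≫ subdivD h hc C j k b t = G (retrFace h hc b) := by
    rintro b ⟨h1, h2⟩
    have e := hdb b h1 h2
    rw [subdivD_of_same h hc C i j h1 e, subdivD_of_same h hc C j k h2 (e.symm.trans hd)]
    have hq : j + var.shift * defect N c b.1 = j + var.shift * defect N c s.1 := by rw [e]
    exact ACplx_d_d_congr C _ _ (retrFace h hc s) (retrFace h hc b) (retrFace h hc t) hq
  have hGzero : ∀ τ, ¬(var.rel _ (retrFace h hc s) τ ∧ var.rel _ τ (retrFace h hc t)) →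
      G τ = 0 := by
    intro τ hτ
    by_contra hne
    refine hτ ⟨(C.d (i + var.shift * defect N c s.1) (j + var.shift * defect N c s.1)).allowed
        _ _ fun h0 => hne ?_,
      (C.d (j + var.shift * defect N c s.1) (k + var.shift * defect N c t.1)).allowed
        _ _ fun h0 => hne ?_⟩
    · simp only [G]
      rw [h0, zero_comp]
    · simp only [G]
      rw [h0, comp_zero]
  have e1 : ∑ᶠ b, subdivD h hc C i j s b ≫ subdivD h hc C j k b t =
      ∑ᶠ b ∈ {b | var.rel (stellar K N base) s b ∧ var.rel _ b t},
        subdivD h hc C i j s b ≫ subdivD h hc C j k b t := by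
    rw [← finsum_mem_univ]
    refine finsum_mem_inter_support_eq' _ _ _ fun b hb => ?_
    simp only [Set.mem_univ, true_iff]
    by_contra hc'
    exact hb (hzero b hc')
  have e2 : ∑ᶠ τ, G τ = ∑ᶠ τ ∈ {τ | var.rel _ (retrFace h hc s) τ ∧
      var.rel _ τ (retrFace h hc t)}, G τ := by
    rw [← finsum_mem_univ]
    refine finsum_mem_inter_support_eq' _ _ _ fun b hb => ?_
    simp only [Set.mem_univ, true_iff]
    by_contra hc'
    exact hb (hGzero b hc')
  rw [e1, finsum_mem_eq_of_bijOn (retrFace h hc) hbij hterm, ← e2, hG]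

theorem finsum_subdivD_diff (h : IsDisjointStellar K N base) (hc : ∀ x ∈ N, c x ∈ base x)
    (hK : IsFDLF K) (C : ACplx A var K) (i j k : ℤ) (hij : j + 1 = i) (hjk : k + 1 = j)
    (s t : Face (stellar K N base)) (hd : defect N c s.1 ≠ defect N c t.1) :
    ∑ᶠ b, subdivD h hc C i j s b ≫ subdivD h hc C j k b t = 0 := by
  classical
  let G := (C.d (i + var.shift * defect N c s.1) (k + var.shift * defect N c t.1)).comp
    (retrFace h hc s) (retrFace h hc t)
  let E : Face (stellar K N base) → Face (stellar K N base) → ℤ := fun a b =>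
    if var.rel _ a b ∧ defect N c a.1 = defect N c b.1 then 1 else 0
  let J : Face (stellar K N base) → Face (stellar K N base) → ℤ := fun a b =>
    var.joinSign N c a.1 b.1
  let n : Face (stellar K N base) → ℤ := fun b => E s b * J b t - J s b * E b t
  have hsign : (j.negOnePow : ℤ) = -(i.negOnePow : ℤ) := by
    rw [← hij, Int.negOnePow_succ]
    simp
  have hn : ∑ᶠ b, n b = 0 := by
    cases var
    · have := h.sum_joinSign hc t s
      rw [← neg_zero, ← this, ← finsum_neg_distrib]
      refine finsum_congr fun b => ?_
      have e1 : E s b = if b.1 ⊆ s.1 ∧ defect N c b.1 = defect N c s.1 then 1 else 0 :=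
        if_congr (and_congr Iff.rfl eq_comm) rfl rfl
      have e2 : E b t = if t.1 ⊆ b.1 ∧ defect N c t.1 = defect N c b.1 then 1 else 0 :=
        if_congr (and_congr Iff.rfl eq_comm) rfl rfl
      simp only [n, J, Variance.joinSign, e1, e2]
      ring
    · rw [← h.sum_joinSign hc s t]
      refine finsum_congr fun b => ?_
      have e1 : E s b = if s.1 ⊆ b.1 ∧ defect N c s.1 = defect N c b.1 then 1 else 0 :=
        if_congr Iff.rfl rfl rfl
      have e2 : E b t = if b.1 ⊆ t.1 ∧ defect N c b.1 = defect N c t.1 then 1 else 0 :=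
        if_congr Iff.rfl rfl rfl
      simp only [n, J, Variance.joinSign, e1, e2]
  have hterm : ∀ b, subdivD h hc C i j s b ≫ subdivD h hc C j k b t =
      ((j.negOnePow : ℤ) * n b) • G := by
    intro b
    by_cases hE1 : var.rel _ s b ∧ defect N c s.1 = defect N c b.1
    · have hJ1 : J s b = 0 := by
        by_contra hne
        exact (Variance.joinSign_spec h hc hne).2.2.2.1 hE1.2
      by_cases hJ2 : J b t = 0
      · have hE2 : ¬(var.rel _ b t ∧ defect N c b.1 = defect N c t.1) := fun hh =>
          hd (hE1.2.trans hh.2)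
        rw [subdivD_of_not h hc C j k hE2 hJ2]
        simp [n, hJ1, hJ2]
      · obtain ⟨e, he⟩ := subdivD_of_joinSign h hc C j k hjk hJ2
        obtain ⟨-, h2, h3, h4, -⟩ := Variance.joinSign_spec h hc hJ2
        have h5 : j + var.shift * defect N c b.1 = k + var.shift * defect N c t.1 := by
          rw [mul_sub] at h3
          omega
        rw [he, subdivD_of_same h hc C i j hE1.1 hE1.2, Preadditive.comp_zsmul,
          ACplx_d_eqToHom C _ _ h5 h2]
        simp only [n, hJ1, E, if_pos hE1, one_mul, zero_mul, sub_zero]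
        rfl
    · by_cases hJ1 : J s b = 0
      · rw [subdivD_of_not h hc C i j hE1 hJ1]
        simp [n, hJ1, E, if_neg hE1]
      · obtain ⟨e, he⟩ := subdivD_of_joinSign h hc C i j hij hJ1
        obtain ⟨-, h2, h3, h4, h6⟩ := Variance.joinSign_spec h hc hJ1
        have h5 : i + var.shift * defect N c s.1 = j + var.shift * defect N c b.1 := by
          rw [mul_sub] at h3
          omega
        by_cases hE2 : var.rel _ b t ∧ defect N c b.1 = defect N c t.1
        · rw [he, subdivD_of_same h hc C j k hE2.1 hE2.2, Preadditive.zsmul_comp,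
            ACplx_eqToHom_d C _ _ h5 h2]
          simp only [n, E, if_neg hE1, if_pos hE2, zero_mul, mul_one, zero_sub, hsign, neg_mul_neg]
          rfl
        · have hJ2 : J b t = 0 := by
            by_contra hne
            obtain ⟨-, -, -, -, h7⟩ := Variance.joinSign_spec h hc hne
            have h8 := h6.symm.trans (Prod.ext rfl rfl : _ = (defect N c s.1, defect N c b.1))
            cases var <;> simp_all
          rw [subdivD_of_not h hc C j k hE2 hJ2]
          simp [n, E, if_neg hE1, if_neg hE2]
  have hfin : (Function.support n).Finite := by
    refine (finite_rel (var := var) (h.isFDLF hK) s).subset fun b hb => ?_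
    by_contra hrel
    have hE : E s b = 0 := if_neg fun hh => hrel hh.1
    have hJ : J s b = 0 := by
      by_contra hne
      exact hrel (Variance.joinSign_spec h hc hne).1
    exact hb (by simp [n, hE, hJ])
  have hmap := ((zmultiplesHom _ G).comp (AddMonoidHom.mulLeft (j.negOnePow : ℤ))).map_finsum hfin
  rw [hn, map_zero] at hmap
  exact (finsum_congr hterm).trans hmap.symm

/-- The algebraic subdivision `Sd_r C` of a chain complex `C` in `A(X)` along a simultaneous
disjoint stellar subdivision, for the simplicial approximation `r` to the identity which sends the
new vertex `x` to the vertex `c x` of `base x`: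
`Sd_r C (s)_n = C(r(s))_{n ∓ (|s| - |r(s)|)}`. -/
def subdivStellar (h : IsDisjointStellar K N base) (hc : ∀ x ∈ N, c x ∈ base x) (hK : IsFDLF K)
    (C : ACplx A var K) : ACplx A var (stellar K N base) where
  X i := ⟨fun s => (C.X (i + var.shift * defect N c s.1)).obj (retrFace h hc s)⟩
  d i j := subdivHom h hc hK C i j
  shape i j hij := by
    refine Graded.hom_ext fun s t => ?_
    change subdivD h hc C i j s t = 0
    unfold subdivD
    split_ifs with h1 h2
    · rw [C.shape _ _ fun hr => hij ?_]
      · rfl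
      · have hr' : j + var.shift * defect N c t.1 + 1 = i + var.shift * defect N c s.1 := hr
        rw [h1.2] at hr'
        change j + 1 = i
        omega
    · exact (hij h2.1).elim
    · rfl
  d_comp_d' i j k hij hjk := by
    refine Graded.hom_ext fun s t => ?_
    rw [Graded.comp_comp]
    change ∑ᶠ b, subdivD h hc C i j s b ≫ subdivD h hc C j k b t = 0
    by_cases hd : defect N c s.1 = defect N c t.1
    · exact finsum_subdivD_same h hc C i j k s t hd
    · exact finsum_subdivD_diff h hc hK C i j k hij hjk s t hd

end SubdividedComplex
/-! ### Barycentric subdivision as an iterated stellar subdivision -/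

section Barycentric

variable {V : Type w} [DecidableEq V]

/-- The set `{ {v} | v ∈ σ }`: the simplex `σ` when each vertex `v` is renamed `{v}`. -/
def vertexSimplex (σ : Finset V) : Finset (Finset V) := σ.image fun v => {v}

/-- The simplices of `K` that are starred in the `m`-th step: those of dimension `dim K - m`, as
long as this is positive. -/
def newVertices (K : PreAbstractSimplicialComplex V) (m : ℕ) : Set (Finset V) :=
  {σ | σ ∈ K.faces ∧ 2 ≤ σ.card ∧ σ.card + m = complexDim K + 1}

/-- The complex obtained from `K` by starring first all simplices of dimension `dim K`, then all
simplices of dimension `dim K - 1`, and so on, `m` times. Its vertices are finite sets of vertices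
of `K`: the old vertex `v` is `{v}`, and the barycentre of a simplex `σ` of `K` is `σ` itself. -/
def sdStage (K : PreAbstractSimplicialComplex V) : ℕ → PreAbstractSimplicialComplex (Finset V)
  | 0 => K.map fun v => {v}
  | m + 1 => stellar (sdStage K m) (newVertices K m) vertexSimplex

/-- The barycentric subdivision, see `mem_sd_iff`. -/
def sd (K : PreAbstractSimplicialComplex V) : PreAbstractSimplicialComplex (Finset V) :=
  sdStage K (complexDim K)

theorem mem_vertexSimplex {σ τ : Finset V} : τ ∈ vertexSimplex σ ↔ ∃ v ∈ σ, {v} = τ := by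
  simp [vertexSimplex]

theorem vertexSimplex_subset_union {σ P : Finset V} {s B : Finset (Finset V)}
    (hs : ∀ τ ∈ s, τ ∈ vertexSimplex P ∨ τ ∈ B) (hB : ∀ τ ∈ B, 2 ≤ τ.card)
    (h : vertexSimplex σ ⊆ s) : σ ⊆ P := by
  intro v hv
  have h1 : ({v} : Finset V) ∈ vertexSimplex σ := mem_vertexSimplex.2 ⟨v, hv, rfl⟩
  rcases hs _ (h h1) with h2 | h2
  · obtain ⟨u, hu, huv⟩ := mem_vertexSimplex.1 h2
    rwa [Finset.singleton_inj.1 huv] at hu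
  · have := hB _ h2
    simp at this

/-- The simplices of `sdStage K m`. -/
theorem mem_sdStage_iff {K : PreAbstractSimplicialComplex V} (hK : IsFDLF K) (m : ℕ)
    (hm : m ≤ complexDim K) (s : Finset (Finset V)) :
    s ∈ (sdStage K m).faces ↔ s.Nonempty ∧ ∃ (P : Finset V) (B : Finset (Finset V)),
      (∀ τ, τ ∈ s ↔ τ ∈ vertexSimplex P ∨ τ ∈ B) ∧ (P.Nonempty → P ∈ K.faces) ∧
      P.card + m ≤ complexDim K + 1 ∧
      (∀ τ ∈ B, τ ∈ K.faces ∧ complexDim K + 1 < τ.card + m ∧ P ⊆ τ) ∧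
      ∀ τ ∈ B, ∀ τ' ∈ B, τ ⊆ τ' ∨ τ' ⊆ τ := by
  induction m generalizing s with
  | zero =>
    constructor
    · rintro ⟨P, hP, rfl⟩
      refine ⟨(Face.nonempty hP).image _, P, ∅, fun τ => by simp [vertexSimplex], fun _ => hP,
        card_le_complexDim hK hP, by simp, by simp⟩
    · rintro ⟨hs, P, B, hsPB, hP, -, hB, -⟩
      have hB0 : B = ∅ := by
        refine Finset.eq_empty_of_forall_notMem fun τ hτ => ?_
        have h1 := card_le_complexDim hK (hB τ hτ).1
        have h2 := (hB τ hτ).2.1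
        omega
      have hsP : s = vertexSimplex P := by
        ext τ
        simp [hsPB, hB0]
      subst hsP
      exact ⟨P, hP (Finset.image_nonempty.1 hs), rfl⟩
  | succ m ih =>
    have ih := ih (by omega)
    constructor
    · rintro (⟨hs, hN⟩ | ⟨σ, hσ, ρ, rfl, hρ, hN⟩)
      · obtain ⟨hne, P, B, hsPB, hP, hPc, hB, hch⟩ := (ih s).1 hs
        refine ⟨hne, P, B, hsPB, hP, ?_, fun τ hτ => ?_, hch⟩
        · by_contra hlt
          have hPc' : P.card + m = complexDim K + 1 := by omega
          refine hN P ⟨hP (Finset.card_pos.1 (by omega)), by omega, hPc'⟩ fun τ hτ => ?_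
          exact (hsPB τ).2 (Or.inl hτ)
        · obtain ⟨h1, h2, h3⟩ := hB τ hτ
          exact ⟨h1, by omega, h3⟩
      · obtain ⟨-, P', B', hsPB, hP', hPc, hB, hch⟩ := (ih _).1 hρ
        obtain ⟨hσK, hσ2, hσc⟩ := hσ
        have hB2 : ∀ τ ∈ B', 2 ≤ τ.card := fun τ hτ => by
          have := (hB τ hτ).2.1
          omega
        have hσP : σ = P' := by
          refine Finset.eq_of_subset_of_card_le (vertexSimplex_subset_union
            (fun τ hτ => (hsPB τ).1 hτ) hB2 Finset.subset_union_right) (by omega)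
        subst hσP
        have hρ' : ∀ τ ∈ ρ, τ ∈ vertexSimplex σ ∨ τ ∈ B' := fun τ hτ =>
          (hsPB τ).1 (Finset.mem_union_left _ hτ)
        have hsub : σ.filter (fun v => {v} ∈ ρ) ⊆ σ := Finset.filter_subset _ _
        refine ⟨Finset.insert_nonempty _ _, σ.filter (fun v => {v} ∈ ρ),
          insert σ (ρ.filter fun τ => τ ∈ B'), ?_, ?_, ?_, ?_, ?_⟩
        · intro τ
          simp only [Finset.mem_insert, Finset.mem_filter, mem_vertexSimplex]
          constructor
          · rintro (rfl | hτ)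
            · exact Or.inr (Or.inl rfl)
            · rcases hρ' τ hτ with h1 | h1
              · obtain ⟨v, hv, rfl⟩ := mem_vertexSimplex.1 h1
                exact Or.inl ⟨v, ⟨hv, hτ⟩, rfl⟩
              · exact Or.inr (Or.inr ⟨hτ, h1⟩)
          · rintro (⟨v, ⟨-, hv⟩, rfl⟩ | rfl | ⟨hτ, -⟩)
            · exact Or.inr hv
            · exact Or.inl rfl
            · exact Or.inr hτ
        · intro hne
          exact Face.down hσK hsub hne
        · have : (σ.filter fun v => {v} ∈ ρ).card < σ.card := by
            refine Finset.card_lt_card (Finset.ssubset_iff_subset_ne.2 ⟨hsub, fun he => ?_⟩)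
            refine hN σ ⟨hσK, hσ2, hσc⟩ fun τ hτ => ?_
            obtain ⟨v, hv, rfl⟩ := mem_vertexSimplex.1 hτ
            rw [← he] at hv
            exact (Finset.mem_filter.1 hv).2
          omega
        · intro τ hτ
          rcases Finset.mem_insert.1 hτ with rfl | hτ
          · exact ⟨hσK, by omega, hsub⟩
          · obtain ⟨h1, h2, h3⟩ := hB τ (Finset.mem_filter.1 hτ).2
            exact ⟨h1, by omega, hsub.trans h3⟩
        · intro τ hτ τ' hτ'
          rcases Finset.mem_insert.1 hτ with h1 | h1 <;>
            rcases Finset.mem_insert.1 hτ' with h2 | h2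
          · rw [h1, h2]
            exact Or.inl (Finset.Subset.refl _)
          · rw [h1]
            exact Or.inl (hB τ' (Finset.mem_filter.1 h2).2).2.2
          · rw [h2]
            exact Or.inr (hB τ (Finset.mem_filter.1 h1).2).2.2
          · exact hch τ (Finset.mem_filter.1 h1).2 τ' (Finset.mem_filter.1 h2).2
    · rintro ⟨hne, P, B, hsPB, hP, hPc, hB, hch⟩
      have hB2 : ∀ τ ∈ B, 2 ≤ τ.card := fun τ hτ => by
        have := (hB τ hτ).2.1
        omega
      have hnot : ∀ σ ∈ newVertices K m, ¬ vertexSimplex σ ⊆ s := by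
        rintro σ ⟨-, -, hσc⟩ hσs
        have := Finset.card_le_card
          (vertexSimplex_subset_union (fun τ hτ => (hsPB τ).1 hτ) hB2 hσs)
        omega
      by_cases hex : ∃ σ ∈ B, σ.card + m = complexDim K + 1
      · obtain ⟨σ, hσB, hσc⟩ := hex
        have hσs : σ ∈ s := (hsPB σ).2 (Or.inr hσB)
        have hσN : σ ∈ newVertices K m := ⟨(hB σ hσB).1, hB2 σ hσB, hσc⟩
        refine Or.inr ⟨σ, hσN, s.erase σ, (Finset.insert_erase hσs).symm, ?_,
          fun τ hτ h => hnot τ hτ (h.trans (Finset.erase_subset _ _))⟩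
        refine (ih _).2 ⟨?_, σ, B.erase σ, ?_, fun _ => (hB σ hσB).1, by omega, ?_, ?_⟩
        · obtain ⟨v, hv⟩ := Face.nonempty (hB σ hσB).1
          exact ⟨{v}, Finset.mem_union_right _ (mem_vertexSimplex.2 ⟨v, hv, rfl⟩)⟩
        · intro τ
          simp only [Finset.mem_union, Finset.mem_erase, hsPB]
          constructor
          · rintro (⟨hτσ, h1 | h1⟩ | h1)
            · obtain ⟨v, hv, rfl⟩ := mem_vertexSimplex.1 h1
              exact Or.inl (mem_vertexSimplex.2 ⟨v, (hB σ hσB).2.2 hv, rfl⟩)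
            · exact Or.inr ⟨hτσ, h1⟩
            · exact Or.inl h1
          · rintro (h1 | ⟨h1, h2⟩)
            · exact Or.inr h1
            · exact Or.inl ⟨h1, Or.inr h2⟩
        · intro τ hτ
          obtain ⟨hτσ, hτB⟩ := Finset.mem_erase.1 hτ
          obtain ⟨h1, h2, -⟩ := hB τ hτB
          have hστ : σ ⊆ τ := by
            rcases hch σ hσB τ hτB with h | h
            · exact h
            · exact (hτσ (Finset.eq_of_subset_of_card_le h (by omega))).elim
          have : σ.card < τ.card := Finset.card_lt_card
            (Finset.ssubset_iff_subset_ne.2 ⟨hστ, fun he => hτσ he.symm⟩)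
          exact ⟨h1, by omega, hστ⟩
        · intro τ hτ τ' hτ'
          exact hch τ (Finset.mem_of_mem_erase hτ) τ' (Finset.mem_of_mem_erase hτ')
      · push Not at hex
        refine Or.inl ⟨(ih s).2 ⟨hne, P, B, hsPB, hP, by omega, fun τ hτ => ?_, hch⟩, hnot⟩
        obtain ⟨h1, h2, h3⟩ := hB τ hτ
        have := hex τ hτ
        exact ⟨h1, by omega, h3⟩

/-- The simplices of the barycentric subdivision are the chains of simplices. -/
theorem mem_sd_iff {K : PreAbstractSimplicialComplex V} (hK : IsFDLF K) (s : Finset (Finset V)) :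
    s ∈ (sd K).faces ↔
      s.Nonempty ∧ (∀ σ ∈ s, σ ∈ K.faces) ∧ ∀ σ ∈ s, ∀ τ ∈ s, σ ⊆ τ ∨ τ ⊆ σ := by
  rw [sd, mem_sdStage_iff hK _ le_rfl]
  refine and_congr_right fun hne => ⟨?_, ?_⟩
  · rintro ⟨P, B, hsPB, hP, hPc, hB, hch⟩
    have hP1 : ∀ τ ∈ vertexSimplex P, τ = P := by
      intro τ hτ
      obtain ⟨v, hv, rfl⟩ := mem_vertexSimplex.1 hτ
      exact Finset.eq_of_subset_of_card_le (Finset.singleton_subset_iff.2 hv)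
        (by rw [Finset.card_singleton]; omega)
    have hPne : ∀ τ ∈ vertexSimplex P, P.Nonempty := fun τ hτ => by
      obtain ⟨v, hv, -⟩ := mem_vertexSimplex.1 hτ
      exact ⟨v, hv⟩
    refine ⟨fun σ hσ => ?_, fun σ hσ τ hτ => ?_⟩
    · rcases (hsPB σ).1 hσ with h | h
      · rw [hP1 σ h]
        exact hP (hPne σ h)
      · exact (hB σ h).1
    · rcases (hsPB σ).1 hσ with h | h <;> rcases (hsPB τ).1 hτ with h' | h'
      · rw [hP1 σ h, hP1 τ h']
        exact Or.inl (Finset.Subset.refl _)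
      · rw [hP1 σ h]
        exact Or.inl (hB τ h').2.2
      · rw [hP1 τ h']
        exact Or.inr (hB σ h).2.2
      · exact hch σ h τ h'
  · rintro ⟨hsK, hch⟩
    have hcard : ∀ σ ∈ s, ¬ 2 ≤ σ.card → ∃ v, σ = {v} := fun σ hσ h =>
      Finset.card_eq_one.1 (by
        have := (Face.nonempty (hsK σ hσ)).card_pos
        omega)
    by_cases hex : ∃ v : V, {v} ∈ s
    · obtain ⟨v, hv⟩ := hex
      have huniq : ∀ u, {u} ∈ s → u = v := fun u hu => by
        rcases hch _ hu _ hv with h | h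
        · simpa using h
        · simpa [eq_comm] using h
      refine ⟨{v}, s.filter fun σ => 2 ≤ σ.card, fun τ => ?_, fun _ => hsK _ hv, ?_, ?_, ?_⟩
      · simp only [vertexSimplex, Finset.image_singleton, Finset.mem_singleton,
          Finset.mem_filter]
        constructor
        · intro hτ
          by_cases h2 : 2 ≤ τ.card
          · exact Or.inr ⟨hτ, h2⟩
          · obtain ⟨u, rfl⟩ := hcard τ hτ h2
            rw [huniq u hτ]
            exact Or.inl rfl
        · rintro (rfl | h)
          · exact hv
          · exact h.1
      · rw [Finset.card_singleton]
        omega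
      · intro τ hτ
        obtain ⟨h1, h2⟩ := Finset.mem_filter.1 hτ
        refine ⟨hsK τ h1, by omega, ?_⟩
        rcases hch _ hv _ h1 with h | h
        · exact h
        · have := Finset.card_le_card h
          rw [Finset.card_singleton] at this
          omega
      · intro τ hτ τ' hτ'
        exact hch τ (Finset.mem_filter.1 hτ).1 τ' (Finset.mem_filter.1 hτ').1
    · refine ⟨∅, s, fun τ => by simp [vertexSimplex], by simp, by simp, fun τ hτ => ?_, hch⟩
      refine ⟨hsK τ hτ, ?_, Finset.empty_subset _⟩
      by_contra h2
      obtain ⟨u, rfl⟩ := hcard τ hτ (by omega)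
      exact hex ⟨u, hτ⟩

/-- Each step in the construction of `sd K` is a simultaneous disjoint stellar subdivision. -/
theorem isDisjointStellar_sdStage {K : PreAbstractSimplicialComplex V} (hK : IsFDLF K) (m : ℕ) :
    IsDisjointStellar (sdStage K m) (newVertices K m) vertexSimplex := by
  by_cases hm : m < complexDim K
  swap
  · have hempty : ∀ σ ∈ newVertices K m, False := by
      rintro σ ⟨-, h1, h2⟩
      omega
    exact ⟨fun σ hσ => (hempty σ hσ).elim, fun σ hσ => (hempty σ hσ).elim,
      fun _ _ σ hσ => (hempty σ hσ).elim⟩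
  constructor
  · rintro σ ⟨hσ, hσ2, hσc⟩
    refine (mem_sdStage_iff hK m hm.le _).2 ⟨(Face.nonempty hσ).image _, σ, ∅, by simp,
      fun _ => hσ, by omega, by simp, by simp⟩
  · rintro σ ⟨-, hσ2, hσc⟩ s hs hσs
    obtain ⟨-, P, B, hsPB, -, -, hB, -⟩ := (mem_sdStage_iff hK m hm.le s).1 hs
    rcases (hsPB σ).1 hσs with h | h
    · obtain ⟨v, -, rfl⟩ := mem_vertexSimplex.1 h
      rw [Finset.card_singleton] at hσ2
      omega
    · have := (hB σ h).2.1
      omega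
  · rintro s hs σ ⟨-, hσ2, hσc⟩ τ ⟨-, -, hτc⟩ hσs hτs
    obtain ⟨-, P, B, hsPB, -, hPc, hB, -⟩ := (mem_sdStage_iff hK m hm.le s).1 hs
    have hB2 : ∀ τ ∈ B, 2 ≤ τ.card := fun τ hτ => by
      have := (hB τ hτ).2.1
      omega
    have h1 := vertexSimplex_subset_union (fun τ hτ => (hsPB τ).1 hτ) hB2 hσs
    have h2 := vertexSimplex_subset_union (fun τ hτ => (hsPB τ).1 hτ) hB2 hτs
    rw [Finset.eq_of_subset_of_card_le h1 (by omega), Finset.eq_of_subset_of_card_le h2 (by omega)]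

theorem isFDLF_sdStage {K : PreAbstractSimplicialComplex V} (hK : IsFDLF K) (m : ℕ) :
    IsFDLF (sdStage K m) := by
  induction m with
  | zero =>
    constructor
    · obtain ⟨n, hn⟩ := hK.finite_dimensional
      refine ⟨n, ?_⟩
      rintro _ ⟨s, hs, rfl⟩
      exact Finset.card_image_le.trans (hn s hs)
    · intro τ
      by_cases hτ : ∃ v, τ = {v}
      · obtain ⟨v, rfl⟩ := hτ
        refine ((hK.locally_finite v).image vertexSimplex).subset ?_
        rintro _ ⟨⟨s, hs, rfl⟩, hv⟩
        refine ⟨s, ⟨hs, ?_⟩, rfl⟩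
        simpa using hv
      · refine Set.finite_empty.subset ?_
        rintro _ ⟨⟨s, hs, rfl⟩, hv⟩
        obtain ⟨v, -, rfl⟩ := Finset.mem_image.1 hv
        exact hτ ⟨v, rfl⟩
  | succ m ih => exact (isDisjointStellar_sdStage hK m).isFDLF ih

theorem isFDLF_sd {K : PreAbstractSimplicialComplex V} (hK : IsFDLF K) : IsFDLF (sd K) :=
  isFDLF_sdStage hK _

/-- A choice of a vertex `c(σ) ∈ σ` for every simplex `σ`.  It determines the simplicial
approximation to the identity `r : Sd K → K` that sends the barycentre of `σ` to `c(σ)`. -/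
structure VertexChoice (K : PreAbstractSimplicialComplex V) where
  /-- The vertex chosen in a simplex. -/
  vertex : Face K → V
  vertex_mem : ∀ σ, vertex σ ∈ σ.1

open Classical in
/-- The image of the barycentre `σ` as a vertex `{v}` of the intermediate subdivisions. -/
def VertexChoice.toMap {K : PreAbstractSimplicialComplex V} (c : VertexChoice K)
    (σ : Finset V) : Finset V :=
  if h : σ ∈ K.faces then {c.vertex ⟨σ, h⟩} else σ

theorem VertexChoice.toMap_mem {K : PreAbstractSimplicialComplex V} (c : VertexChoice K) (m : ℕ) :
    ∀ σ ∈ newVertices K m, c.toMap σ ∈ vertexSimplex σ := by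
  rintro σ ⟨hσ, -⟩
  rw [VertexChoice.toMap, dif_pos hσ]
  exact mem_vertexSimplex.2 ⟨_, c.vertex_mem ⟨σ, hσ⟩, rfl⟩

/-- The bijection between the simplices of `K` and those of `K` with each vertex `v` renamed
`{v}`. -/
def renameEquiv (K : PreAbstractSimplicialComplex V) : Face K ≃ Face (sdStage K 0) :=
  Equiv.ofBijective (fun s => ⟨vertexSimplex s.1, s.1, s.2, rfl⟩) <| by
    constructor
    · intro s t hst
      have := congrArg Subtype.val hst
      exact Subtype.ext (Finset.image_injective Finset.singleton_injective this)
    · rintro ⟨_, s, hs, rfl⟩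
      exact ⟨⟨s, hs⟩, rfl⟩

end Barycentric

section Subdivision

variable {V : Type w} [DecidableEq V] {A : Type u} [Category.{v} A] [Preadditive A]
  {K : PreAbstractSimplicialComplex V} {var : Variance}

theorem rel_renameEquiv (var : Variance) (K : PreAbstractSimplicialComplex V) (s t : Face K)
    (h : var.rel K s t) : var.rel _ (renameEquiv K s) (renameEquiv K t) := by
  cases var
  · exact Finset.image_subset_image h
  · exact Finset.image_subset_image h

/-- The subdivision of `C` on the intermediate complexes. -/
def subdivStage (hK : IsFDLF K) (c : VertexChoice K) (C : ACplx A var K) :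
    ∀ m : ℕ, ACplx A var (sdStage K m)
  | 0 => ((Graded.reindex (renameEquiv K) _ _ (rel_renameEquiv var K) A).mapHomologicalComplex
      _).obj C
  | m + 1 => subdivStellar (isDisjointStellar_sdStage hK m) (c.toMap_mem m) (isFDLF_sdStage hK m)
      (subdivStage hK c C m)

/-- The algebraic subdivision `Sd_r C` of a chain complex in `A(K)` along the barycentric
subdivision, for the simplicial approximation `r` to the identity given by a choice of vertices:
the composition of the algebraic subdivisions for the successive simultaneous disjoint stellar
subdivisions. -/
def subdiv (hK : IsFDLF K) (c : VertexChoice K) (C : ACplx A var K) : ACplx A var (sd K) :=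
  subdivStage hK c C (complexDim K)

end Subdivision

/-! ### Iterated barycentric subdivisions -/

/-- The vertices of the `j`-th barycentric subdivision: those of the next one are simplices. -/
def SdVertex (V : Type w) : ℕ → Type w
  | 0 => V
  | j + 1 => Finset (SdVertex V j)

instance (V : Type w) (j : ℕ) : DecidableEq (SdVertex V j) := Classical.decEq _

/-- The `j`-th barycentric subdivision `Sd^j X`. -/
def sdIter {V : Type w} (X : PreAbstractSimplicialComplex V) :
    ∀ j : ℕ, PreAbstractSimplicialComplex (SdVertex V j)
  | 0 => X
  | j + 1 => sd (sdIter X j)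

theorem isFDLF_sdIter {V : Type w} {X : PreAbstractSimplicialComplex V} (hX : IsFDLF X) :
    ∀ j : ℕ, IsFDLF (sdIter X j)
  | 0 => hX
  | j + 1 => isFDLF_sd (isFDLF_sdIter hX j)

/-- The iterated algebraic subdivision `Sd_{r_{i-1}} ∘ ⋯ ∘ Sd_{r_0}`, which is `Sd_r` for
`r = r_0 ∘ ⋯ ∘ r_{i-1} : Sd^i X → X`.  The maps `r_j` are given by choices of vertices. -/
def subdivIter {V : Type w} {X : PreAbstractSimplicialComplex V} (hX : IsFDLF X)
    (r : ∀ j, VertexChoice (sdIter X j)) {A : Type u} [Category.{v} A] [Preadditive A]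
    {var : Variance} (C : ACplx A var X) : ∀ i : ℕ, ACplx A var (sdIter X i)
  | 0 => C
  | i + 1 => subdiv (isFDLF_sdIter hX i) (r i) (subdivIter hX r C i)

/-! ### Geometry: barycentres and the standard metric -/

section Geometry

variable {V : Type w}

/-- The barycentre of the points `p x`, `x ∈ s`. -/
def barycentre {W : Type w} (p : W → V →₀ ℝ) (s : Finset W) : V →₀ ℝ :=
  (s.card : ℝ)⁻¹ • ∑ x ∈ s, p x

/-- The position of the vertices of `Sd^j X` in the realisation of `X`, whose points are given by
their barycentric coordinates in `V →₀ ℝ`. -/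
def position (V : Type w) : ∀ j : ℕ, SdVertex V j → V →₀ ℝ
  | 0, x => Finsupp.single x 1
  | j + 1, s => barycentre (position V j) s

/-- The closed simplex of the realisation of `X` which is spanned by `s`. -/
def cell (s : Finset V) : Set (V →₀ ℝ) :=
  {x | (∀ v, 0 ≤ x v) ∧ x.support ⊆ s ∧ ∑ v ∈ s, x v = 1}

/-- The Euclidean distance of barycentric coordinates. -/
def euclDist (x y : V →₀ ℝ) : ℝ := Real.sqrt ((x - y).sum fun _ a => a ^ 2)

/-- The standard metric of the realisation of `X`, the path metric which restricts to the
Euclidean metric on each simplex: the infimum of the lengths of the piecewise linear paths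
`p 0, …, p m` from `x` to `y`, each of whose segments lies in a simplex of `X`. It is infinite for
points in different components. -/
def stdDist (X : PreAbstractSimplicialComplex V) (x y : V →₀ ℝ) : ENNReal :=
  ⨅ (m : ℕ) (p : ℕ → V →₀ ℝ) (_ : p 0 = x ∧ p m = y ∧
    ∀ k < m, ∃ s ∈ X.faces, p k ∈ cell s ∧ p (k + 1) ∈ cell s),
    ∑ k ∈ Finset.range m, ENNReal.ofReal (euclDist (p k) (p (k + 1)))

/-- The distance of a point from a set in the standard metric. -/
def stdDistTo (X : PreAbstractSimplicialComplex V) (x : V →₀ ℝ) (S : Set (V →₀ ℝ)) : ENNReal :=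
  ⨅ y ∈ S, stdDist X x y

/-- The open simplex with vertices `p x`, `x ∈ s`. -/
def openSimplex {W : Type w} (p : W → V →₀ ℝ) (s : Finset W) : Set (V →₀ ℝ) :=
  {y | ∃ a : W → ℝ, (∀ x ∈ s, 0 < a x) ∧ ∑ x ∈ s, a x = 1 ∧ y = ∑ x ∈ s, a x • p x}

/-- A family of simplicial approximations to the identity `r_j : Sd^{j+1} X → Sd^j X` which
retract towards the boundary: `r_0` is arbitrary, and for `j ≥ 1` the barycentre of a simplex `τ`
of `Sd^j X` is sent to a vertex of `τ` with the following property. Let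
`ρ = { σ_0 < ⋯ < σ_n }` be the simplex of `Sd X` whose interior contains the interior of `τ`. If
`n ≥ 1`, then the vertex is as close as possible, among the vertices of `τ`, to the face of `ρ`
spanned by the barycentres of `σ_0, …, σ_{n-1}`. -/
structure RetractionFamily (X : PreAbstractSimplicialComplex V) where
  /-- The vertices `r_j(barycentre of τ) ∈ τ`. -/
  r : ∀ j, VertexChoice (sdIter X j)
  nearest : ∀ j, 1 ≤ j → ∀ (τ : Face (sdIter X j)) (ρ : Face (sdIter X 1)),
    openSimplex (position V j) τ.1 ⊆ openSimplex (position V 1) ρ.1 →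
    ∀ top : Finset V, top ∈ ρ.1 → (∀ σ : Finset V, σ ∈ ρ.1 → σ ⊆ top) →
    (∃ σ : Finset V, σ ∈ ρ.1 ∧ σ ≠ top) → ∀ x ∈ τ.1,
      stdDistTo X (position V j ((r j).vertex τ))
          (convexHull ℝ (position V 1 '' {σ : Finset V | σ ∈ ρ.1 ∧ σ ≠ top})) ≤
        stdDistTo X (position V j x)
          (convexHull ℝ (position V 1 '' {σ : Finset V | σ ∈ ρ.1 ∧ σ ≠ top}))

/-- The distance between the barycentres of two simplices of `Sd^i X`, measured in `X`. -/
def controlDist (X : PreAbstractSimplicialComplex V) (i : ℕ) (σ τ : Face (sdIter X i)) : ENNReal :=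
  stdDist X (barycentre (position V i) σ.1) (barycentre (position V i) τ.1)

end Geometry

/-! ### Controlled chain equivalences -/

section Control

variable {I : Type w} {R : I → I → Prop} [IsPreorder I R] {A : Type u} [Category.{v} A]
  [Preadditive A]

/-- The bound of a graded morphism: the supremum of the distances `d i j` over its nonzero
components. -/
def bound (d : I → I → ENNReal) {M N : Graded I R A} (f : M ⟶ N) : ENNReal :=
  ⨆ (i : I) (j : I) (_ : f.comp i j ≠ 0), d i j

/-- A chain equivalence (a chain map, an inverse up to homotopy and two homotopies) all of whose
constituents have bound at most `ε`. -/
structure HasControl (d : I → I → ENNReal) (ε : ENNReal)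
    {C D : HomologicalComplex (Graded I R A) (ComplexShape.down ℤ)} (e : HomotopyEquiv C D) :
    Prop where
  hom : ∀ n, bound d (e.hom.f n) ≤ ε
  inv : ∀ n, bound d (e.inv.f n) ≤ ε
  homotopy_hom_inv : ∀ n m, bound d (e.homotopyHomInvId.hom n m) ≤ ε
  homotopy_inv_hom : ∀ n m, bound d (e.homotopyInvHomId.hom n m) ≤ ε

/-- A chain complex is finite if only finitely many of its objects are nonzero. -/
def IsFiniteComplex (C : HomologicalComplex (Graded I R A) (ComplexShape.down ℤ)) : Prop :=
  {n | ¬ IsZero (C.X n)}.Finite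

end Control

end

/-!
# Squeezing

A chain equivalence `Sd_r C ≃ Sd_r D` is pulled back through the subdivisions, one at a time, and
its constituents are shown to become more and more local, until at level `0` they lie in `A(X)`.

*Pulling back.*  Complexes over different simplicial complexes are compared in one category, that
of families of objects with arbitrary index sets (`Fam`, `famCplx`).  In it a complex is a
deformation retract of its stellar subdivision: the identity components of the differential between
`s` and `s * r(x)`, for a new vertex `x ∈ s`, can be cancelled by Gaussian elimination
(`exists_deformationRetract_of_elimination`, `hasGoodRetraction_subdivStellar`).  Hence an
equivalence between subdivisions induces one between the original complexes.  All maps and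
homotopies occurring here move simplices in a few ways only: to a face, or by adding the new vertex
`x` to a simplex that contains the starred simplex, or by adding `r(x)` to a simplex that contains
`x`.  Control in terms of predicates on simplices that are closed under these moves is therefore
inherited without any loss (`exists_controlled_of_subdiv`), no matter how many subdivisions are
passed; the two maps lead from a predicate `P` to `Q` and from `Q` to `R`, the homotopies from `P`
to `R`.

*Closed predicates.*  Three kinds are used.  Conditions on the carrier of a simplex in `X`
(`levelClosed_carrier`).  Conditions on the carrier in `Sd^J X`, when the level is at least `J`
(`levelClosed_lift`); they turn the `ε`-control at level `i` into estimates for all barycentric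
coordinates at level `J`, with an error of size `ε` plus the mesh of `Sd^J X`
(`IsSqueezingSequence.apply_le`).  Finally, `NearBoundary τ δ` for a simplex `τ` of `X`: each vertex
of the simplex has a coordinate `≤ δ` in `τ`, and the carrier does not contain `τ` properly.  That
this is closed, at levels at least `1`, is where the condition on the retractions enters.  If `κ`
is a simplex of `Sd^j X` with carrier `τ`, lying in the simplex `σ₀ < ⋯ < σₙ = τ` of `Sd X`, then
the distance of a point from the face spanned by `σ₀, …, σₙ₋₁` is proportional to its coordinate at
the barycentre of `τ` (`stdDistTo_opposite_face`), and this is the coordinate at any vertex of `τ`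
that is not in `σₙ₋₁`, up to a factor.  So the retraction does not increase the coordinate at such a
vertex, which is also the smallest of all the coordinates in `τ`
(`RetractionFamily.exists_minimal_coordinate`).

*Squeezing.*  Let `n = dim X` and choose levels `1 = J₀ ≤ J₁ ≤ ⋯ ≤ Jₙ₊₁`, where the mesh of
`Sd^{J_{m+1}} X` is small in comparison with the nonzero coordinates of the vertices of
`Sd^{J_m} X`.  By downward induction on `m`, at level `J_m` the components only lead to simplices
whose carrier is contained in that of the source or has at most `m` vertices (`SqueezedAbove`).  For
`m = n + 1` there is nothing to prove.  Given the claim for `m + 1` and a set `τ` of `m + 1`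
vertices, the estimates for the coordinates at level `J_{m+1}` show that the maps lead from
`NearBoundary τ δ` to `NearBoundary τ (δ + η)`, with `η` small.  This persists down to level `J_m`,
where coordinates `≤ 2 η` vanish: a component which leads into the interior of `τ` must come from a
simplex whose carrier contains `τ` (`SqueezedAbove.step`).  For `m = 0` the statement passes
from level `1` to level `0` and says that the components respect the face relation of `X`.
-/

noncomputable section

/-! ### Families of objects over varying index sets -/

/-- Families of objects of `A`, over arbitrary index sets.  Together with the column-finite
matrices as morphisms they form a category which contains the categories `G_K(A)` of all
complexes `K` at once, so that a complex over `K` can be compared with one over a subdivision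
of `K`. -/
structure Fam (A : Type u) where
  /-- The index set. -/
  I : Type w
  /-- The objects of the family. -/
  obj : I → A

namespace Fam

variable {A : Type u} [Category.{v} A] [Preadditive A]

/-- A column-finite matrix of morphisms. -/
@[ext]
structure Hom (M N : Fam.{w} A) where
  /-- The component from the index `i` to the index `j`. -/
  comp : ∀ i j, M.obj i ⟶ N.obj j
  finite_column : ∀ i, {j | comp i j ≠ 0}.Finite

/-- The entries of a product of matrices. -/
def Hom.compSum {L M N : Fam.{w} A} (f : Hom L M) (g : Hom M N) (i : L.I) (k : N.I) :
    L.obj i ⟶ N.obj k :=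
  ∑ j ∈ (f.finite_column i).toFinset, f.comp i j ≫ g.comp j k

theorem Hom.compSum_eq_sum {L M N : Fam.{w} A} (f : Hom L M) (g : Hom M N) (i : L.I) (k : N.I)
    (T : Finset M.I) (hT : ∀ j, f.comp i j ≠ 0 → j ∈ T) :
    compSum f g i k = ∑ j ∈ T, f.comp i j ≫ g.comp j k := by
  refine Finset.sum_subset (fun j hj => hT j (by simpa using hj)) ?_
  intro j _ hj
  have : f.comp i j = 0 := by simpa using hj
  simp [this]

theorem Hom.exists_of_compSum_ne_zero {L M N : Fam.{w} A} {f : Hom L M} {g : Hom M N} {i : L.I}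
    {k : N.I} (h : compSum f g i k ≠ 0) : ∃ j, f.comp i j ≠ 0 ∧ g.comp j k ≠ 0 := by
  obtain ⟨j, -, hj⟩ := Finset.exists_ne_zero_of_sum_ne_zero h
  exact ⟨j, fun h => hj (by simp [h]), fun h => hj (by simp [h])⟩

open Classical in
instance : Category (Fam.{w} A) where
  Hom := Hom
  id M :=
    { comp := fun i j => if h : i = j then eqToHom (congrArg M.obj h) else 0
      finite_column := fun i => (Set.finite_singleton i).subset fun j hj => by
        by_contra hij
        exact hj (dif_neg fun h => hij h.symm) }
  comp f g :=
    { comp := Hom.compSum f g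
      finite_column := fun i => by
        refine ((f.finite_column i).biUnion fun j _ => g.finite_column j).subset ?_
        intro k hk
        obtain ⟨j, h1, h2⟩ := Hom.exists_of_compSum_ne_zero hk
        simp only [Set.mem_iUnion]
        exact ⟨j, h1, h2⟩ }
  id_comp {M N} f := by
    refine Hom.ext (funext fun i => funext fun k => ?_)
    refine (Hom.compSum_eq_sum _ f i k {i} fun j hj => ?_).trans ?_
    · by_contra hij
      exact hj (dif_neg fun h => hij (by simp [h]))
    · simp
  comp_id {M N} f := by
    refine Hom.ext (funext fun i => funext fun k => ?_)
    refine (Hom.compSum_eq_sum f _ i k (insert k (f.finite_column i).toFinset) fun j hj => by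
      simp [hj]).trans ?_
    rw [Finset.sum_eq_single k]
    · simp
    · intro j _ hj
      simp [hj]
    · simp
  assoc {K L M N} f g h := by
    refine Hom.ext (funext fun i => funext fun l => ?_)
    refine (Hom.compSum_eq_sum _ h i l
      ((f.finite_column i).biUnion fun j _ => g.finite_column j).toFinset (by
        intro k hk
        obtain ⟨j, h1, h2⟩ := Hom.exists_of_compSum_ne_zero hk
        simp only [Set.Finite.mem_toFinset, Set.mem_iUnion]
        exact ⟨j, h1, h2⟩)).trans ?_
    simp only [Hom.compSum, Preadditive.sum_comp, Category.assoc]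
    rw [Finset.sum_comm]
    refine Finset.sum_congr rfl fun j hj => ?_
    rw [← Preadditive.comp_sum]
    congr 1
    symm
    refine Hom.compSum_eq_sum g h j l _ fun k hk => ?_
    simp only [Set.Finite.mem_toFinset, Set.mem_iUnion]
    exact ⟨j, by simpa using hj, hk⟩

variable {L M N : Fam.{w} A}

@[ext]
theorem hom_ext {f g : M ⟶ N} (h : ∀ i j, f.comp i j = g.comp i j) : f = g :=
  Hom.ext (funext fun i => funext fun j => h i j)

theorem id_comp_self (i : M.I) : (𝟙 M : M ⟶ M).comp i i = 𝟙 _ := dif_pos rfl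

theorem id_comp_ne {i j : M.I} (h : i ≠ j) : (𝟙 M : M ⟶ M).comp i j = 0 := dif_neg h

theorem comp_comp_eq_sum (f : L ⟶ M) (g : M ⟶ N) (i : L.I) (k : N.I)
    (T : Finset M.I) (hT : ∀ j, f.comp i j ≠ 0 → j ∈ T) :
    (f ≫ g).comp i k = ∑ j ∈ T, f.comp i j ≫ g.comp j k :=
  Hom.compSum_eq_sum f g i k T hT

theorem exists_of_comp_ne_zero {f : L ⟶ M} {g : M ⟶ N} {i : L.I} {k : N.I}
    (h : (f ≫ g).comp i k ≠ 0) : ∃ j, f.comp i j ≠ 0 ∧ g.comp j k ≠ 0 :=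
  Hom.exists_of_compSum_ne_zero h

/-- An entry of a product to which only one intermediate index contributes. -/
theorem comp_comp_eq_single (f : L ⟶ M) (g : M ⟶ N) (i : L.I) (k : N.I) (j : M.I)
    (hj : ∀ j', j' ≠ j → f.comp i j' ≠ 0 → g.comp j' k = 0) :
    (f ≫ g).comp i k = f.comp i j ≫ g.comp j k := by
  classical
  rw [comp_comp_eq_sum f g i k (insert j (f.finite_column i).toFinset) fun j hj => by simp [hj]]
  refine Finset.sum_eq_single j (fun j' _ hne => ?_) (fun h => by simp at h)
  by_cases h : f.comp i j' = 0
  · simp [h]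
  · simp [hj j' hne h]

theorem comp_comp_eq_zero (f : L ⟶ M) (g : M ⟶ N) (i : L.I) (k : N.I)
    (hj : ∀ j, f.comp i j ≠ 0 → g.comp j k = 0) : (f ≫ g).comp i k = 0 := by
  by_contra h
  obtain ⟨j, h1, h2⟩ := exists_of_comp_ne_zero h
  exact h2 (hj j h1)

instance : Zero (M ⟶ N) where
  zero := { comp := fun _ _ => 0, finite_column := fun i => by simp }

instance : Add (M ⟶ N) where
  add f g :=
    { comp := fun i j => f.comp i j + g.comp i j
      finite_column := fun i =>
        ((f.finite_column i).union (g.finite_column i)).subset fun j hj => by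
        by_contra hc
        simp only [Set.mem_union, Set.mem_ofPred_eq, not_or, not_not] at hc
        exact hj (by simp [hc.1, hc.2]) }

instance : Neg (M ⟶ N) where
  neg f :=
    { comp := fun i j => -f.comp i j
      finite_column := fun i => (f.finite_column i).subset fun j hj => by simpa using hj }

theorem add_comp_apply (f g : M ⟶ N) (i : M.I) (j : N.I) :
    (f + g).comp i j = f.comp i j + g.comp i j := rfl

theorem neg_comp_apply (f : M ⟶ N) (i : M.I) (j : N.I) : (-f).comp i j = -f.comp i j := rfl

instance : AddCommGroup (M ⟶ N) where
  add_assoc f g h := hom_ext fun i j => add_assoc _ _ _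
  zero_add f := hom_ext fun i j => zero_add _
  add_zero f := hom_ext fun i j => add_zero _
  nsmul := nsmulRec
  zsmul := zsmulRec
  neg_add_cancel f := hom_ext fun i j => neg_add_cancel _
  add_comm f g := hom_ext fun i j => add_comm _ _

theorem sub_comp_apply (f g : M ⟶ N) (i : M.I) (j : N.I) :
    (f - g).comp i j = f.comp i j - g.comp i j := by
  rw [sub_eq_add_neg, add_comp_apply, neg_comp_apply, sub_eq_add_neg]

instance : Preadditive (Fam.{w} A) where
  add_comp L M N f f' g := by
    classical
    ext i k
    rw [add_comp_apply]
    let T := (f.finite_column i).toFinset ∪ (f'.finite_column i).toFinset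
    rw [comp_comp_eq_sum f g i k T fun j hj => by simp [T, hj],
      comp_comp_eq_sum f' g i k T fun j hj => by simp [T, hj],
      comp_comp_eq_sum (f + f') g i k T fun j hj => by
        by_contra hc
        simp only [T, Finset.mem_union, Set.Finite.mem_toFinset, Set.mem_ofPred_eq, not_or,
          not_not] at hc
        exact hj (by rw [add_comp_apply, hc.1, hc.2, add_zero]), ← Finset.sum_add_distrib]
    simp [add_comp_apply]
  comp_add L M N f g g' := by
    ext i k
    change Hom.compSum f (g + g') i k = Hom.compSum f g i k + Hom.compSum f g' i k
    simp [Hom.compSum, add_comp_apply, Finset.sum_add_distrib]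

/-! ### Monomial matrices -/

open Classical in
/-- The matrix whose entry from `i` to `j` is `z` times the identity if `R i j`, and `0`
otherwise.  Each source index is related to at most one target index. -/
def mono (M N : Fam.{w} A) (z : ℤ) (R : M.I → N.I → Prop)
    (hR : ∀ i j j', R i j → R i j' → j = j') (e : ∀ i j, R i j → M.obj i = N.obj j) :
    M ⟶ N where
  comp i j := if h : R i j then z • eqToHom (e i j h) else 0
  finite_column i := by
    refine Set.Subsingleton.finite fun j hj j' hj' => hR i j j' ?_ ?_
    · by_contra h
      exact hj (dif_neg h)
    · by_contra h
      exact hj' (dif_neg h)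

section mono

variable {z : ℤ} {R : M.I → N.I → Prop} {hR : ∀ i j j', R i j → R i j' → j = j'}
  {e : ∀ i j, R i j → M.obj i = N.obj j}

theorem mono_of {i : M.I} {j : N.I} (h : R i j) :
    (mono M N z R hR e).comp i j = z • eqToHom (e i j h) := dif_pos h

theorem mono_not {i : M.I} {j : N.I} (h : ¬R i j) : (mono M N z R hR e).comp i j = 0 := dif_neg h

theorem rel_of_mono_ne_zero {i : M.I} {j : N.I} (h : (mono M N z R hR e).comp i j ≠ 0) :
    R i j := by
  by_contra hn
  exact h (mono_not hn)

theorem mono_comp_of {P : Fam.{w} A} (g : N ⟶ P) {i : M.I} {j : N.I} (h : R i j) (k : P.I) :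
    (mono M N z R hR e ≫ g).comp i k = z • (eqToHom (e i j h) ≫ g.comp j k) := by
  rw [comp_comp_eq_single _ _ i k j fun j' hne h' =>
    (hne (hR i j' j (rel_of_mono_ne_zero h') h)).elim, mono_of h, Preadditive.zsmul_comp]

theorem mono_comp_not {P : Fam.{w} A} (g : N ⟶ P) {i : M.I} (h : ∀ j, ¬R i j) (k : P.I) :
    (mono M N z R hR e ≫ g).comp i k = 0 :=
  comp_comp_eq_zero _ _ _ _ fun j hj => (h j (rel_of_mono_ne_zero hj)).elim

theorem comp_mono_of {P : Fam.{w} A} (g : P ⟶ M) (hR' : ∀ i i' j, R i j → R i' j → i = i')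
    {i : M.I} {j : N.I} (h : R i j) (k : P.I) :
    (g ≫ mono M N z R hR e).comp k j = z • (g.comp k i ≫ eqToHom (e i j h)) := by
  rw [comp_comp_eq_single _ _ k j i fun i' hne _ => mono_not fun h' => hne (hR' i' i j h' h),
    mono_of h, Preadditive.comp_zsmul]

end mono

/-! ### Matrices that respect predicates on the index sets -/

/-- With `lower` variance, the nonzero entries of `f` lead from indices satisfying `P` to indices
satisfying `Q`; with `upper` variance an entry is read from its target to its source. -/
def Respects (var : Variance) (P : M.I → Prop) (Q : N.I → Prop) (f : M ⟶ N) : Prop :=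
  ∀ i j, f.comp i j ≠ 0 → match var with
    | .lower => P i → Q j
    | .upper => Q j → P i

namespace Respects

variable {var : Variance} {P : L.I → Prop} {Q : M.I → Prop} {S : N.I → Prop}

theorem comp {f : L ⟶ M} {g : M ⟶ N} (hf : Respects var P Q f) (hg : Respects var Q S g) :
    Respects var P S (f ≫ g) := by
  intro i k h
  obtain ⟨j, h1, h2⟩ := exists_of_comp_ne_zero h
  have h3 := hf i j h1
  have h4 := hg j k h2
  cases var
  · exact fun h => h4 (h3 h)
  · exact fun h => h3 (h4 h)

theorem zero : Respects var P Q (0 : L ⟶ M) := fun _ _ h => (h rfl).elim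

theorem add {f g : L ⟶ M} (hf : Respects var P Q f) (hg : Respects var P Q g) :
    Respects var P Q (f + g) := by
  intro i j h
  by_cases h1 : f.comp i j = 0
  · exact hg i j fun h2 => h (by rw [add_comp_apply, h1, h2, add_zero])
  · exact hf i j h1

theorem neg {f : L ⟶ M} (hf : Respects var P Q f) : Respects var P Q (-f) := fun i j h =>
  hf i j fun h1 => h (by rw [neg_comp_apply, h1, neg_zero])

theorem sub {f g : L ⟶ M} (hf : Respects var P Q f) (hg : Respects var P Q g) :
    Respects var P Q (f - g) := by
  rw [sub_eq_add_neg]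
  exact hf.add hg.neg

end Respects

end Fam

/-! ### Graded objects as families -/

namespace Graded

variable {A : Type u} [Category.{v} A] [Preadditive A]

/-- A graded object is a family, and graded morphisms are column-finite matrices. -/
def toFam (I : Type w) : Graded I (fun _ _ => True) A ⥤ Fam.{w} A where
  obj M := ⟨I, M.obj⟩
  map f := ⟨f.comp, f.finite_column⟩
  map_id _ := rfl
  map_comp _ _ := rfl

instance (I : Type w) : (toFam (A := A) I).Additive where
  map_add := rfl

end Graded

/-- A chain complex in `A(K)` as a chain complex of families. -/
abbrev famCplx {W : Type w} {A : Type u} [Category.{v} A] [Preadditive A] {var : Variance}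
    {K : PreAbstractSimplicialComplex W} (C : ACplx A var K) :
    HomologicalComplex (Fam.{w} A) (ComplexShape.down ℤ) :=
  ((Graded.toFam (Face K)).mapHomologicalComplex _).obj ((toG A var K).obj C)

/-! ### Gaussian elimination for chain complexes -/

section Reduction

variable {𝒞 : Type u} [Category.{v} 𝒞] [Preadditive 𝒞]

/-- Gaussian elimination, without splitting the objects: `h` inverts the part of the differential
of `S` which is to be cancelled, `h'` is that part, and `a`, `b` are the inclusion of and the
projection to what remains. The differential that remains is `b d a - b d h d a` (in the usual
order of composition); if it is that of `C`, then `C` is a deformation retract of `S`.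

With `p = 1 - d h - h d`, a chain map homotopic to the identity, the projection is `b p` and the
inclusion is `p a`. -/
theorem exists_deformationRetract_of_elimination
    (S C : HomologicalComplex 𝒞 (ComplexShape.down ℤ))
    (a : ∀ n, C.X n ⟶ S.X n) (b : ∀ n, S.X n ⟶ C.X n) (h h' : ∀ i j, S.X i ⟶ S.X j)
    (h_zero : ∀ i j, i + 1 ≠ j → h i j = 0)
    (ab : ∀ i, a i ≫ b i = 𝟙 _) (ah : ∀ i j, a i ≫ h i j = 0) (hb : ∀ i j, h i j ≫ b j = 0)
    (hh : ∀ i j k, h i j ≫ h j k = 0) (hdh : ∀ i j, i + 1 = j → h i j ≫ S.d j i ≫ h i j = h i j)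
    (decomp : ∀ i j k, i + 1 = j → j + 1 = k →
      𝟙 (S.X j) = b j ≫ a j + h j k ≫ h' k j + h' j i ≫ h i j)
    (red : ∀ i j, i + 1 = j →
      a j ≫ S.d j i ≫ b i - a j ≫ S.d j i ≫ h i j ≫ S.d j i ≫ b i = C.d j i) :
    ∃ (π : S ⟶ C) (ι : C ⟶ S) (H : Homotopy (π ≫ ι) (𝟙 S)), ι ≫ π = 𝟙 C ∧
      (∀ i j, i + 1 = j → π.f i = b i - h i j ≫ S.d j i ≫ b i) ∧
      (∀ i j, i + 1 = j → ι.f j = a j - a j ≫ S.d j i ≫ h i j) ∧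
      ∀ i j, H.hom i j = -h i j := by
  let q : S ⟶ S := Homotopy.nullHomotopicMap h
  let p : S ⟶ S := 𝟙 S - q
  have hq : ∀ i j k, i + 1 = j → j + 1 = k → q.f j = S.d j i ≫ h i j + h j k ≫ S.d k j :=
    fun i j k hij hjk => Homotopy.nullHomotopicMap_f (c := ComplexShape.down ℤ) hjk hij h
  have hp : ∀ i j k, i + 1 = j → j + 1 = k →
      p.f j = 𝟙 _ - (S.d j i ≫ h i j + h j k ≫ S.d k j) := fun i j k hij hjk => by
    rw [← hq i j k hij hjk]
    rfl
  have hp1 : ∀ i j, h i j ≫ p.f j = 0 := by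
    intro i j
    by_cases hij : i + 1 = j
    · rw [hp i j (j + 1) hij rfl]
      simp only [Preadditive.comp_sub, Preadditive.comp_add, Category.comp_id]
      rw [hdh i j hij, ← Category.assoc (h i j) (h j (j + 1)), hh]
      simp
    · rw [h_zero i j hij, zero_comp]
  have hp2 : ∀ i j, p.f i ≫ h i j = 0 := by
    intro i j
    by_cases hij : i + 1 = j
    · rw [hp (i - 1) i j (by omega) hij]
      simp only [Preadditive.sub_comp, Preadditive.add_comp, Category.id_comp, Category.assoc]
      rw [hdh i j hij, hh]
      simp
    · rw [h_zero i j hij, comp_zero]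
  have hpp : ∀ j, p.f j ≫ p.f j = p.f j := by
    intro j
    have e := hp (j - 1) j (j + 1) (by omega) rfl =≫ p.f j
    simp only [Preadditive.sub_comp, Preadditive.add_comp, Category.id_comp, Category.assoc] at e
    rw [hp1, ← p.comm, ← Category.assoc (h j (j + 1)), hp1] at e
    simpa using e
  have hpbap : ∀ j, p.f j ≫ b j ≫ a j ≫ p.f j = p.f j := by
    intro j
    have e := congrArg (fun f => p.f j ≫ f ≫ p.f j)
      (decomp (j - 1) j (j + 1) (by omega) rfl)
    simp only [Preadditive.comp_add, Preadditive.add_comp, Category.assoc, Category.id_comp,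
      hpp, hp1, comp_zero, add_zero] at e
    rw [← Category.assoc (p.f j) (h j (j + 1)), hp2, zero_comp, add_zero] at e
    exact e.symm
  have hpb : ∀ i j, i + 1 = j → p.f i ≫ b i = b i - h i j ≫ S.d j i ≫ b i := by
    intro i j hij
    rw [hp (i - 1) i j (by omega) hij]
    simp only [Preadditive.sub_comp, Preadditive.add_comp, Category.id_comp, Category.assoc]
    rw [hb, comp_zero, zero_add]
  have hap : ∀ i j, i + 1 = j → a j ≫ p.f j = a j - a j ≫ S.d j i ≫ h i j := by
    intro i j hij
    rw [hp i j (j + 1) hij rfl]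
    simp only [Preadditive.comp_sub, Preadditive.comp_add, Category.comp_id]
    rw [← Category.assoc (a j) (h j (j + 1)), ah, zero_comp, add_zero]
  have hd : ∀ i j, i + 1 = j → a j ≫ p.f j ≫ S.d j i ≫ p.f i ≫ b i = C.d j i := by
    intro i j hij
    rw [← p.comm_assoc, ← Category.assoc (p.f j) (p.f j), hpp, ← Category.assoc, hap i j hij,
      ← red i j hij]
    simp only [Preadditive.sub_comp, Category.assoc]
  let π : S ⟶ C :=
    { f := fun i => p.f i ≫ b i
      comm' := fun j i hij => by
        rw [← hd i j hij, Category.assoc]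
        have e := hpbap j =≫ (S.d j i ≫ p.f i ≫ b i)
        simp only [Category.assoc] at e
        rw [e, ← p.comm_assoc, ← Category.assoc (p.f j) (p.f j), hpp, p.comm_assoc] }
  let ι : C ⟶ S :=
    { f := fun i => a i ≫ p.f i
      comm' := fun j i hij => by
        rw [← hd i j hij]
        simp only [Category.assoc]
        rw [hpbap i, ← p.comm, ← Category.assoc (p.f j) (p.f j), hpp] }
  have hπι : π ≫ ι = p := by
    ext j
    change (p.f j ≫ b j) ≫ a j ≫ p.f j = p.f j
    rw [Category.assoc, hpbap]
  refine ⟨π, ι, (((Homotopy.ofEq hπι).trans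
    { hom := fun i j => -h i j
      zero := fun i j hij => by rw [h_zero i j hij, neg_zero]
      comm := fun j => ?_ })), ?_, fun i j hij => hpb i j hij, fun i j hij => hap i j hij, ?_⟩
  · have h1 : (ComplexShape.down ℤ).Rel j (j - 1) := by
      change j - 1 + 1 = j
      omega
    have h2 : (ComplexShape.down ℤ).Rel (j + 1) j := rfl
    rw [dNext_eq _ h1, prevD_eq _ h2, hp (j - 1) j (j + 1) h1 rfl]
    simp only [Preadditive.comp_neg, Preadditive.neg_comp, HomologicalComplex.id_f]
    abel
  · ext j
    change (a j ≫ p.f j) ≫ p.f j ≫ b j = 𝟙 _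
    rw [Category.assoc, ← Category.assoc (p.f j), hpp, hpb j (j + 1) rfl, Preadditive.comp_sub,
      ab, ← Category.assoc (a j) (h j (j + 1)), ah, zero_comp, sub_zero]
  · intro i j
    simp [Homotopy.trans, Homotopy.ofEq]

end Reduction

/-! ### The simplices that cancel in a stellar subdivision -/

section Pairing

variable {W : Type w} [DecidableEq W] {K : PreAbstractSimplicialComplex W} {N : Set W}
  {base : W → Finset W} {c : W → W}

/-- The pairing along which a subdivided complex is reduced: a simplex `s` which contains a new
vertex `x` but not `c x` is paired with `s * c x`. -/
def Paired (N : Set W) (c : W → W) (s t : Finset W) : Prop :=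
  ∃ x ∈ N, x ∈ s ∧ c x ∉ s ∧ t = insert (c x) s

open Classical in
/-- The simplex of the subdivision which remains after cancelling the pairs and which represents
the simplex `σ` of `K`: it is `x * (σ - c x)` if `σ` contains the starred simplex `base x`, and `σ`
itself if it contains no starred simplex. -/
def kept (N : Set W) (base : W → Finset W) (c : W → W) (σ : Finset W) : Finset W :=
  if h : ∃ x ∈ N, base x ⊆ σ then insert h.choose (σ.erase (c h.choose)) else σ

theorem kept_of_not {σ : Finset W} (h : ∀ x ∈ N, ¬base x ⊆ σ) : kept N base c σ = σ :=
  dif_neg fun ⟨x, hx, hxσ⟩ => h x hx hxσ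

namespace IsDisjointStellar

theorem kept_of_base_subset (h : IsDisjointStellar K N base) {σ : Finset W} (hσ : σ ∈ K.faces)
    {x : W} (hx : x ∈ N) (hxσ : base x ⊆ σ) :
    kept N base c σ = insert x (σ.erase (c x)) := by
  have hex : ∃ x ∈ N, base x ⊆ σ := ⟨x, hx, hxσ⟩
  have : hex.choose = x :=
    h.disjoint σ hσ _ hex.choose_spec.1 _ hx hex.choose_spec.2 hxσ
  rw [kept, dif_pos hex, this]

theorem kept_mem (h : IsDisjointStellar K N base) (hc : ∀ x ∈ N, c x ∈ base x) {σ : Finset W}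
    (hσ : σ ∈ K.faces) : kept N base c σ ∈ (stellar K N base).faces := by
  by_cases hex : ∃ x ∈ N, base x ⊆ σ
  · obtain ⟨x, hx, hxσ⟩ := hex
    rw [h.kept_of_base_subset hσ hx hxσ]
    refine Or.inr ⟨x, hx, _, rfl, Face.down hσ (Finset.union_subset (Finset.erase_subset _ _) hxσ)
      ((Face.nonempty (h.base_mem x hx)).mono Finset.subset_union_right), fun y hy hyσ => ?_⟩
    obtain rfl := h.disjoint σ hσ y hy x hx (hyσ.trans (Finset.erase_subset _ _)) hxσ
    exact Finset.notMem_erase _ _ (hyσ (hc y hy))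
  · push Not at hex
    rw [kept_of_not hex]
    exact Or.inl ⟨hσ, hex⟩

/-- A simplex containing the new vertex `x` does not contain `base x`. -/
theorem not_base_subset (h : IsDisjointStellar K N base) {s : Finset W}
    (hs : s ∈ (stellar K N base).faces) {x : W} (hx : x ∈ N) : ¬base x ⊆ s := by
  rcases hs with ⟨-, hN⟩ | ⟨z, hz, ρ, rfl, -, hN⟩
  · exact hN x hx
  · intro hxs
    refine hN x hx fun y hy => (Finset.mem_insert.1 (hxs hy)).resolve_left ?_
    rintro rfl
    exact h.notMem_of_mem_base hx hy hz

theorem image_kept (h : IsDisjointStellar K N base) (hc : ∀ x ∈ N, c x ∈ base x) {σ : Finset W}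
    (hσ : σ ∈ K.faces) : (kept N base c σ).image (retr N c) = σ := by
  have hfix : ∀ ρ ⊆ σ, ρ.image (retr N c) = ρ := fun ρ hρ => by
    refine (Finset.image_congr fun y hy => ?_).trans Finset.image_id
    exact retr_of_notMem fun hyN => h.fresh y hyN σ hσ (hρ hy)
  by_cases hex : ∃ x ∈ N, base x ⊆ σ
  · obtain ⟨x, hx, hxσ⟩ := hex
    rw [h.kept_of_base_subset hσ hx hxσ, Finset.image_insert, retr_of_mem hx,
      hfix _ (Finset.erase_subset _ _), Finset.insert_erase (hxσ (hc x hx))]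
  · push Not at hex
    rw [kept_of_not hex, hfix _ subset_rfl]

theorem notMem_kept (h : IsDisjointStellar K N base) (hc : ∀ x ∈ N, c x ∈ base x) {σ : Finset W}
    (hσ : σ ∈ K.faces) {x : W} (hx : x ∈ N) (hxσ : x ∈ kept N base c σ) :
    base x ⊆ σ ∧ c x ∉ kept N base c σ := by
  by_cases hex : ∃ x ∈ N, base x ⊆ σ
  · obtain ⟨y, hy, hyσ⟩ := hex
    rw [h.kept_of_base_subset hσ hy hyσ] at hxσ ⊢
    have : x = y := (Finset.mem_insert.1 hxσ).resolve_right fun h1 =>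
      h.fresh x hx σ hσ (Finset.mem_of_mem_erase h1)
    subst this
    refine ⟨hyσ, fun h2 => ?_⟩
    rcases Finset.mem_insert.1 h2 with h2 | h2
    · exact h.notMem_of_mem_base hx (hc x hx) (by rw [h2]; exact hx)
    · exact Finset.notMem_erase _ _ h2
  · push Not at hex
    rw [kept_of_not hex] at hxσ
    exact (h.fresh x hx σ hσ hxσ).elim

theorem defect_kept (h : IsDisjointStellar K N base) (hc : ∀ x ∈ N, c x ∈ base x) {σ : Finset W}
    (hσ : σ ∈ K.faces) : defect N c (kept N base c σ) = 0 :=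
  h.defect_eq_zero (h.kept_mem hc hσ) fun _ hx hxσ => (h.notMem_kept hc hσ hx hxσ).2

theorem not_paired_kept_left (h : IsDisjointStellar K N base) (hc : ∀ x ∈ N, c x ∈ base x)
    {σ : Finset W} (hσ : σ ∈ K.faces) {t : Finset W} (ht : t ∈ (stellar K N base).faces) :
    ¬Paired N c (kept N base c σ) t := by
  rintro ⟨x, hx, hxσ, -, rfl⟩
  have hb := (h.notMem_kept hc hσ hx hxσ).1
  refine h.not_base_subset ht hx fun y hy => ?_
  rw [h.kept_of_base_subset hσ hx hb]
  by_cases hyc : y = c x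
  · exact hyc ▸ Finset.mem_insert_self _ _
  · exact Finset.mem_insert_of_mem (Finset.mem_insert_of_mem (Finset.mem_erase.2 ⟨hyc, hb hy⟩))

theorem not_paired_kept_right (h : IsDisjointStellar K N base) (hc : ∀ x ∈ N, c x ∈ base x)
    {σ : Finset W} (hσ : σ ∈ K.faces) {s : Finset W} : ¬Paired N c s (kept N base c σ) := by
  rintro ⟨x, hx, hxs, -, he⟩
  refine (h.notMem_kept hc hσ hx (he ▸ Finset.mem_insert_of_mem hxs)).2 ?_
  rw [he]
  exact Finset.mem_insert_self _ _

theorem not_paired_paired (h : IsDisjointStellar K N base) {s t r : Finset W}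
    (hr : r ∈ (stellar K N base).faces) (h1 : Paired N c s t) (h2 : Paired N c t r) : False := by
  obtain ⟨x, hx, hxs, -, rfl⟩ := h1
  obtain ⟨y, hy, hyt, hct, rfl⟩ := h2
  obtain rfl := h.subsingleton hr hx hy (Finset.mem_insert_of_mem (Finset.mem_insert_of_mem hxs))
    (Finset.mem_insert_of_mem hyt)
  exact hct (Finset.mem_insert_self _ _)

theorem paired_right_unique (h : IsDisjointStellar K N base) {s t t' : Finset W}
    (hs : s ∈ (stellar K N base).faces) (h1 : Paired N c s t) (h2 : Paired N c s t') :
    t = t' := by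
  obtain ⟨x, hx, hxs, -, rfl⟩ := h1
  obtain ⟨y, hy, hys, -, rfl⟩ := h2
  rw [h.subsingleton hs hx hy hxs hys]

theorem paired_left_unique (h : IsDisjointStellar K N base) {s s' t : Finset W}
    (ht : t ∈ (stellar K N base).faces) (h1 : Paired N c s t) (h2 : Paired N c s' t) :
    s = s' := by
  obtain ⟨x, hx, hxs, hcs, rfl⟩ := h1
  obtain ⟨y, hy, hys, hcs', he⟩ := h2
  have hy' : y ∈ insert (c x) s := he ▸ Finset.mem_insert_of_mem hys
  obtain rfl := h.subsingleton ht hx hy (Finset.mem_insert_of_mem hxs) hy'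
  rw [← Finset.erase_insert hcs, he, Finset.erase_insert hcs']

/-- Every simplex of the subdivision is kept, or it is the smaller or the larger simplex of a
pair. -/
theorem kept_or_paired (h : IsDisjointStellar K N base) (hc : ∀ x ∈ N, c x ∈ base x) {s : Finset W}
    (hs : s ∈ (stellar K N base).faces) :
    (∃ σ ∈ K.faces, s = kept N base c σ) ∨ (∃ t ∈ (stellar K N base).faces, Paired N c s t) ∨
      ∃ t ∈ (stellar K N base).faces, Paired N c t s := by
  have hs' := hs
  rcases hs with ⟨hsK, hN⟩ | ⟨x, hx, ρ, rfl, hρ, hN⟩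
  · exact Or.inl ⟨s, hsK, (kept_of_not hN).symm⟩
  have hcN : c x ∉ N := h.notMem_of_mem_base hx (hc x hx)
  have hne : c x ≠ x := fun he => hcN (by rw [he]; exact hx)
  have hxρ : x ∉ ρ := fun hxρ => h.fresh x hx _ hρ (Finset.mem_union_left _ hxρ)
  by_cases hcs : c x ∈ insert x ρ
  · refine Or.inr (Or.inr ⟨(insert x ρ).erase (c x), Face.down hs' (Finset.erase_subset _ _)
      ⟨x, Finset.mem_erase.2 ⟨hne.symm, Finset.mem_insert_self _ _⟩⟩, x, hx,
      Finset.mem_erase.2 ⟨hne.symm, Finset.mem_insert_self _ _⟩, Finset.notMem_erase _ _,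
      (Finset.insert_erase hcs).symm⟩)
  · have hcρ : c x ∉ ρ := fun h1 => hcs (Finset.mem_insert_of_mem h1)
    have hsub : insert (c x) ρ ∪ base x ⊆ ρ ∪ base x := by
      refine Finset.union_subset (Finset.insert_subset (Finset.mem_union_right _ (hc x hx))
        Finset.subset_union_left) Finset.subset_union_right
    by_cases hb : base x ⊆ insert (c x) ρ
    · have hσ : insert (c x) ρ ∈ K.faces :=
        Face.down hρ (Finset.subset_union_left.trans hsub) (Finset.insert_nonempty _ _)
      refine Or.inl ⟨_, hσ, ?_⟩
      rw [h.kept_of_base_subset hσ hx hb, Finset.erase_insert hcρ]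
    · refine Or.inr (Or.inl ⟨insert (c x) (insert x ρ), Or.inr ⟨x, hx, insert (c x) ρ,
        Finset.insert_comm _ _ _, Face.down hρ hsub
          ((Finset.insert_nonempty _ _).mono Finset.subset_union_left), fun y hy hyρ => ?_⟩,
        x, hx, Finset.mem_insert_self _ _, hcs, rfl⟩)
      refine hb ?_
      obtain rfl := h.disjoint _ hρ y hy x hx ((hyρ.trans Finset.subset_union_left).trans hsub)
        Finset.subset_union_right
      exact hyρ

theorem joinSign_of_paired {s t : Finset W} (hst : Paired N c s t) : joinSign N c s t = 1 :=
  if_pos hst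

theorem paired_of_joinSign_ne_zero (h : IsDisjointStellar K N base) {s t l : Finset W}
    (hl : l ∈ (stellar K N base).faces) (hst : Paired N c s t) (hj : joinSign N c s l ≠ 0) :
    Paired N c s l := by
  unfold joinSign at hj
  split_ifs at hj with h1 h2
  · exact h1
  · obtain ⟨x, hx, hcs, hxs, rfl⟩ := h2
    obtain ⟨y, hy, hys, -, -⟩ := hst
    obtain rfl := h.subsingleton hl hx hy (Finset.mem_insert_self _ _)
      (Finset.mem_insert_of_mem hys)
    exact (hxs hys).elim
  · exact (hj rfl).elim

/-- An identity component between a kept simplex and a larger simplex comes from adding a new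
vertex. -/
theorem joinSign_kept (h : IsDisjointStellar K N base) (hc : ∀ x ∈ N, c x ∈ base x) {σ : Finset W}
    (hσ : σ ∈ K.faces) {l : Finset W} (hl : l ∈ (stellar K N base).faces)
    (hj : joinSign N c (kept N base c σ) l ≠ 0) :
    joinSign N c (kept N base c σ) l = -1 ∧ ∃ x ∈ N, c x ∈ kept N base c σ ∧
      x ∉ kept N base c σ ∧ l = insert x (kept N base c σ) := by
  have h1 : ¬Paired N c (kept N base c σ) l := h.not_paired_kept_left hc hσ hl
  unfold joinSign at hj ⊢
  split_ifs at hj ⊢ with h0 h2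
  · exact (h1 h0).elim
  · exact ⟨rfl, h2⟩
  · exact (hj rfl).elim

/-- The configurations in which the elimination of the pairs contributes to the component of the
reduced differential between `σ` and its face `τ`. -/
def Detour (N : Set W) (base : W → Finset W) (c : W → W) (σ τ p q : Finset W) : Prop :=
  Paired N c p q ∧ p ⊆ kept N base c σ ∧ joinSign N c (kept N base c τ) q ≠ 0

theorem detour_unique (h : IsDisjointStellar K N base) (hc : ∀ x ∈ N, c x ∈ base x)
    {σ τ p q p' q' : Finset W} (hσ : σ ∈ K.faces) (hτ : τ ∈ K.faces)
    (hq : q ∈ (stellar K N base).faces) (hq' : q' ∈ (stellar K N base).faces)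
    (h1 : Detour N base c σ τ p q) (h2 : Detour N base c σ τ p' q') : p = p' ∧ q = q' := by
  have key : ∀ p q, q ∈ (stellar K N base).faces → Detour N base c σ τ p q →
      ∃ x ∈ N, x ∈ kept N base c σ ∧ q = insert x (kept N base c τ) := by
    rintro p q hq ⟨⟨x, hx, hxp, -, rfl⟩, hpσ, hj⟩
    obtain ⟨-, y, hy, -, -, he⟩ := h.joinSign_kept hc hτ hq hj
    obtain rfl := h.subsingleton hq hx hy (Finset.mem_insert_of_mem hxp)
      (he ▸ Finset.mem_insert_self _ _)
    exact ⟨x, hx, hpσ hxp, he⟩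
  obtain ⟨x, hx, hxσ, hqx⟩ := key p q hq h1
  obtain ⟨y, hy, hyσ, hqy⟩ := key p' q' hq' h2
  obtain rfl := h.subsingleton (h.kept_mem hc hσ) hx hy hxσ hyσ
  have hqq : q = q' := by rw [hqx, hqy]
  subst hqq
  exact ⟨h.paired_left_unique hq h1.1 h2.1, rfl⟩

theorem not_subset_of_detour (h : IsDisjointStellar K N base) (hc : ∀ x ∈ N, c x ∈ base x)
    {σ τ p q : Finset W} (hσ : σ ∈ K.faces) (hτ : τ ∈ K.faces)
    (hq : q ∈ (stellar K N base).faces) (h1 : Detour N base c σ τ p q) :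
    ¬kept N base c τ ⊆ kept N base c σ := by
  obtain ⟨⟨x, hx, hxp, -, rfl⟩, hpσ, hj⟩ := h1
  obtain ⟨-, y, hy, hcy, -, he⟩ := h.joinSign_kept hc hτ hq hj
  obtain rfl := h.subsingleton hq hx hy (Finset.mem_insert_of_mem hxp)
    (he ▸ Finset.mem_insert_self _ _)
  exact fun hsub => (h.notMem_kept hc hσ hx (hpσ hxp)).2 (hsub hcy)

theorem exists_detour (h : IsDisjointStellar K N base) (hc : ∀ x ∈ N, c x ∈ base x)
    {σ τ : Finset W} (hσ : σ ∈ K.faces) (hτ : τ ∈ K.faces) (hτσ : τ ⊆ σ)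
    (hn : ¬kept N base c τ ⊆ kept N base c σ) :
    ∃ p ∈ (stellar K N base).faces, ∃ q ∈ (stellar K N base).faces, Detour N base c σ τ p q := by
  have hτN : ∀ x ∈ N, ¬base x ⊆ τ := by
    intro x hx hxτ
    refine hn ?_
    rw [h.kept_of_base_subset hτ hx hxτ, h.kept_of_base_subset hσ hx (hxτ.trans hτσ)]
    exact Finset.insert_subset_insert _ (Finset.erase_subset_erase _ hτσ)
  have hkτ : kept N base c τ = τ := kept_of_not hτN
  have hσN : ∃ x ∈ N, base x ⊆ σ := by
    by_contra hσN
    push Not at hσN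
    rw [hkτ, kept_of_not hσN] at hn
    exact hn hτσ
  obtain ⟨x, hx, hxσ⟩ := hσN
  have hxτ : x ∉ τ := h.fresh x hx τ hτ
  have hcN : c x ∉ N := h.notMem_of_mem_base hx (hc x hx)
  have hne : c x ≠ x := fun he => hcN (by rw [he]; exact hx)
  rw [hkτ, h.kept_of_base_subset hσ hx hxσ] at hn
  have hcτ : c x ∈ τ := by
    by_contra hcτ
    exact hn fun y hy => Finset.mem_insert_of_mem
      (Finset.mem_erase.2 ⟨fun hyc => hcτ (hyc ▸ hy), hτσ hy⟩)
  have hq : insert x τ ∈ (stellar K N base).faces :=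
    Or.inr ⟨x, hx, τ, rfl, Face.down hσ (Finset.union_subset hτσ hxσ)
      ((Face.nonempty hτ).mono Finset.subset_union_left), hτN⟩
  refine ⟨insert x (τ.erase (c x)), Face.down hq
    (Finset.insert_subset_insert _ (Finset.erase_subset _ _)) (Finset.insert_nonempty _ _),
    insert x τ, hq, ⟨x, hx, Finset.mem_insert_self _ _, ?_, ?_⟩, ?_, ?_⟩
  · intro h1
    rcases Finset.mem_insert.1 h1 with h1 | h1
    · exact hne h1
    · exact Finset.notMem_erase _ _ h1
  · rw [Finset.insert_comm, Finset.insert_erase hcτ]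
  · rw [h.kept_of_base_subset hσ hx hxσ]
    exact Finset.insert_subset_insert _ (Finset.erase_subset_erase _ hτσ)
  · rw [hkτ, joinSign, if_neg, if_pos]
    · decide
    · exact ⟨x, hx, hcτ, hxτ, rfl⟩
    · rintro ⟨y, hy, hyτ, -⟩
      exact h.fresh y hy τ hτ hyτ

end IsDisjointStellar

end Pairing

/-! ### A stellar subdivision of a complex is equivalent to the complex -/

/-- A predicate on finite vertex sets which is inherited by subsets, and under the addition of new
vertices of a stellar subdivision and of their images under the retraction. -/
structure StellarClosed {W : Type w} [DecidableEq W] (N : Set W) (base : W → Finset W)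
    (c : W → W) (P : Finset W → Prop) : Prop where
  mono : ∀ {s t}, t ⊆ s → P s → P t
  star : ∀ {x s}, x ∈ N → base x ⊆ s → P s → P (insert x s)
  retr : ∀ {x s}, x ∈ N → x ∈ s → P s → P (insert (c x) s)

/-- A predicate on finite sets, as a predicate on simplices. -/
abbrev onFaces {W : Type w} (K : PreAbstractSimplicialComplex W) (P : Finset W → Prop) :
    Face K → Prop := fun s => P s.1

section Elimination

variable {W : Type w} [DecidableEq W] {A : Type u} [Category.{v} A] [Preadditive A]
  {K : PreAbstractSimplicialComplex W} {N : Set W} {base : W → Finset W} {c : W → W}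
  {var : Variance}

/-- The relation along which the homotopy leads: from the smaller to the larger simplex of a pair
for `A^*`, and backwards for `A_*`. -/
def Variance.Paired (N : Set W) (c : W → W) : Variance → Finset W → Finset W → Prop
  | lower, s, t => _root_.Paired N c s t
  | upper, s, t => _root_.Paired N c t s

/-- The simplex that represents a simplex of `K`, as a simplex of the subdivision. -/
def keptFace (h : IsDisjointStellar K N base) (hc : ∀ x ∈ N, c x ∈ base x) (σ : Face K) :
    Face (stellar K N base) := ⟨kept N base c σ.1, h.kept_mem hc σ.2⟩

theorem retrFace_keptFace (h : IsDisjointStellar K N base) (hc : ∀ x ∈ N, c x ∈ base x)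
    (σ : Face K) : retrFace h hc (keptFace h hc σ) = σ := Subtype.ext (h.image_kept hc σ.2)

theorem defect_keptFace (h : IsDisjointStellar K N base) (hc : ∀ x ∈ N, c x ∈ base x)
    (σ : Face K) : defect N c (keptFace h hc σ).1 = 0 := h.defect_kept hc σ.2

theorem keptFace_injective (h : IsDisjointStellar K N base) (hc : ∀ x ∈ N, c x ∈ base x)
    {σ τ : Face K} (he : keptFace h hc σ = keptFace h hc τ) : σ = τ := by
  rw [← retrFace_keptFace h hc σ, he, retrFace_keptFace]

theorem Variance.Paired.right_unique (h : IsDisjointStellar K N base)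
    {s t t' : Face (stellar K N base)} (h1 : var.Paired N c s.1 t.1)
    (h2 : var.Paired N c s.1 t'.1) : t = t' := by
  cases var
  · exact Subtype.ext (h.paired_right_unique s.2 h1 h2)
  · exact Subtype.ext (h.paired_left_unique s.2 h1 h2)

theorem Variance.Paired.left_unique (h : IsDisjointStellar K N base)
    {s s' t : Face (stellar K N base)} (h1 : var.Paired N c s.1 t.1)
    (h2 : var.Paired N c s'.1 t.1) : s = s' := by
  cases var
  · exact Subtype.ext (h.paired_left_unique t.2 h1 h2)
  · exact Subtype.ext (h.paired_right_unique t.2 h1 h2)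

theorem Variance.not_paired_kept_left (h : IsDisjointStellar K N base)
    (hc : ∀ x ∈ N, c x ∈ base x) (σ : Face K) (t : Face (stellar K N base)) :
    ¬var.Paired N c (keptFace h hc σ).1 t.1 := by
  cases var
  · exact h.not_paired_kept_left hc σ.2 t.2
  · exact h.not_paired_kept_right hc σ.2

theorem Variance.not_paired_kept_right (h : IsDisjointStellar K N base)
    (hc : ∀ x ∈ N, c x ∈ base x) (σ : Face K) (t : Face (stellar K N base)) :
    ¬var.Paired N c t.1 (keptFace h hc σ).1 := by
  cases var
  · exact h.not_paired_kept_right hc σ.2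
  · exact h.not_paired_kept_left hc σ.2 t.2

theorem Variance.not_paired_paired (h : IsDisjointStellar K N base)
    {s t r : Face (stellar K N base)} (h1 : var.Paired N c s.1 t.1)
    (h2 : var.Paired N c t.1 r.1) : False := by
  cases var
  · exact h.not_paired_paired r.2 h1 h2
  · exact h.not_paired_paired s.2 h2 h1

theorem Variance.kept_or_paired (var : Variance) (h : IsDisjointStellar K N base)
    (hc : ∀ x ∈ N, c x ∈ base x) (s : Face (stellar K N base)) :
    (∃ σ, s = keptFace h hc σ) ∨ (∃ t : Face (stellar K N base), var.Paired N c s.1 t.1) ∨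
      ∃ t : Face (stellar K N base), var.Paired N c t.1 s.1 := by
  rcases h.kept_or_paired hc s.2 with ⟨σ, hσ, he⟩ | ⟨t, ht, hp⟩ | ⟨t, ht, hp⟩
  · exact Or.inl ⟨⟨σ, hσ⟩, Subtype.ext he⟩
  · cases var
    · exact Or.inr (Or.inl ⟨⟨t, ht⟩, hp⟩)
    · exact Or.inr (Or.inr ⟨⟨t, ht⟩, hp⟩)
  · cases var
    · exact Or.inr (Or.inr ⟨⟨t, ht⟩, hp⟩)
    · exact Or.inr (Or.inl ⟨⟨t, ht⟩, hp⟩)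

theorem Variance.joinSign_of_paired {s t : Finset W} (hst : var.Paired N c s t) :
    var.joinSign N c t s = 1 := by
  cases var
  · exact IsDisjointStellar.joinSign_of_paired hst
  · exact IsDisjointStellar.joinSign_of_paired hst

/-- Between targets and sources of the homotopy, only the cancelled pairs are joined by identity
components of the differential. -/
theorem Variance.paired_of_joinSign_ne_zero (h : IsDisjointStellar K N base)
    {s t s' t' : Face (stellar K N base)} (h1 : var.Paired N c s.1 t.1)
    (h2 : var.Paired N c s'.1 t'.1) (hj : var.joinSign N c t.1 s'.1 ≠ 0) : s' = s := by
  cases var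
  · have := h.paired_of_joinSign_ne_zero t.2 h2 hj
    exact Subtype.ext (h.paired_left_unique t.2 this h1)
  · have := h.paired_of_joinSign_ne_zero s'.2 h1 hj
    exact Subtype.ext (h.paired_right_unique t.2 this h1)

/-- The two simplices of a pair carry the same object of `C`, in successive degrees. -/
theorem Variance.Paired.degree_eq_and_retrFace_eq (h : IsDisjointStellar K N base)
    (hc : ∀ x ∈ N, c x ∈ base x) {i j : ℤ} (hij : i + 1 = j) {s t : Face (stellar K N base)}
    (hst : var.Paired N c s.1 t.1) :
    i + var.shift * defect N c s.1 = j + var.shift * defect N c t.1 ∧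
      retrFace h hc s = retrFace h hc t := by
  have hj : var.joinSign N c t.1 s.1 ≠ 0 := by
    rw [Variance.joinSign_of_paired hst]
    exact one_ne_zero
  obtain ⟨-, h1, h2, -⟩ := Variance.joinSign_spec h hc hj
  refine ⟨?_, h1.symm⟩
  rw [mul_sub] at h2
  omega

/-- Only identity components of the differential lead from a target to a source of the
homotopy: the components of `d_C` preserve the defect. -/
theorem Variance.Paired.defect_ne (h : IsDisjointStellar K N base) (hc : ∀ x ∈ N, c x ∈ base x)
    {s t s' t' : Face (stellar K N base)} (h1 : var.Paired N c s.1 t.1)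
    (h2 : var.Paired N c s'.1 t'.1) : defect N c t.1 ≠ defect N c s'.1 := by
  have e1 := (Variance.joinSign_spec h hc
    ((Variance.joinSign_of_paired h1).trans_ne one_ne_zero)).2.2.2.2
  have e2 := (Variance.joinSign_spec h hc
    ((Variance.joinSign_of_paired h2).trans_ne one_ne_zero)).2.2.2.2
  intro he
  cases var <;> simp only [Prod.mk.injEq] at e1 e2 <;> omega

/-- The objects of a complex in degree `n`, as a family. -/
abbrev famObj (C : ACplx A var K) (n : ℤ) : Fam.{w} A := ⟨Face K, (C.X n).obj⟩

/-- The objects of a subdivided complex in degree `n`, as a family. -/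
abbrev subdivFam (h : IsDisjointStellar K N base) (hc : ∀ x ∈ N, c x ∈ base x)
    (C : ACplx A var K) (n : ℤ) : Fam.{w} A :=
  ⟨Face (stellar K N base),
    fun s => (C.X (n + var.shift * defect N c s.1)).obj (retrFace h hc s)⟩

theorem subdivFam_keptFace (h : IsDisjointStellar K N base) (hc : ∀ x ∈ N, c x ∈ base x)
    (C : ACplx A var K) (n : ℤ) (σ : Face K) :
    (subdivFam h hc C n).obj (keptFace h hc σ) = (famObj C n).obj σ := by
  dsimp only
  rw [retrFace_keptFace, defect_keptFace, mul_zero, add_zero]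

theorem subdivFam_paired (h : IsDisjointStellar K N base) (hc : ∀ x ∈ N, c x ∈ base x)
    (C : ACplx A var K) {i j : ℤ} (hij : i + 1 = j) {s t : Face (stellar K N base)}
    (hst : var.Paired N c s.1 t.1) :
    (subdivFam h hc C i).obj s = (subdivFam h hc C j).obj t := by
  obtain ⟨h1, h2⟩ := hst.degree_eq_and_retrFace_eq h hc hij
  dsimp only
  rw [h1, h2]

/-- The differential of a subdivided complex, as a matrix. -/
def subdivFamD (h : IsDisjointStellar K N base) (hc : ∀ x ∈ N, c x ∈ base x) (hK : IsFDLF K)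
    (C : ACplx A var K) (i j : ℤ) : subdivFam h hc C i ⟶ subdivFam h hc C j :=
  Fam.Hom.mk (M := subdivFam h hc C i) (N := subdivFam h hc C j) (subdivD h hc C i j)
    (subdivHom h hc hK C i j).finite_column

theorem subdivFamD_comp (h : IsDisjointStellar K N base) (hc : ∀ x ∈ N, c x ∈ base x)
    (hK : IsFDLF K) (C : ACplx A var K) (i j : ℤ) (s t : Face (stellar K N base)) :
    (subdivFamD h hc hK C i j).comp s t = subdivD h hc C i j s t := rfl

/-- The graded inclusion of the kept simplices. -/
def keptIncl (h : IsDisjointStellar K N base) (hc : ∀ x ∈ N, c x ∈ base x)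
    (C : ACplx A var K) (n : ℤ) :
    famObj C n ⟶ subdivFam h hc C n :=
  Fam.mono _ _ 1 (fun (σ : Face K) (s : Face (stellar K N base)) => s = keptFace h hc σ)
    (fun _ _ _ h1 h2 => h1.trans h2.symm) (by
      rintro σ _ rfl
      exact (subdivFam_keptFace h hc C n σ).symm)

/-- The graded projection to the kept simplices. -/
def keptProj (h : IsDisjointStellar K N base) (hc : ∀ x ∈ N, c x ∈ base x)
    (C : ACplx A var K) (n : ℤ) :
    subdivFam h hc C n ⟶ famObj C n :=
  Fam.mono _ _ 1 (fun (s : Face (stellar K N base)) (σ : Face K) => s = keptFace h hc σ)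
    (fun _ _ _ h1 h2 => keptFace_injective h hc (h1.symm.trans h2)) (by
      rintro _ σ rfl
      exact subdivFam_keptFace h hc C n σ)

/-- The contraction of the cancelled pairs.  The sign is that of the identity component of the
differential which it inverts. -/
def pairHomotopy (h : IsDisjointStellar K N base) (hc : ∀ x ∈ N, c x ∈ base x)
    (C : ACplx A var K) (i j : ℤ) :
    subdivFam h hc C i ⟶ subdivFam h hc C j :=
  Fam.mono _ _ (j.negOnePow : ℤ)
    (fun s t : Face (stellar K N base) => i + 1 = j ∧ var.Paired N c s.1 t.1)
    (fun _ _ _ h1 h2 => h1.2.right_unique h h2.2)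
    fun _ _ hst => subdivFam_paired h hc C hst.1 hst.2

/-- The part of the differential inside the cancelled pairs. -/
def pairDifferential (h : IsDisjointStellar K N base) (hc : ∀ x ∈ N, c x ∈ base x)
    (C : ACplx A var K) (j i : ℤ) :
    subdivFam h hc C j ⟶ subdivFam h hc C i :=
  Fam.mono _ _ (j.negOnePow : ℤ)
    (fun t s : Face (stellar K N base) => i + 1 = j ∧ var.Paired N c s.1 t.1)
    (fun _ _ _ h1 h2 => h1.2.left_unique h h2.2)
    fun _ _ hst => (subdivFam_paired h hc C hst.1 hst.2).symm

variable (h : IsDisjointStellar K N base) (hc : ∀ x ∈ N, c x ∈ base x) (hK : IsFDLF K)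
  (C : ACplx A var K)

theorem keptIncl_comp_keptProj (n : ℤ) :
    keptIncl h hc C n ≫ keptProj h hc C n = 𝟙 _ := by
  refine Fam.hom_ext fun (σ : Face K) (τ : Face K) => ?_
  rw [keptIncl, Fam.mono_comp_of _ (rfl : keptFace h hc σ = keptFace h hc σ), keptProj]
  by_cases hστ : σ = τ
  · subst hστ
    rw [Fam.mono_of (rfl : keptFace h hc σ = keptFace h hc σ), Fam.id_comp_self]
    simp
  · have hne : ¬keptFace h hc σ = keptFace h hc τ := fun he => hστ (keptFace_injective h hc he)
    rw [Fam.mono_not hne, Fam.id_comp_ne hστ]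
    simp

theorem keptIncl_comp_pairHomotopy (i j : ℤ) :
    keptIncl h hc C i ≫ pairHomotopy h hc C i j = 0 := by
  refine Fam.hom_ext fun (σ : Face K) (t : Face (stellar K N base)) => ?_
  rw [keptIncl, Fam.mono_comp_of _ (rfl : keptFace h hc σ = keptFace h hc σ), pairHomotopy]
  have hne : ¬(i + 1 = j ∧ var.Paired N c (keptFace h hc σ).1 t.1) := fun he =>
    Variance.not_paired_kept_left h hc σ t he.2
  rw [Fam.mono_not hne, comp_zero, smul_zero]
  rfl

theorem pairHomotopy_comp_keptProj (i j : ℤ) :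
    pairHomotopy h hc C i j ≫ keptProj h hc C j = 0 := by
  refine Fam.hom_ext fun s (σ : Face K) => ?_
  refine Fam.comp_comp_eq_zero _ _ _ _ fun t ht => Fam.mono_not fun he => ?_
  subst he
  exact Variance.not_paired_kept_right h hc σ s (Fam.rel_of_mono_ne_zero ht).2

theorem pairHomotopy_comp_pairHomotopy (i j k : ℤ) :
    pairHomotopy h hc C i j ≫ pairHomotopy h hc C j k = 0 := by
  refine Fam.hom_ext fun s r => ?_
  refine Fam.comp_comp_eq_zero _ _ _ _ fun t ht => Fam.mono_not fun he => ?_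
  exact Variance.not_paired_paired h (Fam.rel_of_mono_ne_zero ht).2 he.2

theorem pairHomotopy_d_pairHomotopy (i j : ℤ) (hij : i + 1 = j) :
    pairHomotopy h hc C i j ≫ subdivFamD h hc hK C j i ≫
      pairHomotopy h hc C i j = pairHomotopy h hc C i j := by
  refine Fam.hom_ext fun (s : Face (stellar K N base)) (r : Face (stellar K N base)) => ?_
  by_cases hs : ∃ t : Face (stellar K N base), var.Paired N c s.1 t.1
  swap
  · have hs' : ∀ t : Face (stellar K N base), ¬(i + 1 = j ∧ var.Paired N c s.1 t.1) :=
      fun t ht => hs ⟨t, ht.2⟩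
    conv_lhs => rw [pairHomotopy]
    rw [Fam.mono_comp_not _ hs', pairHomotopy, Fam.mono_not (hs' r)]
  obtain ⟨t, hst⟩ := hs
  conv_lhs => rw [pairHomotopy]
  rw [Fam.mono_comp_of _ (⟨hij, hst⟩ : i + 1 = j ∧ var.Paired N c s.1 t.1)]
  have hsingle : ∀ s' : Face (stellar K N base), s' ≠ s →
      subdivD h hc C j i t s' ≠ 0 → (pairHomotopy h hc C i j).comp s' r = 0 := by
    intro s' hne hd
    refine Fam.mono_not fun he => hne ?_
    refine Variance.paired_of_joinSign_ne_zero h hst he.2 fun hj => hd ?_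
    exact subdivD_of_not h hc C j i (fun h1 => hst.defect_ne h hc he.2 h1.2) hj
  rw [Fam.comp_comp_eq_single _ _ _ _ s hsingle]
  have hj : var.joinSign N c t.1 s.1 = 1 := Variance.joinSign_of_paired hst
  obtain ⟨e, he⟩ := subdivD_of_joinSign h hc C j i hij (hj.trans_ne one_ne_zero)
  rw [subdivFamD_comp, he, hj, mul_one, Preadditive.zsmul_comp, Preadditive.comp_zsmul, smul_smul,
    Int.units_coe_mul_self, one_smul, eqToHom_trans_assoc, eqToHom_refl, Category.id_comp,
    pairHomotopy]

theorem id_eq_kept_add_paired (i j k : ℤ) (hij : i + 1 = j) (hjk : j + 1 = k) :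
    𝟙 (subdivFam h hc C j) =
      keptProj h hc C j ≫ keptIncl h hc C j +
        pairHomotopy h hc C j k ≫ pairDifferential h hc C k j +
        pairDifferential h hc C j i ≫ pairHomotopy h hc C i j := by
  refine Fam.hom_ext fun (s : Face (stellar K N base)) (r : Face (stellar K N base)) => ?_
  rw [Fam.add_comp_apply, Fam.add_comp_apply]
  have hR : s ≠ r → (𝟙 (subdivFam h hc C j) : _ ⟶ _).comp s r = 0 :=
    fun hne => Fam.id_comp_ne hne
  have z1 : (∀ σ, s ≠ keptFace h hc σ) →
      (keptProj h hc C j ≫ keptIncl h hc C j).comp s r = 0 :=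
    fun hs => Fam.mono_comp_not _ hs _
  have z2 : (∀ t : Face (stellar K N base), ¬var.Paired N c s.1 t.1) →
      (pairHomotopy h hc C j k ≫ pairDifferential h hc C k j).comp s r = 0 :=
    fun hs => Fam.mono_comp_not _ (fun t ht => hs t ht.2) _
  have z3 : (∀ t : Face (stellar K N base), ¬var.Paired N c t.1 s.1) →
      (pairDifferential h hc C j i ≫ pairHomotopy h hc C i j).comp s r = 0 :=
    fun hs => Fam.mono_comp_not _ (fun t ht => hs t ht.2) _
  rcases var.kept_or_paired h hc s with ⟨σ, rfl⟩ | ⟨t, ht⟩ | ⟨t, ht⟩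
  · rw [z2 (Variance.not_paired_kept_left h hc σ),
      z3 fun t => Variance.not_paired_kept_right h hc σ t, add_zero, add_zero, keptProj,
      Fam.mono_comp_of _ (rfl : keptFace h hc σ = keptFace h hc σ), keptIncl]
    by_cases he : r = keptFace h hc σ
    · subst he
      rw [Fam.mono_of (rfl : keptFace h hc σ = keptFace h hc σ), Fam.id_comp_self]
      simp
    · rw [Fam.mono_not he, hR (Ne.symm he)]
      simp
  · rw [z1 fun σ he => Variance.not_paired_kept_left h hc σ t (he ▸ ht),
      z3 fun t' ht' => Variance.not_paired_paired h ht' ht, zero_add, add_zero, pairHomotopy,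
      Fam.mono_comp_of _ (⟨hjk, ht⟩ : j + 1 = k ∧ var.Paired N c s.1 t.1), pairDifferential]
    by_cases he : s = r
    · subst he
      rw [Fam.mono_of ⟨hjk, ht⟩, Fam.id_comp_self, Preadditive.comp_zsmul, smul_smul,
        Int.units_coe_mul_self, one_smul, eqToHom_trans, eqToHom_refl]
    · have hne : ¬(j + 1 = k ∧ var.Paired N c r.1 t.1) := fun h' => he (ht.left_unique h h'.2)
      rw [Fam.mono_not hne, hR he]
      simp
  · rw [z1 fun σ he => Variance.not_paired_kept_right h hc σ t (he ▸ ht),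
      z2 fun t' ht' => Variance.not_paired_paired h ht ht', zero_add, zero_add, pairDifferential,
      Fam.mono_comp_of _ (⟨hij, ht⟩ : i + 1 = j ∧ var.Paired N c t.1 s.1), pairHomotopy]
    by_cases he : s = r
    · subst he
      rw [Fam.mono_of ⟨hij, ht⟩, Fam.id_comp_self, Preadditive.comp_zsmul, smul_smul,
        Int.units_coe_mul_self, one_smul, eqToHom_trans, eqToHom_refl]
    · have hne : ¬(i + 1 = j ∧ var.Paired N c t.1 r.1) := fun h' => he (ht.right_unique h h'.2)
      rw [Fam.mono_not hne, hR he]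
      simp

/-- The differential of a complex, as a matrix. -/
def famD (C : ACplx A var K) (i j : ℤ) : famObj C i ⟶ famObj C j :=
  Fam.Hom.mk (M := famObj C i) (N := famObj C j) (C.d i j).comp (C.d i j).finite_column

/-- A configuration `Detour`, oriented according to the variance. -/
def Variance.Detour (N : Set W) (base : W → Finset W) (c : W → W) :
    Variance → Finset W → Finset W → Finset W → Finset W → Prop
  | lower, σ, τ, s, t => _root_.IsDisjointStellar.Detour N base c σ τ s t
  | upper, σ, τ, s, t => _root_.IsDisjointStellar.Detour N base c τ σ t s

theorem Variance.Detour.paired {σ τ s t : Finset W} (hd : var.Detour N base c σ τ s t) :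
    var.Paired N c s t := by
  cases var
  · exact hd.1
  · exact hd.1

theorem Variance.Detour.unique (h : IsDisjointStellar K N base) (hc : ∀ x ∈ N, c x ∈ base x)
    {σ τ : Face K} {s t s' t' : Face (stellar K N base)}
    (h1 : var.Detour N base c σ.1 τ.1 s.1 t.1) (h2 : var.Detour N base c σ.1 τ.1 s'.1 t'.1) :
    s = s' ∧ t = t' := by
  cases var
  · obtain ⟨e1, e2⟩ := h.detour_unique hc σ.2 τ.2 t.2 t'.2 h1 h2
    exact ⟨Subtype.ext e1, Subtype.ext e2⟩
  · obtain ⟨e1, e2⟩ := h.detour_unique hc τ.2 σ.2 s.2 s'.2 h1 h2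
    exact ⟨Subtype.ext e2, Subtype.ext e1⟩

theorem Variance.Detour.not_rel {σ τ : Face K} {s t : Face (stellar K N base)}
    (h1 : var.Detour N base c σ.1 τ.1 s.1 t.1) :
    ¬var.rel _ (keptFace h hc σ) (keptFace h hc τ) := by
  cases var
  · exact h.not_subset_of_detour hc σ.2 τ.2 t.2 h1
  · exact h.not_subset_of_detour hc τ.2 σ.2 s.2 h1

theorem Variance.exists_detour {σ τ : Face K} (hστ : var.rel _ σ τ)
    (hn : ¬var.rel _ (keptFace h hc σ) (keptFace h hc τ)) :
    ∃ s t : Face (stellar K N base), var.Detour N base c σ.1 τ.1 s.1 t.1 := by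
  cases var
  · obtain ⟨p, hp, q, hq, hd⟩ := h.exists_detour hc σ.2 τ.2 hστ hn
    exact ⟨⟨p, hp⟩, ⟨q, hq⟩, hd⟩
  · obtain ⟨p, hp, q, hq, hd⟩ := h.exists_detour hc τ.2 σ.2 hστ hn
    exact ⟨⟨q, hq⟩, ⟨p, hp⟩, hd⟩

theorem defect_of_paired (h : IsDisjointStellar K N base) (hc : ∀ x ∈ N, c x ∈ base x)
    {p q : Face (stellar K N base)} (hpq : Paired N c p.1 q.1) :
    defect N c p.1 = 0 ∧ defect N c q.1 = 1 :=
  (h.joinSign_spec hc p.2 q.2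
    ((IsDisjointStellar.joinSign_of_paired hpq).trans_ne one_ne_zero)).2.2

theorem detour_of_ne_zero (i j : ℤ) {σ τ : Face K} {s t : Face (stellar K N base)}
    (hst : var.Paired N c s.1 t.1) (h1 : subdivD h hc C j i (keptFace h hc σ) s ≠ 0)
    (h2 : subdivD h hc C j i t (keptFace h hc τ) ≠ 0) :
    var.Detour N base c σ.1 τ.1 s.1 t.1 := by
  cases var
  · refine ⟨hst, rel_of_subdivD_ne_zero h hc C j i h1, fun hj => h2 ?_⟩
    refine subdivD_of_not h hc C j i (fun he => ?_) hj
    have := he.2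
    rw [(defect_of_paired h hc hst).2, defect_keptFace] at this
    exact one_ne_zero this
  · refine ⟨hst, rel_of_subdivD_ne_zero h hc C j i h2, fun hj => h1 ?_⟩
    refine subdivD_of_not h hc C j i (fun he => ?_) hj
    have := he.2
    rw [(defect_of_paired h hc hst).2, defect_keptFace] at this
    exact zero_ne_one this

theorem kept_component (i j : ℤ) {σ τ : Face K}
    (hστ : var.rel _ (keptFace h hc σ) (keptFace h hc τ))
    (e1 : (famObj C j).obj σ = (subdivFam h hc C j).obj (keptFace h hc σ))
    (e2 : (subdivFam h hc C i).obj (keptFace h hc τ) = (famObj C i).obj τ) :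
    eqToHom e1 ≫ subdivD h hc C j i (keptFace h hc σ) (keptFace h hc τ) ≫ eqToHom e2 =
      (C.d j i).comp σ τ := by
  rw [subdivD_of_same h hc C j i hστ (by rw [defect_keptFace, defect_keptFace]),
    ACplx_d_eqToHom C _ _ (by rw [defect_keptFace, mul_zero, add_zero]) (retrFace_keptFace h hc τ),
    ACplx_eqToHom_d C _ _ (by rw [defect_keptFace, mul_zero, add_zero])
      (retrFace_keptFace h hc σ).symm]

/-- The contribution of a detour: the signs of its two identity components and of the homotopy
multiply to `-1`. -/
theorem detour_component (i j : ℤ) (hij : i + 1 = j) {σ τ : Face K}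
    {s t : Face (stellar K N base)} (hd : var.Detour N base c σ.1 τ.1 s.1 t.1)
    (e1 : (famObj C j).obj σ = (subdivFam h hc C j).obj (keptFace h hc σ))
    (e2 : (subdivFam h hc C i).obj s = (subdivFam h hc C j).obj t)
    (e3 : (subdivFam h hc C i).obj (keptFace h hc τ) = (famObj C i).obj τ) :
    eqToHom e1 ≫ subdivD h hc C j i (keptFace h hc σ) s ≫ ((j.negOnePow : ℤ) • eqToHom e2) ≫
      subdivD h hc C j i t (keptFace h hc τ) ≫ eqToHom e3 = -(C.d j i).comp σ τ := by
  obtain ⟨hk1, hk2⟩ := hd.paired.degree_eq_and_retrFace_eq h hc hij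
  have hsq : (j.negOnePow : ℤ) * ((j.negOnePow : ℤ) * -1) = -1 := by
    rw [← mul_assoc, Int.units_coe_mul_self, one_mul]
  have hsq' : (j.negOnePow : ℤ) * -1 * (j.negOnePow : ℤ) = -1 := by
    rw [mul_comm, hsq]
  cases var
  · obtain ⟨hp, hs, hj⟩ := hd
    obtain ⟨e, he⟩ := subdivD_of_joinSign (var := .lower) h hc C j i hij
      (s := t) (t := keptFace h hc τ) hj
    have hj' : Variance.lower.joinSign N c t.1 (keptFace h hc τ).1 = -1 :=
      (h.joinSign_kept hc τ.2 t.2 hj).1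
    rw [he, hj', subdivD_of_same h hc C j i (s := keptFace h hc σ) (t := s) hs
      (by rw [defect_keptFace, (defect_of_paired h hc hp).1])]
    simp only [Preadditive.zsmul_comp, Preadditive.comp_zsmul, eqToHom_trans, smul_smul]
    rw [hsq', ACplx_d_eqToHom C _ _
        (by rw [(defect_of_paired h hc hp).1, mul_zero, add_zero])
        (hk2.trans ((Variance.joinSign_spec (var := .lower) h hc (s := t) (t := keptFace h hc τ)
          hj).2.1.trans (retrFace_keptFace h hc τ))),
      ACplx_eqToHom_d C _ _ (by rw [defect_keptFace, mul_zero, add_zero])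
      (retrFace_keptFace h hc σ).symm, neg_one_zsmul]
  · obtain ⟨hp, hs, hj⟩ := hd
    obtain ⟨e, he⟩ := subdivD_of_joinSign (var := .upper) h hc C j i hij
      (s := keptFace h hc σ) (t := s) hj
    have hj' : Variance.upper.joinSign N c (keptFace h hc σ).1 s.1 = -1 :=
      (h.joinSign_kept hc σ.2 s.2 hj).1
    have hsσ := (Variance.joinSign_spec (var := .upper) h hc (s := keptFace h hc σ) (t := s)
      hj).2.1
    rw [he, hj', subdivD_of_same h hc C j i (s := t) (t := keptFace h hc τ) hs
      (by rw [defect_keptFace, (defect_of_paired h hc hp).1])]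
    simp only [Preadditive.zsmul_comp, Preadditive.comp_zsmul, eqToHom_trans_assoc, smul_smul]
    rw [hsq, ACplx_d_eqToHom C _ _ (by rw [defect_keptFace, mul_zero, add_zero])
        (retrFace_keptFace h hc τ),
      ACplx_eqToHom_d C _ _ (by rw [(defect_of_paired h hc hp).1, mul_zero, add_zero])
      ((retrFace_keptFace h hc σ).symm.trans (hsσ.trans hk2)), neg_one_zsmul]

/-- Eliminating the pairs turns the differential of the subdivision into that of the complex. -/
theorem eliminated_differential (i j : ℤ) (hij : i + 1 = j) :
    keptIncl h hc C j ≫ subdivFamD h hc hK C j i ≫ keptProj h hc C i -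
      keptIncl h hc C j ≫ subdivFamD h hc hK C j i ≫ pairHomotopy h hc C i j ≫
        subdivFamD h hc hK C j i ≫ keptProj h hc C i = famD C j i := by
  refine Fam.hom_ext fun (σ : Face K) (τ : Face K) => ?_
  have hinj : ∀ (s s' : Face (stellar K N base)) (τ : Face K), s = keptFace h hc τ →
      s' = keptFace h hc τ → s = s' := fun _ _ _ h1 h2 => h1.trans h2.symm
  have hproj : ∀ s : Face (stellar K N base),
      (subdivFamD h hc hK C j i ≫ keptProj h hc C i).comp s τ =
        subdivD h hc C j i s (keptFace h hc τ) ≫ eqToHom (subdivFam_keptFace h hc C i τ) :=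
    fun s => by
    rw [keptProj, Fam.comp_mono_of _ hinj (rfl : keptFace h hc τ = keptFace h hc τ), one_smul,
      subdivFamD_comp]
  rw [Fam.sub_comp_apply, keptIncl, Fam.mono_comp_of _ (rfl : keptFace h hc σ = keptFace h hc σ),
    Fam.mono_comp_of _ (rfl : keptFace h hc σ = keptFace h hc σ), one_smul, one_smul, hproj]
  change _ = (C.d j i).comp σ τ
  -- Only detours contribute to the second term, and there is at most one.
  have hzero : ∀ s : Face (stellar K N base),
      (∀ t : Face (stellar K N base), ¬var.Detour N base c σ.1 τ.1 s.1 t.1) →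
      (subdivFamD h hc hK C j i).comp (keptFace h hc σ) s ≠ 0 →
      (pairHomotopy h hc C i j ≫ subdivFamD h hc hK C j i ≫ keptProj h hc C i).comp s τ = 0 := by
    intro s hs h1
    refine Fam.comp_comp_eq_zero _ _ _ _ fun t ht => ?_
    rw [hproj]
    by_contra h2
    refine hs t (detour_of_ne_zero h hc C i j (Fam.rel_of_mono_ne_zero ht).2 h1 fun h3 => h2 ?_)
    rw [h3, zero_comp]
  by_cases hex : ∃ s t : Face (stellar K N base), var.Detour N base c σ.1 τ.1 s.1 t.1
  · obtain ⟨s, t, hd⟩ := hex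
    have hn := hd.not_rel h hc
    have h0 : subdivD h hc C j i (keptFace h hc σ) (keptFace h hc τ) = 0 := by
      by_contra h0
      exact hn (rel_of_subdivD_ne_zero h hc C j i h0)
    rw [h0, zero_comp, comp_zero, zero_sub, Fam.comp_comp_eq_single _ _ _ _ s fun s' hne =>
        hzero s' fun t' hd' => hne (hd'.unique h hc hd).1, pairHomotopy,
      Fam.mono_comp_of _ (⟨hij, hd.paired⟩ : i + 1 = j ∧ var.Paired N c s.1 t.1), hproj,
      subdivFamD_comp, neg_eq_iff_eq_neg, ← detour_component h hc C i j hij hd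
        (subdivFam_keptFace h hc C j σ).symm (subdivFam_paired h hc C hij hd.paired)
        (subdivFam_keptFace h hc C i τ)]
    simp only [Preadditive.zsmul_comp, Preadditive.comp_zsmul]
  · push Not at hex
    rw [Fam.comp_comp_eq_zero _ _ _ _ fun s => hzero s (hex s), comp_zero, sub_zero]
    by_cases hrel : var.rel _ (keptFace h hc σ) (keptFace h hc τ)
    · exact kept_component h hc C i j hrel _ _
    · have h0 : subdivD h hc C j i (keptFace h hc σ) (keptFace h hc τ) = 0 := by
        by_contra h0
        exact hrel (rel_of_subdivD_ne_zero h hc C j i h0)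
      rw [h0, zero_comp, comp_zero]
      by_contra h1
      obtain ⟨s, t, hd⟩ := Variance.exists_detour h hc
        ((C.d j i).allowed σ τ (Ne.symm h1)) hrel
      exact hex s t hd

end Elimination

/-! ### Transfer of control to deformation retracts -/

section TransferGeneral

variable {𝒞 : Type u} [Category.{v} 𝒞] [Preadditive 𝒞]
  {S C T D : HomologicalComplex 𝒞 (ComplexShape.down ℤ)}

/-- If `C` and `D` are deformation retracts of `S` and `T`, then a homotopy `f g ≃ 1` for
`f : S → T` and `g : T → S` induces one for the induced maps between `C` and `D`. -/
def transferHomotopy {πC : S ⟶ C} {ιC : C ⟶ S} {πD : T ⟶ D} {ιD : D ⟶ T}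
    (hC : ιC ≫ πC = 𝟙 C) (HD : Homotopy (πD ≫ ιD) (𝟙 T)) {f : S ⟶ T} {g : T ⟶ S}
    (H : Homotopy (f ≫ g) (𝟙 S)) :
    Homotopy ((ιC ≫ f ≫ πD) ≫ ιD ≫ g ≫ πC) (𝟙 C) :=
  ((Homotopy.ofEq (by simp only [Category.assoc])).trans
    ((HD.compLeft (ιC ≫ f)).compRight (g ≫ πC))).trans
    (((Homotopy.ofEq (by simp only [Category.assoc, Category.comp_id])).trans
      ((H.compLeft ιC).compRight πC)).trans
      (Homotopy.ofEq (by rw [Category.comp_id, hC])))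

theorem transferHomotopy_hom {πC : S ⟶ C} {ιC : C ⟶ S} {πD : T ⟶ D} {ιD : D ⟶ T}
    (hC : ιC ≫ πC = 𝟙 C) (HD : Homotopy (πD ≫ ιD) (𝟙 T)) {f : S ⟶ T} {g : T ⟶ S}
    (H : Homotopy (f ≫ g) (𝟙 S)) (i j : ℤ) :
    (transferHomotopy hC HD H).hom i j =
      (ιC.f i ≫ f.f i) ≫ HD.hom i j ≫ g.f j ≫ πC.f j + ιC.f i ≫ H.hom i j ≫ πC.f j := by
  simp [transferHomotopy, Homotopy.trans, Homotopy.compLeft, Homotopy.compRight, Homotopy.ofEq]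

/-- The equivalence between deformation retracts that is induced by an equivalence. -/
def transferEquiv {πC : S ⟶ C} {ιC : C ⟶ S} {πD : T ⟶ D} {ιD : D ⟶ T}
    (hC : ιC ≫ πC = 𝟙 C) (HC : Homotopy (πC ≫ ιC) (𝟙 S)) (hD : ιD ≫ πD = 𝟙 D)
    (HD : Homotopy (πD ≫ ιD) (𝟙 T)) (e : HomotopyEquiv S T) : HomotopyEquiv C D where
  hom := ιC ≫ e.hom ≫ πD
  inv := ιD ≫ e.inv ≫ πC
  homotopyHomInvId := transferHomotopy hC HD e.homotopyHomInvId
  homotopyInvHomId := transferHomotopy hD HC e.homotopyInvHomId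

end TransferGeneral

section Transfer

variable {W : Type w} {A : Type u} [Category.{v} A] [Preadditive A]
  {K : PreAbstractSimplicialComplex W} {var : Variance}

/-- Control of a chain equivalence by three predicates: the two chain maps lead from `P` to `Q` and
from `Q` to `R`, the two homotopies lead from `P` to `R`.  Two steps are allowed for the homotopies
since in a composition `f H g`, as it occurs in `transferHomotopy`, both chain maps have to be
passed. -/
structure Controlled (P Q R : Finset W → Prop) {C D : ACplx A var K}
    (e : HomotopyEquiv (famCplx C) (famCplx D)) : Prop where
  hom₁ : ∀ n, Fam.Respects var (onFaces K P) (onFaces K Q) (e.hom.f n)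
  hom₂ : ∀ n, Fam.Respects var (onFaces K Q) (onFaces K R) (e.hom.f n)
  inv₁ : ∀ n, Fam.Respects var (onFaces K P) (onFaces K Q) (e.inv.f n)
  inv₂ : ∀ n, Fam.Respects var (onFaces K Q) (onFaces K R) (e.inv.f n)
  homotopyHomInv : ∀ n m, Fam.Respects var (onFaces K P) (onFaces K R) (e.homotopyHomInvId.hom n m)
  homotopyInvHom : ∀ n m, Fam.Respects var (onFaces K P) (onFaces K R) (e.homotopyInvHomId.hom n m)

/-- A deformation retraction of `S` onto `C`, where `C` and `S` are complexes over different
simplicial complexes, all of whose constituents respect the predicates `P'` and `P` whenever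
`Good P P'`. -/
def HasGoodRetraction {W' : Type w} {K' : PreAbstractSimplicialComplex W'}
    (Good : (Finset W → Prop) → (Finset W' → Prop) → Prop) (C : ACplx A var K)
    (S : ACplx A var K') : Prop :=
  ∃ (π : famCplx S ⟶ famCplx C) (ι : famCplx C ⟶ famCplx S) (H : Homotopy (π ≫ ι) (𝟙 _)),
    ι ≫ π = 𝟙 _ ∧ ∀ P P', Good P P' →
      (∀ n, Fam.Respects var (onFaces K' P') (onFaces K P) (π.f n)) ∧
      (∀ n, Fam.Respects var (onFaces K P) (onFaces K' P') (ι.f n)) ∧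
      ∀ n m, Fam.Respects var (onFaces K' P') (onFaces K' P') (H.hom n m)

/-- A controlled equivalence induces a controlled equivalence between deformation retracts. The
outer predicates do not deteriorate: the homotopy of the target runs between the two chain maps. -/
theorem HasGoodRetraction.transfer {W' : Type w} {K' : PreAbstractSimplicialComplex W'}
    {Good : (Finset W → Prop) → (Finset W' → Prop) → Prop} {C D : ACplx A var K}
    {S T : ACplx A var K'} (hC : HasGoodRetraction Good C S) (hD : HasGoodRetraction Good D T)
    (e : HomotopyEquiv (famCplx S) (famCplx T)) :
    ∃ e' : HomotopyEquiv (famCplx C) (famCplx D), ∀ P P' Q Q' R R', Good P P' → Good Q Q' →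
      Good R R' → Controlled P' Q' R' e → Controlled P Q R e' := by
  obtain ⟨πC, ιC, HC, h1, hgC⟩ := hC
  obtain ⟨πD, ιD, HD, h2, hgD⟩ := hD
  refine ⟨transferEquiv h1 HC h2 HD e, fun P P' Q Q' R R' hP hQ hR he => ?_⟩
  obtain ⟨cP1, cP2, -⟩ := hgC P P' hP
  obtain ⟨cQ1, cQ2, cQ3⟩ := hgC Q Q' hQ
  obtain ⟨cR1, cR2, -⟩ := hgC R R' hR
  obtain ⟨dP1, dP2, -⟩ := hgD P P' hP
  obtain ⟨dQ1, dQ2, dQ3⟩ := hgD Q Q' hQ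
  obtain ⟨dR1, dR2, -⟩ := hgD R R' hR
  refine ⟨fun n => (cP2 n).comp ((he.hom₁ n).comp (dQ1 n)),
    fun n => (cQ2 n).comp ((he.hom₂ n).comp (dR1 n)),
    fun n => (dP2 n).comp ((he.inv₁ n).comp (cQ1 n)),
    fun n => (dQ2 n).comp ((he.inv₂ n).comp (cR1 n)), fun n m => ?_, fun n m => ?_⟩
  · refine Eq.subst (motive := fun f => Fam.Respects var (onFaces K P) (onFaces K R) f)
      (transferHomotopy_hom h1 HD e.homotopyHomInvId n m).symm ?_
    exact (((cP2 n).comp (he.hom₁ n)).comp ((dQ3 n m).comp ((he.inv₂ m).comp (cR1 m)))).add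
      ((cP2 n).comp ((he.homotopyHomInv n m).comp (cR1 m)))
  · refine Eq.subst (motive := fun f => Fam.Respects var (onFaces K P) (onFaces K R) f)
      (transferHomotopy_hom h2 HC e.homotopyInvHomId n m).symm ?_
    exact (((dP2 n).comp (he.inv₁ n)).comp ((cQ3 n m).comp ((he.hom₂ m).comp (dR1 m)))).add
      ((dP2 n).comp ((he.homotopyInvHom n m).comp (dR1 m)))

end Transfer

section Stellar

variable {W : Type w} [DecidableEq W] {A : Type u} [Category.{v} A] [Preadditive A]
  {K : PreAbstractSimplicialComplex W} {N : Set W} {base : W → Finset W} {c : W → W}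
  {var : Variance}

variable (h : IsDisjointStellar K N base) (hc : ∀ x ∈ N, c x ∈ base x) (hK : IsFDLF K)
  (C : ACplx A var K)

/-- The simplex `σ` and the kept simplex that represents it arise from each other by adding `x` or
`c x` and passing to a face. -/
theorem StellarClosed.kept_iff {P : Finset W → Prop} (hP : StellarClosed N base c P)
    (h : IsDisjointStellar K N base) {σ : Finset W} (hσ : σ ∈ K.faces) :
    P (kept N base c σ) ↔ P σ := by
  by_cases hex : ∃ x ∈ N, base x ⊆ σ
  · obtain ⟨x, hx, hxσ⟩ := hex
    rw [h.kept_of_base_subset hσ hx hxσ]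
    constructor
    · intro h1
      refine hP.mono ?_ (hP.retr hx (Finset.mem_insert_self _ _) h1)
      intro y hy
      by_cases hyc : y = c x
      · exact hyc ▸ Finset.mem_insert_self _ _
      · exact Finset.mem_insert_of_mem (Finset.mem_insert_of_mem (Finset.mem_erase.2 ⟨hyc, hy⟩))
    · intro h1
      exact hP.mono (Finset.insert_subset_insert _ (Finset.erase_subset _ _))
        (hP.star hx hxσ h1)
  · push Not at hex
    rw [kept_of_not hex]

theorem StellarClosed.paired_iff {P : Finset W → Prop} (hP : StellarClosed N base c P)
    {s t : Finset W} (hst : Paired N c s t) : P s ↔ P t := by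
  obtain ⟨x, hx, hxs, -, rfl⟩ := hst
  exact ⟨fun h => hP.retr hx hxs h, hP.mono (Finset.subset_insert _ _)⟩

/-- A complex is a deformation retract of its algebraic subdivision, by maps which respect all
predicates that are closed for the stellar subdivision. -/
theorem hasGoodRetraction_subdivStellar :
    HasGoodRetraction (fun P P' => P = P' ∧ StellarClosed N base c P) C
      (subdivStellar h hc hK C) := by
  obtain ⟨π, ι, H, h1, h2, h3, h4⟩ := exists_deformationRetract_of_elimination
    (famCplx (subdivStellar h hc hK C)) (famCplx C) (keptIncl h hc C) (keptProj h hc C)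
    (pairHomotopy h hc C) (pairDifferential h hc C)
    (fun i j hij => Fam.hom_ext fun s t => Fam.mono_not fun he => hij he.1)
    (keptIncl_comp_keptProj h hc C) (keptIncl_comp_pairHomotopy h hc C)
    (pairHomotopy_comp_keptProj h hc C) (pairHomotopy_comp_pairHomotopy h hc C)
    (pairHomotopy_d_pairHomotopy h hc hK C) (id_eq_kept_add_paired h hc C)
    (eliminated_differential h hc hK C)
  refine ⟨π, ι, H, h1, ?_⟩
  rintro P _ ⟨rfl, hP⟩
  have ra : ∀ n, Fam.Respects var (onFaces K P) (onFaces (stellar K N base) P)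
      (keptIncl h hc C n) := by
    intro n (σ : Face K) s hne
    have he : s = keptFace h hc σ := Fam.rel_of_mono_ne_zero hne
    subst he
    have := hP.kept_iff h σ.2
    cases var
    · exact this.2
    · exact this.1
  have rb : ∀ n, Fam.Respects var (onFaces (stellar K N base) P) (onFaces K P)
      (keptProj h hc C n) := by
    intro n s (σ : Face K) hne
    have he : s = keptFace h hc σ := Fam.rel_of_mono_ne_zero hne
    subst he
    have := hP.kept_iff h σ.2
    cases var
    · exact this.1
    · exact this.2
  have rh : ∀ n m, Fam.Respects var (onFaces (stellar K N base) P)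
      (onFaces (stellar K N base) P) (pairHomotopy h hc C n m) := by
    intro n m s t hne
    have he := (Fam.rel_of_mono_ne_zero hne).2
    cases var
    · exact (hP.paired_iff he).1
    · exact (hP.paired_iff he).1
  have rd : ∀ n m, Fam.Respects var (onFaces (stellar K N base) P)
      (onFaces (stellar K N base) P) (subdivFamD h hc hK C n m) := by
    intro n m s t hne
    have he : var.rel _ s t := rel_of_subdivD_ne_zero h hc C n m hne
    cases var
    · exact hP.mono he
    · exact hP.mono he
  refine ⟨fun n => ?_, fun n => ?_, fun n m => ?_⟩
  · refine Eq.subst (motive := fun f => Fam.Respects var (onFaces (stellar K N base) P)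
      (onFaces K P) f) (h2 n (n + 1) rfl).symm ?_
    exact (rb n).sub ((rh n (n + 1)).comp ((rd (n + 1) n).comp (rb n)))
  · refine Eq.subst (motive := fun f => Fam.Respects var (onFaces K P)
      (onFaces (stellar K N base) P) f) (h3 (n - 1) n (by omega)).symm ?_
    exact (ra n).sub ((ra n).comp ((rd n (n - 1)).comp (rh (n - 1) n)))
  · refine Eq.subst (motive := fun f => Fam.Respects var (onFaces (stellar K N base) P)
      (onFaces (stellar K N base) P) f) (h4 n m).symm ?_
    exact (rh n m).neg

end Stellar

/-! ### Transfer of control through one barycentric subdivision -/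

section Reindex

variable {W W' : Type w} {A : Type u} [Category.{v} A] [Preadditive A]
  {K : PreAbstractSimplicialComplex W} {K' : PreAbstractSimplicialComplex W'} {var : Variance}

/-- A reindexed complex is isomorphic to the original one, by matrices with entries over the
graph of the bijection. -/
theorem hasGoodRetraction_reindex (e : Face K ≃ Face K')
    (he : ∀ s t, var.rel K s t → var.rel K' (e s) (e t)) (C : ACplx A var K) :
    HasGoodRetraction (fun P P' => ∀ s : Face K, P' (e s).1 ↔ P s.1) C
      (((Graded.reindex e _ _ he A).mapHomologicalComplex _).obj C) := by
  let F : ℤ → Fam.{w} A := fun n => ⟨Face K, (C.X n).obj⟩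
  let G : ℤ → Fam.{w} A := fun n => ⟨Face K', fun j => (C.X n).obj (e.symm j)⟩
  let dF : ∀ i j, F i ⟶ F j := fun i j =>
    Fam.Hom.mk (M := F i) (N := F j) (C.d i j).comp (C.d i j).finite_column
  let dG : ∀ i j, G i ⟶ G j := fun i j =>
    Fam.Hom.mk (M := G i) (N := G j) (fun s t => (C.d i j).comp (e.symm s) (e.symm t))
      (fun s => ((C.d i j).finite_column (e.symm s)).preimage e.symm.injective.injOn)
  let p : ∀ n, G n ⟶ F n := fun n => Fam.mono (G n) (F n) 1
    (fun (j : Face K') (i : Face K) => e.symm j = i) (fun _ _ _ h1 h2 => h1.symm.trans h2)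
    (by rintro j _ rfl; rfl)
  let q : ∀ n, F n ⟶ G n := fun n => Fam.mono (F n) (G n) 1
    (fun (i : Face K) (j : Face K') => e.symm j = i)
    (fun _ _ _ h1 h2 => e.symm.injective (h1.trans h2.symm)) (by rintro _ j rfl; rfl)
  have hp : ∀ n (j : Face K'), (p n).comp j (e.symm j) = 𝟙 _ := fun n j => by
    refine (Fam.mono_of (rfl : e.symm j = e.symm j)).trans ?_
    simp [G, F]
  have hq : ∀ n (j : Face K'), (q n).comp (e.symm j) j = 𝟙 _ := fun n j => by
    refine (Fam.mono_of (rfl : e.symm j = e.symm j)).trans ?_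
    simp [G, F]
  have hpf : ∀ {n m} (f : F n ⟶ F m) (j : Face K') (i : Face K),
      (p n ≫ f).comp j i = f.comp (e.symm j) i := fun {n m} f j i => by
    rw [Fam.comp_comp_eq_single _ _ _ _ (e.symm j : Face K) fun i' hne h =>
      (hne (Fam.rel_of_mono_ne_zero h).symm).elim, hp]
    exact Category.id_comp _
  have hqf : ∀ {n} {M : Fam.{w} A} (f : G n ⟶ M) (j : Face K') (i : M.I),
      (q n ≫ f).comp (e.symm j) i = f.comp j i := fun {n M} f j i => by
    rw [Fam.comp_comp_eq_single _ _ _ _ (j : Face K') fun j' hne h =>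
      (hne (e.symm.injective (Fam.rel_of_mono_ne_zero h))).elim, hq]
    exact Category.id_comp _
  have hfp : ∀ {n m} (f : G n ⟶ G m) (j k : Face K'),
      (f ≫ p m).comp j (e.symm k) = f.comp j k := fun {n m} f j k => by
    rw [Fam.comp_comp_eq_single _ _ _ _ (k : Face K') fun k' hne _ => Fam.mono_not fun h =>
      hne (e.symm.injective h), hp]
    exact Category.comp_id _
  have hpd : ∀ i j, p i ≫ dF i j = dG i j ≫ p j := fun i j => by
    refine Fam.hom_ext fun (s : Face K') (t : Face K) => ?_
    obtain ⟨t, rfl⟩ := e.symm.surjective t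
    rw [hpf, hfp]
  have hpq : ∀ n, p n ≫ q n = 𝟙 (G n) := fun n => by
    refine Fam.hom_ext fun (s : Face K') (t : Face K') => ?_
    rw [Fam.comp_comp_eq_single _ _ _ _ (e.symm s : Face K) fun i' hne h =>
      (hne (Fam.rel_of_mono_ne_zero h).symm).elim, hp]
    refine (Category.id_comp _).trans ?_
    by_cases hst : s = t
    · subst hst
      rw [hq, Fam.id_comp_self]
    · rw [Fam.id_comp_ne hst]
      exact Fam.mono_not fun h => hst (e.symm.injective h).symm
  have hqp : ∀ n, q n ≫ p n = 𝟙 (F n) := fun n => by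
    refine Fam.hom_ext fun (s : Face K) (t : Face K) => ?_
    obtain ⟨s, rfl⟩ := e.symm.surjective s
    rw [hqf]
    by_cases hst : e.symm s = t
    · subst hst
      rw [hp, Fam.id_comp_self]
    · rw [Fam.id_comp_ne hst]
      exact Fam.mono_not hst
  have hqd : ∀ i j, q i ≫ dG i j = dF i j ≫ q j := fun i j => by
    have := congrArg (fun f => q i ≫ f ≫ q j) (hpd i j)
    simp only [Category.assoc, hpq, Category.comp_id] at this
    rw [← this, ← Category.assoc, hqp, Category.id_comp]
  let π : famCplx (((Graded.reindex e _ _ he A).mapHomologicalComplex _).obj C) ⟶ famCplx C :=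
    { f := p
      comm' := fun i j _ => hpd i j }
  let ι : famCplx C ⟶ famCplx (((Graded.reindex e _ _ he A).mapHomologicalComplex _).obj C) :=
    { f := q
      comm' := fun i j _ => hqd i j }
  refine ⟨π, ι, Homotopy.ofEq (HomologicalComplex.hom_ext _ _ fun n => hpq n),
    HomologicalComplex.hom_ext _ _ fun n => hqp n, fun P P' hP => ⟨fun n => ?_, fun n => ?_,
    fun n m => Fam.Respects.zero⟩⟩
  · intro (j : Face K') (i : Face K) hne
    have hij : e.symm j = i := Fam.rel_of_mono_ne_zero (show (p n).comp j i ≠ 0 from hne)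
    subst hij
    have := hP (e.symm j)
    rw [e.apply_symm_apply] at this
    cases var
    · exact this.1
    · exact this.2
  · intro (i : Face K) (j : Face K') hne
    have hij : e.symm j = i := Fam.rel_of_mono_ne_zero (show (q n).comp i j ≠ 0 from hne)
    subst hij
    have := hP (e.symm j)
    rw [e.apply_symm_apply] at this
    cases var
    · exact this.2
    · exact this.1

end Reindex

section Level

variable {V : Type w} [DecidableEq V] {A : Type u} [Category.{v} A] [Preadditive A]
  {K : PreAbstractSimplicialComplex V} {var : Variance}

/-- A pair of predicates, `P` on the simplices of `K` and `P'` on those of its subdivision, which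
agree on `K` and such that `P'` is closed under the moves of the barycentric subdivision. -/
structure LevelClosed (c : VertexChoice K) (P : Finset V → Prop) (P' : Finset (Finset V) → Prop) :
    Prop where
  mono : ∀ {s t}, t ⊆ s → P' s → P' t
  rename : ∀ s, P' (vertexSimplex s) ↔ P s
  star : ∀ (x : Face K) {s}, vertexSimplex x.1 ⊆ s → P' s → P' (insert x.1 s)
  retr : ∀ (x : Face K) {s}, x.1 ∈ s → P' s → P' (insert {c.vertex x} s)

theorem LevelClosed.stellarClosed {c : VertexChoice K} {P : Finset V → Prop}
    {P' : Finset (Finset V) → Prop} (h : LevelClosed c P P') (m : ℕ) :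
    StellarClosed (newVertices K m) vertexSimplex c.toMap P' where
  mono := h.mono
  star {x s} hx hxs hs := h.star ⟨x, hx.1⟩ hxs hs
  retr {x s} hx hxs hs := by
    rw [VertexChoice.toMap, dif_pos hx.1]
    exact h.retr ⟨x, hx.1⟩ hxs hs

/-- An equivalence between barycentric subdivisions induces an equivalence between the original
complexes, which inherits all control by predicates that are closed under the moves of the
subdivision. -/
theorem exists_controlled_of_subdiv (hK : IsFDLF K) (c : VertexChoice K) {C D : ACplx A var K}
    (e : HomotopyEquiv (famCplx (subdiv hK c C)) (famCplx (subdiv hK c D))) :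
    ∃ e' : HomotopyEquiv (famCplx C) (famCplx D), ∀ P P' Q Q' R R', LevelClosed c P P' →
      LevelClosed c Q Q' → LevelClosed c R R' → Controlled P' Q' R' e → Controlled P Q R e' := by
  have key : ∀ (m : ℕ) (e : HomotopyEquiv (famCplx (subdivStage hK c C m))
      (famCplx (subdivStage hK c D m))),
      ∃ e' : HomotopyEquiv (famCplx C) (famCplx D), ∀ P P' Q Q' R R', LevelClosed c P P' →
      LevelClosed c Q Q' → LevelClosed c R R' → Controlled P' Q' R' e → Controlled P Q R e' := by
    intro m
    induction m with
    | zero =>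
      intro e
      obtain ⟨e', he'⟩ := (hasGoodRetraction_reindex _ (rel_renameEquiv var K) C).transfer
        (hasGoodRetraction_reindex _ (rel_renameEquiv var K) D) e
      exact ⟨e', fun P P' Q Q' R R' hP hQ hR => he' P P' Q Q' R R' (fun s => hP.rename s.1)
        (fun s => hQ.rename s.1) (fun s => hR.rename s.1)⟩
    | succ m ih =>
      intro e
      obtain ⟨e', he'⟩ := (hasGoodRetraction_subdivStellar (isDisjointStellar_sdStage hK m)
        (c.toMap_mem m) (isFDLF_sdStage hK m) (subdivStage hK c C m)).transfer
        (hasGoodRetraction_subdivStellar (isDisjointStellar_sdStage hK m) (c.toMap_mem m)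
          (isFDLF_sdStage hK m) (subdivStage hK c D m)) e
      obtain ⟨e'', he''⟩ := ih e'
      exact ⟨e'', fun P P' Q Q' R R' hP hQ hR h => he'' P P' Q Q' R R' hP hQ hR
        (he' P' P' Q' Q' R' R' ⟨rfl, hP.stellarClosed m⟩ ⟨rfl, hQ.stellarClosed m⟩
          ⟨rfl, hR.stellarClosed m⟩ h)⟩
  exact key _ e

end Level

/-! ### Barycentric coordinates in iterated subdivisions -/

section Coordinates

variable {V : Type w} {W : Type w}

theorem barycentre_apply (p : W → V →₀ ℝ) (s : Finset W) (v : V) :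
    barycentre p s v = (s.card : ℝ)⁻¹ * ∑ x ∈ s, p x v := by
  simp [barycentre]

theorem barycentre_nonneg {p : W → V →₀ ℝ} (hp : ∀ x v, 0 ≤ p x v) (s : Finset W) (v : V) :
    0 ≤ barycentre p s v := by
  rw [barycentre_apply]
  exact mul_nonneg (by positivity) (Finset.sum_nonneg fun x _ => hp x v)

theorem barycentre_le {p : W → V →₀ ℝ} {s : Finset W} (hs : s.Nonempty) {v : V} {a : ℝ}
    (h : ∀ x ∈ s, p x v ≤ a) : barycentre p s v ≤ a := by
  have hc : (0 : ℝ) < s.card := by exact_mod_cast hs.card_pos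
  rw [barycentre_apply, inv_mul_le_iff₀ hc]
  simpa using Finset.sum_le_sum h

theorem le_barycentre {p : W → V →₀ ℝ} {s : Finset W} (hs : s.Nonempty) {v : V} {a : ℝ}
    (h : ∀ x ∈ s, a ≤ p x v) : a ≤ barycentre p s v := by
  have hc : (0 : ℝ) < s.card := by exact_mod_cast hs.card_pos
  rw [barycentre_apply, le_inv_mul_iff₀ hc]
  simpa using Finset.sum_le_sum h

theorem barycentre_singleton (p : W → V →₀ ℝ) (x : W) : barycentre p {x} = p x := by
  simp [barycentre]

theorem mem_support_barycentre {p : W → V →₀ ℝ} (hp : ∀ x v, 0 ≤ p x v) {s : Finset W} {v : V} :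
    v ∈ (barycentre p s).support ↔ ∃ x ∈ s, v ∈ (p x).support := by
  simp only [Finsupp.mem_support_iff]
  rw [barycentre_apply]
  constructor
  · intro h
    obtain ⟨x, hx, hne⟩ := Finset.exists_ne_zero_of_sum_ne_zero (right_ne_zero_of_mul h)
    exact ⟨x, hx, hne⟩
  · rintro ⟨x, hx, hne⟩
    have h1 : 0 < ∑ x ∈ s, p x v :=
      Finset.sum_pos' (fun y _ => hp y v) ⟨x, hx, lt_of_le_of_ne (hp x v) (Ne.symm hne)⟩
    have h2 : (0 : ℝ) < s.card := by exact_mod_cast Finset.card_pos.2 ⟨x, hx⟩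
    positivity

theorem single_one_apply_eq (x v : V) :
    Finsupp.single x (1 : ℝ) v = 0 ∨ Finsupp.single x (1 : ℝ) v = 1 := by
  classical
  rw [Finsupp.single_apply]
  split_ifs
  · exact Or.inr rfl
  · exact Or.inl rfl

theorem position_zero_apply_eq (x : SdVertex V 0) (v : V) :
    position V 0 x v = 0 ∨ position V 0 x v = 1 :=
  single_one_apply_eq (V := V) x v

theorem position_nonneg (V : Type w) : ∀ (j : ℕ) (x : SdVertex V j) (v : V), 0 ≤ position V j x v
  | 0, x, v => by
    rcases position_zero_apply_eq x v with h | h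
    · exact h.ge
    · exact zero_le_one.trans h.ge
  | j + 1, s, v => barycentre_nonneg (position_nonneg V j) s v

section Sd

variable [DecidableEq W] {K : PreAbstractSimplicialComplex W}

theorem card_le_of_mem_sd (hK : IsFDLF K) {n : ℕ} (hn : ∀ s ∈ K.faces, s.card ≤ n)
    {S : Finset (Finset W)} (hS : S ∈ (sd K).faces) : S.card ≤ n := by
  obtain ⟨-, hSK, hch⟩ := (mem_sd_iff hK S).1 hS
  have : S.card ≤ (Finset.Icc 1 n).card := by
    refine Finset.card_le_card_of_injOn Finset.card (fun s hs => ?_) fun s hs t ht hst => ?_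
    · exact Finset.mem_coe.2 (Finset.mem_Icc.2
        ⟨(Face.nonempty (hSK s hs)).card_pos, hn s (hSK s hs)⟩)
    · have hst' : s.card = t.card := hst
      rcases hch s hs t ht with h | h
      · exact Finset.eq_of_subset_of_card_le h hst'.ge
      · exact (Finset.eq_of_subset_of_card_le h hst'.le).symm
  simpa using this

/-- A simplex of the subdivision has a largest vertex, its carrier. -/
theorem exists_carrier (hK : IsFDLF K) {S : Finset (Finset W)} (hS : S ∈ (sd K).faces) :
    ∃ x ∈ S, x ∈ K.faces ∧ ∀ y ∈ S, y ⊆ x := by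
  obtain ⟨hne, hSK, hch⟩ := (mem_sd_iff hK S).1 hS
  obtain ⟨x, hx, hmax⟩ := S.exists_max_image Finset.card hne
  refine ⟨x, hx, hSK x hx, fun y hy => ?_⟩
  rcases hch y hy x hx with h | h
  · exact h
  · rw [Finset.eq_of_subset_of_card_le h (hmax y hy)]

theorem abs_sub_barycentre_le {p : W → V →₀ ℝ} {s : Finset W} {v : V} {M : ℝ} {n : ℕ}
    (hM : ∀ a ∈ s, ∀ b ∈ s, |p a v - p b v| ≤ M) (hs : s.card ≤ n + 1) {a : W} (ha : a ∈ s) :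
    |p a v - barycentre p s v| ≤ n / (n + 1) * M := by
  have hM0 : 0 ≤ M := (abs_nonneg _).trans (hM a ha a ha)
  have hc : (0 : ℝ) < s.card := by exact_mod_cast Finset.card_pos.2 ⟨a, ha⟩
  have h1 : p a v - barycentre p s v = (s.card : ℝ)⁻¹ * ∑ b ∈ s.erase a, (p a v - p b v) := by
    have : ∑ b ∈ s.erase a, (p a v - p b v) = ∑ b ∈ s, (p a v - p b v) := by
      rw [← Finset.add_sum_erase s _ ha, sub_self, zero_add]
    rw [this, barycentre_apply, Finset.sum_sub_distrib, Finset.sum_const, nsmul_eq_mul, mul_sub,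
      inv_mul_cancel_left₀ hc.ne']
  have h2 : |∑ b ∈ s.erase a, (p a v - p b v)| ≤ (s.card - 1) * M := by
    refine (Finset.abs_sum_le_sum_abs _ _).trans ?_
    refine (Finset.sum_le_card_nsmul _ _ M fun b hb => hM a ha b (Finset.mem_of_mem_erase hb)).trans
      ?_
    rw [Finset.card_erase_of_mem ha, nsmul_eq_mul,
      Nat.cast_sub (Finset.card_pos.2 ⟨a, ha⟩), Nat.cast_one]
  rw [h1, abs_mul, abs_of_pos (inv_pos.2 hc)]
  have h3 : (s.card : ℝ) ≤ n + 1 := by exact_mod_cast hs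
  have h4 : (s.card : ℝ)⁻¹ * (s.card - 1) ≤ n / (n + 1) := by
    rw [inv_mul_le_iff₀ hc, mul_div_assoc', le_div_iff₀ (by positivity)]
    nlinarith
  calc (s.card : ℝ)⁻¹ * |∑ b ∈ s.erase a, (p a v - p b v)|
      ≤ (s.card : ℝ)⁻¹ * ((s.card - 1) * M) := mul_le_mul_of_nonneg_left h2 (by positivity)
    _ = (s.card : ℝ)⁻¹ * (s.card - 1) * M := by ring
    _ ≤ n / (n + 1) * M := mul_le_mul_of_nonneg_right h4 hM0

theorem abs_barycentre_sub_barycentre_le {p : W → V →₀ ℝ} {s t : Finset W} {v : V} {M : ℝ} {n : ℕ}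
    (hM : ∀ a ∈ s, ∀ b ∈ s, |p a v - p b v| ≤ M) (hs : s.card ≤ n + 1) (ht : t.Nonempty)
    (hts : t ⊆ s) : |barycentre p t v - barycentre p s v| ≤ n / (n + 1) * M := by
  have h := fun a (ha : a ∈ t) => abs_le.1 (abs_sub_barycentre_le hM hs (hts ha))
  rw [abs_le]
  constructor
  · have := le_barycentre (p := p) (v := v) (a := barycentre p s v - n / (n + 1) * M) ht
      fun a ha => by linarith [(h a ha).1]
    linarith
  · have := barycentre_le (p := p) (v := v) (a := barycentre p s v + n / (n + 1) * M) ht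
      fun a ha => by linarith [(h a ha).2]
    linarith

theorem mesh_sd (hK : IsFDLF K) {p : W → V →₀ ℝ} {v : V} {M : ℝ} {n : ℕ}
    (hn : ∀ s ∈ K.faces, s.card ≤ n + 1)
    (hM : ∀ s ∈ K.faces, ∀ a ∈ s, ∀ b ∈ s, |p a v - p b v| ≤ M) {S : Finset (Finset W)}
    (hS : S ∈ (sd K).faces) : ∀ x ∈ S, ∀ y ∈ S,
      |barycentre p x v - barycentre p y v| ≤ n / (n + 1) * M := by
  obtain ⟨-, hSK, hch⟩ := (mem_sd_iff hK S).1 hS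
  intro x hx y hy
  rcases hch x hx y hy with h | h
  · exact abs_barycentre_sub_barycentre_le (hM y (hSK y hy)) (hn y (hSK y hy))
      (Face.nonempty (hSK x hx)) h
  · rw [abs_sub_comm]
    exact abs_barycentre_sub_barycentre_le (hM x (hSK x hx)) (hn x (hSK x hx))
      (Face.nonempty (hSK y hy)) h

end Sd

variable {X : PreAbstractSimplicialComplex V}

theorem card_le_of_mem_sdIter (hX : IsFDLF X) : ∀ (j : ℕ) {s : Finset (SdVertex V j)},
    s ∈ (sdIter X j).faces → s.card ≤ complexDim X + 1
  | 0, _, hs => card_le_complexDim hX hs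
  | j + 1, _, hs => card_le_of_mem_sd (isFDLF_sdIter hX j)
      (fun _ ht => card_le_of_mem_sdIter hX j ht) hs

/-- The simplices of iterated subdivisions become small. -/
theorem mesh_sdIter (hX : IsFDLF X) (v : V) : ∀ (j : ℕ) {s : Finset (SdVertex V j)},
    s ∈ (sdIter X j).faces → ∀ x ∈ s, ∀ y ∈ s, |position V j x v - position V j y v| ≤
      ((complexDim X : ℝ) / (complexDim X + 1)) ^ j
  | 0, s, _, x, _, y, _ => by
    rw [pow_zero]
    rcases position_zero_apply_eq x v with h | h <;>
      rcases position_zero_apply_eq y v with h' | h' <;> rw [h, h'] <;> norm_num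
  | j + 1, s, hs, x, hx, y, hy => by
    rw [pow_succ']
    exact mesh_sd (isFDLF_sdIter hX j) (fun _ ht => card_le_of_mem_sdIter hX j ht)
      (fun _ ht => mesh_sdIter hX v j ht) hs x hx y hy

theorem barycentre_eq_zero_or_le {p : W → V →₀ ℝ} (hp : ∀ x v, 0 ≤ p x v) {s : Finset W} {v : V}
    {n : ℕ} (hn : s.card ≤ n + 1) {m : ℝ} (h : ∀ x ∈ s, p x v = 0 ∨ m ≤ p x v) :
    barycentre p s v = 0 ∨ ((n : ℝ) + 1)⁻¹ * m ≤ barycentre p s v := by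
  by_cases h0 : ∀ x ∈ s, p x v = 0
  · left
    rw [barycentre_apply, Finset.sum_eq_zero h0, mul_zero]
  · right
    push Not at h0
    obtain ⟨x, hx, hne⟩ := h0
    have h1 : m ≤ p x v := (h x hx).resolve_left hne
    have h2 : p x v ≤ ∑ y ∈ s, p y v :=
      Finset.single_le_sum (f := fun y => p y v) (fun y _ => hp y v) hx
    have h3 : (0 : ℝ) < s.card := by exact_mod_cast Finset.card_pos.2 ⟨x, hx⟩
    have h4 : (s.card : ℝ) ≤ n + 1 := by exact_mod_cast hn
    rw [barycentre_apply]
    calc ((n : ℝ) + 1)⁻¹ * m ≤ ((n : ℝ) + 1)⁻¹ * p x v := by gcongr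
      _ ≤ (s.card : ℝ)⁻¹ * p x v := by
        have := hp x v
        gcongr
      _ ≤ _ := by gcongr

/-- The nonzero coordinates of the vertices of an iterated subdivision are bounded from below. -/
theorem position_eq_zero_or_le (hX : IsFDLF X) (v : V) : ∀ (j : ℕ) {s : Finset (SdVertex V j)},
    s ∈ (sdIter X j).faces → ∀ x ∈ s, position V j x v = 0 ∨
      (((complexDim X : ℝ) + 1)⁻¹) ^ j ≤ position V j x v
  | 0, s, _, x, _ => by
    rw [pow_zero]
    rcases position_zero_apply_eq x v with h | h
    · exact Or.inl h
    · exact Or.inr h.ge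
  | j + 1, s, hs, x, hx => by
    have hxK := ((mem_sd_iff (isFDLF_sdIter hX j) s).1 hs).2.1 x hx
    rw [pow_succ']
    exact barycentre_eq_zero_or_le (position_nonneg V j) (card_le_of_mem_sdIter hX j hxK)
      (position_eq_zero_or_le hX v j hxK)

end Coordinates

/-! ### Estimates for the standard metric -/

section Metric

variable {V : Type w} {X : PreAbstractSimplicialComplex V}

/-- The Euclidean norm of barycentric coordinates. -/
def euclNorm (z : V →₀ ℝ) : ℝ := Real.sqrt (z.sum fun _ a => a ^ 2)

theorem euclDist_eq (x y : V →₀ ℝ) : euclDist x y = euclNorm (x - y) := rfl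

theorem sq_euclNorm (z : V →₀ ℝ) : euclNorm z ^ 2 = ∑ v ∈ z.support, z v ^ 2 :=
  Real.sq_sqrt (Finset.sum_nonneg fun _ _ => sq_nonneg _)

theorem euclNorm_nonneg (z : V →₀ ℝ) : 0 ≤ euclNorm z := Real.sqrt_nonneg _

theorem sum_sq_le_sq_euclNorm (z : V →₀ ℝ) (T : Finset V) :
    ∑ v ∈ T, z v ^ 2 ≤ euclNorm z ^ 2 := by
  classical
  rw [sq_euclNorm, ← Finset.sum_filter_add_sum_filter_not T (fun v => v ∈ z.support)]
  have h1 : ∑ v ∈ T with v ∉ z.support, z v ^ 2 = 0 := by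
    refine Finset.sum_eq_zero fun v hv => ?_
    rw [Finsupp.notMem_support_iff.1 (Finset.mem_filter.1 hv).2]
    norm_num
  rw [h1, add_zero]
  exact Finset.sum_le_sum_of_subset_of_nonneg (fun v hv => (Finset.mem_filter.1 hv).2)
    fun _ _ _ => sq_nonneg _

theorem abs_apply_le_euclNorm (z : V →₀ ℝ) (v : V) : |z v| ≤ euclNorm z := by
  refine abs_le_of_sq_le_sq ?_ (euclNorm_nonneg z)
  simpa using sum_sq_le_sq_euclNorm z {v}

theorem euclNorm_smul {a : ℝ} (ha : 0 ≤ a) (z : V →₀ ℝ) : euclNorm (a • z) = a * euclNorm z := by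
  rcases ha.eq_or_lt with rfl | ha
  · simp [euclNorm]
  · refine (sq_eq_sq₀ (euclNorm_nonneg _) (mul_nonneg ha.le (euclNorm_nonneg _))).1 ?_
    rw [mul_pow, sq_euclNorm, sq_euclNorm, Finsupp.support_smul_eq ha.ne', Finset.mul_sum]
    refine Finset.sum_congr rfl fun v _ => ?_
    rw [Finsupp.smul_apply, smul_eq_mul, mul_pow]

/-- The inner product with a fixed vector. -/
def euclInner (u z : V →₀ ℝ) : ℝ := ∑ v ∈ u.support, u v * z v

theorem abs_euclInner_le (u z : V →₀ ℝ) : |euclInner u z| ≤ euclNorm u * euclNorm z := by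
  refine abs_le_of_sq_le_sq ?_ (mul_nonneg (euclNorm_nonneg _) (euclNorm_nonneg _))
  rw [mul_pow]
  refine (Finset.sum_mul_sq_le_sq_mul_sq _ _ _).trans ?_
  rw [← sq_euclNorm u]
  exact mul_le_mul_of_nonneg_left (sum_sq_le_sq_euclNorm z _) (sq_nonneg _)

theorem euclInner_self (u : V →₀ ℝ) : euclInner u u = euclNorm u ^ 2 := by
  rw [sq_euclNorm, euclInner]
  exact Finset.sum_congr rfl fun v _ => (sq _).symm

theorem euclInner_sub (u x y : V →₀ ℝ) :
    euclInner u (x - y) = euclInner u x - euclInner u y := by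
  simp [euclInner, mul_sub, Finset.sum_sub_distrib]

theorem euclInner_add (u x y : V →₀ ℝ) :
    euclInner u (x + y) = euclInner u x + euclInner u y := by
  simp [euclInner, mul_add, Finset.sum_add_distrib]

theorem euclInner_smul (u : V →₀ ℝ) (a : ℝ) (x : V →₀ ℝ) :
    euclInner u (a • x) = a * euclInner u x := by
  simp only [euclInner, Finset.mul_sum, Finsupp.smul_apply, smul_eq_mul]
  exact Finset.sum_congr rfl fun v _ => by ring

theorem euclInner_sum {ι : Type*} (u : V →₀ ℝ) (T : Finset ι) (f : ι → V →₀ ℝ) :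
    euclInner u (∑ i ∈ T, f i) = ∑ i ∈ T, euclInner u (f i) := by
  simp only [euclInner, Finsupp.finsetSum_apply, Finset.mul_sum]
  exact Finset.sum_comm

/-- Functions which are `1`-Lipschitz for the Euclidean distance are so for the path metric. -/
theorem ofReal_abs_sub_le_stdDist {f : (V →₀ ℝ) → ℝ} (hf : ∀ x y, |f x - f y| ≤ euclDist x y)
    (x y : V →₀ ℝ) : ENNReal.ofReal |f x - f y| ≤ stdDist X x y := by
  refine le_iInf fun m => le_iInf fun p => le_iInf fun ⟨h0, hm, _⟩ => ?_
  subst h0 hm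
  have : |f (p 0) - f (p m)| ≤ ∑ k ∈ Finset.range m, euclDist (p k) (p (k + 1)) := by
    have h1 := Finset.sum_range_sub (fun k => f (p k)) m
    rw [abs_sub_comm, ← h1]
    refine (Finset.abs_sum_le_sum_abs _ _).trans (Finset.sum_le_sum fun k _ => ?_)
    rw [abs_sub_comm]
    exact hf _ _
  refine (ENNReal.ofReal_le_ofReal this).trans_eq ?_
  exact ENNReal.ofReal_sum_of_nonneg fun k _ => euclNorm_nonneg _

theorem abs_apply_sub_le_of_stdDist_le {x y : V →₀ ℝ} {ε : ℝ} (hε : 0 ≤ ε)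
    (h : stdDist X x y ≤ ENNReal.ofReal ε) (v : V) : |x v - y v| ≤ ε := by
  have h1 := (ofReal_abs_sub_le_stdDist (X := X) (f := fun z => z v)
    (fun x y => abs_apply_le_euclNorm (x - y) v) x y).trans h
  exact (ENNReal.ofReal_le_ofReal_iff hε).1 h1

theorem stdDist_le_of_cell {s : Finset V} (hs : s ∈ X.faces) {x y : V →₀ ℝ} (hx : x ∈ cell s)
    (hy : y ∈ cell s) : stdDist X x y ≤ ENNReal.ofReal (euclDist x y) := by
  refine (iInf_le _ 1).trans ((iInf_le _ fun k => if k = 0 then x else y).trans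
    ((iInf_le _ ⟨by simp, by simp, fun k hk => ?_⟩).trans ?_))
  · simp
  · have hk0 : k = 0 := by omega
    exact ⟨s, hs, by simpa [hk0] using hx, by simpa using hy⟩

end Metric

/-! ### Simplices of subdivisions inside simplices of the first subdivision -/

section Carrier

variable {V : Type w} {W : Type w}

/-- The closed simplex spanned by the points `p x`, `x ∈ s`. -/
def closedSimplex (p : W → V →₀ ℝ) (s : Finset W) : Set (V →₀ ℝ) :=
  {y | ∃ a : W → ℝ, (∀ x ∈ s, 0 ≤ a x) ∧ ∑ x ∈ s, a x = 1 ∧ y = ∑ x ∈ s, a x • p x}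

theorem apply_mem_closedSimplex (p : W → V →₀ ℝ) {s : Finset W} {x : W} (hx : x ∈ s) :
    p x ∈ closedSimplex p s := by
  classical
  refine ⟨fun y => if x = y then 1 else 0, fun y _ => by dsimp only; split_ifs <;> norm_num,
    by simp [hx], by simp [ite_smul, hx]⟩

theorem barycentre_mem_openSimplex (p : W → V →₀ ℝ) {s : Finset W} (hs : s.Nonempty) :
    barycentre p s ∈ openSimplex p s := by
  have hc : (0 : ℝ) < s.card := by exact_mod_cast hs.card_pos
  refine ⟨fun _ => (s.card : ℝ)⁻¹, fun _ _ => inv_pos.2 hc, ?_, ?_⟩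
  · rw [Finset.sum_const, nsmul_eq_mul, mul_inv_cancel₀ hc.ne']
  · rw [barycentre, Finset.smul_sum]

theorem barycentre_mem_closedSimplex {q : W → V →₀ ℝ} {U : Type w} {p : U → V →₀ ℝ}
    {s : Finset U} {t : Finset W} (ht : t.Nonempty) (h : ∀ x ∈ t, q x ∈ closedSimplex p s) :
    barycentre q t ∈ closedSimplex p s := by
  have hc : (0 : ℝ) < t.card := by exact_mod_cast ht.card_pos
  choose! a h0 h1 h2 using h
  refine ⟨fun y => (t.card : ℝ)⁻¹ * ∑ x ∈ t, a x y, fun y hy => mul_nonneg (inv_pos.2 hc).le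
    (Finset.sum_nonneg fun x hx => h0 x hx y hy), ?_, ?_⟩
  · rw [← Finset.mul_sum, Finset.sum_comm, Finset.sum_congr rfl h1, Finset.sum_const, nsmul_eq_mul,
      mul_one, inv_mul_cancel₀ hc.ne']
  · rw [barycentre, Finset.sum_congr rfl h2, Finset.sum_comm, Finset.smul_sum]
    refine Finset.sum_congr rfl fun y _ => ?_
    rw [← Finset.sum_smul, smul_smul]

/-- The open simplices of the subdivision lie in the open simplices spanned by their carriers. -/
theorem openSimplex_barycentre_subset [DecidableEq W] (p : W → V →₀ ℝ) {S : Finset (Finset W)}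
    {x : Finset W} (hx : x ∈ S) (hS : ∀ y ∈ S, y.Nonempty ∧ y ⊆ x) :
    openSimplex (barycentre p) S ⊆ openSimplex p x := by
  rintro _ ⟨a, ha, ha1, rfl⟩
  have hc : ∀ y ∈ S, (0 : ℝ) < y.card := fun y hy => by exact_mod_cast (hS y hy).1.card_pos
  refine ⟨fun w => ∑ y ∈ S, if w ∈ y then a y * (y.card : ℝ)⁻¹ else 0, fun w hw => ?_, ?_, ?_⟩
  · refine Finset.sum_pos' (fun y hy => ?_) ⟨x, hx, ?_⟩
    · split_ifs
      · exact (mul_pos (ha y hy) (inv_pos.2 (hc y hy))).le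
      · exact le_rfl
    · rw [if_pos hw]
      exact mul_pos (ha x hx) (inv_pos.2 (hc x hx))
  · rw [Finset.sum_comm, ← ha1]
    refine Finset.sum_congr rfl fun y hy => ?_
    rw [← Finset.sum_filter, Finset.filter_mem_eq_inter, Finset.inter_eq_right.2 (hS y hy).2,
      Finset.sum_const, nsmul_eq_mul, mul_left_comm, mul_inv_cancel₀ (hc y hy).ne', mul_one]
  · simp only [Finset.sum_smul, ite_smul, zero_smul]
    rw [Finset.sum_comm]
    refine Finset.sum_congr rfl fun y hy => ?_
    rw [← Finset.sum_filter, Finset.filter_mem_eq_inter, Finset.inter_eq_right.2 (hS y hy).2,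
      ← Finset.smul_sum, mul_smul]
    rfl

/-- Each simplex of an iterated subdivision has its interior in the interior of a simplex of the
first subdivision. -/
theorem exists_carrier_sd_one {X : PreAbstractSimplicialComplex V} (hX : IsFDLF X) :
    ∀ (k : ℕ) {κ : Finset (SdVertex V (k + 1))}, κ ∈ (sdIter X (k + 1)).faces →
    ∃ ρ ∈ (sdIter X 1).faces, openSimplex (position V (k + 1)) κ ⊆ openSimplex (position V 1) ρ ∧
      ∀ x ∈ κ, position V (k + 1) x ∈ closedSimplex (position V 1) ρ
  | 0, κ, hκ => ⟨κ, hκ, subset_rfl, fun _ hx => apply_mem_closedSimplex _ hx⟩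
  | k + 1, κ, hκ => by
    obtain ⟨x, hx, hxK, hmax⟩ := exists_carrier (isFDLF_sdIter hX (k + 1)) hκ
    have hne : ∀ y ∈ κ, y.Nonempty := fun y hy =>
      Face.nonempty (((mem_sd_iff (isFDLF_sdIter hX (k + 1)) κ).1 hκ).2.1 y hy)
    obtain ⟨ρ, hρ, hsub, hcl⟩ := exists_carrier_sd_one hX k hxK
    refine ⟨ρ, hρ, (openSimplex_barycentre_subset (position V (k + 1)) hx
      fun y hy => ⟨hne y hy, hmax y hy⟩).trans hsub, fun y hy => ?_⟩
    exact barycentre_mem_closedSimplex (hne y hy) fun z hz => hcl z (hmax y hy hz)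

end Carrier

/-! ### The distance to the face opposite to the top barycentre -/

section Distance

variable {V : Type w}

/-- The barycentre of a simplex of `X`. -/
abbrev faceBarycentre (σ : Finset V) : V →₀ ℝ := barycentre (fun v => Finsupp.single v 1) σ

theorem faceBarycentre_of_mem {σ : Finset V} {v : V} (hv : v ∈ σ) :
    faceBarycentre σ v = (σ.card : ℝ)⁻¹ := by
  classical
  simp [barycentre_apply, Finsupp.single_apply, hv]

theorem faceBarycentre_of_notMem {σ : Finset V} {v : V} (hv : v ∉ σ) : faceBarycentre σ v = 0 := by
  classical
  simp [barycentre_apply, Finsupp.single_apply, hv]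

theorem faceBarycentre_nonneg (σ : Finset V) (v : V) : 0 ≤ faceBarycentre σ v :=
  barycentre_nonneg (position_nonneg V 0) σ v

theorem faceBarycentre_mem_cell {σ τ : Finset V} (hσ : σ.Nonempty) (h : σ ⊆ τ) :
    faceBarycentre σ ∈ cell τ := by
  classical
  have hc : (0 : ℝ) < σ.card := by exact_mod_cast hσ.card_pos
  refine ⟨faceBarycentre_nonneg σ, fun v hv => ?_, ?_⟩
  · by_contra hvτ
    exact Finsupp.mem_support_iff.1 hv (faceBarycentre_of_notMem fun hvσ => hvτ (h hvσ))
  · rw [← Finset.sum_subset h fun v _ hv => faceBarycentre_of_notMem hv,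
      Finset.sum_congr rfl fun v hv => faceBarycentre_of_mem hv, Finset.sum_const, nsmul_eq_mul,
      mul_inv_cancel₀ hc.ne']

theorem convex_cell (s : Finset V) : Convex ℝ (cell s) := by
  rintro x ⟨hx0, hxs, hx1⟩ y ⟨hy0, hys, hy1⟩ a b ha hb hab
  refine ⟨fun v => ?_, fun v hv => ?_, ?_⟩
  · simp only [Finsupp.add_apply, Finsupp.smul_apply, smul_eq_mul]
    exact add_nonneg (mul_nonneg ha (hx0 v)) (mul_nonneg hb (hy0 v))
  · by_contra hvs
    refine Finsupp.mem_support_iff.1 hv ?_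
    rw [Finsupp.add_apply, Finsupp.smul_apply, Finsupp.smul_apply,
      Finsupp.notMem_support_iff.1 fun h => hvs (hxs h),
      Finsupp.notMem_support_iff.1 fun h => hvs (hys h)]
    simp
  · simp only [Finsupp.add_apply, Finsupp.smul_apply, smul_eq_mul]
    rw [Finset.sum_add_distrib, ← Finset.mul_sum, ← Finset.mul_sum, hx1, hy1, mul_one, mul_one, hab]

theorem euclInner_single (u : V →₀ ℝ) (v : V) : euclInner u (Finsupp.single v 1) = u v := by
  classical
  rw [euclInner, Finset.sum_eq_single v]
  · simp
  · intro w _ hw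
    rw [Finsupp.single_apply, if_neg hw.symm, mul_zero]
  · intro hv
    rw [Finsupp.notMem_support_iff.1 hv, zero_mul]

theorem euclInner_faceBarycentre {u : V →₀ ℝ} {σ : Finset V} (hσ : σ.Nonempty) {c : ℝ}
    (h : ∀ v ∈ σ, u v = c) : euclInner u (faceBarycentre σ) = c := by
  have hc : (0 : ℝ) < σ.card := by exact_mod_cast hσ.card_pos
  rw [faceBarycentre, barycentre, euclInner_smul, euclInner_sum,
    Finset.sum_congr rfl fun v hv => (euclInner_single u v).trans (h v hv), Finset.sum_const,
    nsmul_eq_mul, inv_mul_cancel_left₀ hc.ne']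

variable {X : PreAbstractSimplicialComplex V} {ρ : Finset (Finset V)} {τ σ' : Finset V}

/-- In a simplex `ρ` of the first subdivision with largest vertex `τ`, the distance of a point from
the face opposite to `τ` is proportional to its barycentric coordinate at `τ`.  Indeed, the
orthogonal projection of `τ` to the opposite face is the next largest vertex `σ'`. -/
theorem stdDistTo_opposite_face (hτX : τ ∈ X.faces) (hτ : τ ∈ ρ)
    (hρ : ∀ σ ∈ ρ, σ.Nonempty ∧ σ ⊆ τ) (hσ' : σ' ∈ ρ) (hne : σ' ≠ τ)
    (hmax : ∀ σ ∈ ρ, σ ≠ τ → σ ⊆ σ') {a : Finset V → ℝ} (ha : ∀ σ ∈ ρ, 0 ≤ a σ)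
    (ha1 : ∑ σ ∈ ρ, a σ = 1) :
    stdDistTo X (∑ σ ∈ ρ, a σ • faceBarycentre σ)
      (convexHull ℝ (faceBarycentre '' {σ : Finset V | σ ∈ ρ ∧ σ ≠ τ})) =
    ENNReal.ofReal (a τ * euclNorm (faceBarycentre τ - faceBarycentre σ')) := by
  classical
  set u : V →₀ ℝ := faceBarycentre τ - faceBarycentre σ' with hu
  set x : V →₀ ℝ := ∑ σ ∈ ρ, a σ • faceBarycentre σ with hx
  have hcell : ∀ σ ∈ ρ, faceBarycentre σ ∈ cell τ := fun σ hσ =>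
    faceBarycentre_mem_cell (hρ σ hσ).1 (hρ σ hσ).2
  apply le_antisymm
  · let z : Finset V → V →₀ ℝ := fun σ => if σ = τ then faceBarycentre σ' else faceBarycentre σ
    have hz : ∑ σ ∈ ρ, a σ • z σ = x - a τ • u := by
      rw [hx, eq_sub_iff_add_eq, ← Finset.sum_erase_add _ _ hτ, ← Finset.sum_erase_add ρ _ hτ,
        add_assoc]
      congr 1
      · refine Finset.sum_congr rfl fun σ hσ => ?_
        simp only [z]
        rw [if_neg (Finset.ne_of_mem_erase hσ)]
      · simp only [z, if_true]
        rw [← smul_add, hu, add_sub_cancel]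
    have hzF : x - a τ • u ∈
        convexHull ℝ (faceBarycentre '' {σ : Finset V | σ ∈ ρ ∧ σ ≠ τ}) := by
      rw [← hz]
      refine (convex_convexHull ℝ _).sum_mem ha ha1 fun σ hσ => subset_convexHull ℝ _ ?_
      simp only [z]
      split_ifs with h
      · exact ⟨σ', ⟨hσ', hne⟩, rfl⟩
      · exact ⟨σ, ⟨hσ, h⟩, rfl⟩
    refine (iInf₂_le _ hzF).trans ((stdDist_le_of_cell hτX ?_ ?_).trans_eq ?_)
    · exact (convex_cell τ).sum_mem ha ha1 hcell
    · rw [← hz]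
      refine (convex_cell τ).sum_mem ha ha1 fun σ hσ => ?_
      simp only [z]
      split_ifs with h
      · exact hcell σ' hσ'
      · exact hcell σ hσ
    · rw [euclDist_eq, sub_sub_cancel, euclNorm_smul (ha τ hτ)]
  · refine le_iInf₂ fun y hy => ?_
    set h := euclNorm u with hh
    -- The coordinates of `u` are constant on `σ'`, so `u` is orthogonal to the opposite face.
    have huc : ∀ v ∈ σ', u v = (τ.card : ℝ)⁻¹ - (σ'.card : ℝ)⁻¹ := fun v hv => by
      rw [hu, Finsupp.sub_apply, faceBarycentre_of_mem hv,
        faceBarycentre_of_mem ((hρ σ' hσ').2 hv)]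
    set c := (τ.card : ℝ)⁻¹ - (σ'.card : ℝ)⁻¹
    have hc : ∀ σ ∈ ρ, σ ≠ τ → euclInner u (faceBarycentre σ) = c := fun σ hσ hσne =>
      euclInner_faceBarycentre (hρ σ hσ).1 fun v hv => huc v (hmax σ hσ hσne hv)
    have hcτ : euclInner u (faceBarycentre τ) = c + h ^ 2 := by
      rw [← hc σ' hσ' hne, ← euclInner_self, ← euclInner_add, hu, add_sub_cancel]
    have hyc : euclInner u y = c := by
      have hconv : Convex ℝ {z | euclInner u z = c} := by
        intro z hz z' hz' s t _ _ hst
        change euclInner u z = c at hz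
        change euclInner u z' = c at hz'
        change euclInner u (s • z + t • z') = c
        rw [euclInner_add, euclInner_smul, euclInner_smul, hz, hz', ← add_mul, hst, one_mul]
      refine convexHull_min ?_ hconv hy
      rintro _ ⟨σ, ⟨hσ, hσne⟩, rfl⟩
      exact hc σ hσ hσne
    have hxc : euclInner u x = c + a τ * h ^ 2 := by
      rw [← Finset.sum_erase_add _ _ hτ] at ha1
      rw [hx, euclInner_sum, ← Finset.sum_erase_add _ _ hτ, euclInner_smul, hcτ,
        Finset.sum_congr rfl fun σ hσ => (euclInner_smul u (a σ) _).trans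
          (congrArg (a σ * ·) (hc σ (Finset.mem_of_mem_erase hσ) (Finset.ne_of_mem_erase hσ))),
        ← Finset.sum_mul]
      linear_combination c * ha1
    have hh0 : 0 ≤ h := euclNorm_nonneg u
    rcases hh0.eq_or_lt with h0 | h0
    · rw [← h0, mul_zero, ENNReal.ofReal_zero]
      exact zero_le
    have hlip : ∀ x y, |euclInner u x / h - euclInner u y / h| ≤ euclDist x y := fun x y => by
      rw [← sub_div, ← euclInner_sub, abs_div, abs_of_pos h0, div_le_iff₀ h0, mul_comm]
      exact abs_euclInner_le u (x - y)
    refine (ENNReal.ofReal_le_ofReal ?_).trans (ofReal_abs_sub_le_stdDist hlip x y)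
    rw [hxc, hyc, ← sub_div, add_sub_cancel_left, sq, ← mul_assoc, mul_div_cancel_right₀ _ h0.ne']
    exact le_abs_self _

/-- The support of a point in an open simplex of the first subdivision. -/
theorem support_of_mem_openSimplex (hτ : τ ∈ ρ) (hρ : ∀ σ ∈ ρ, σ.Nonempty ∧ σ ⊆ τ) {y : V →₀ ℝ}
    (hy : y ∈ openSimplex faceBarycentre ρ) : y.support = τ := by
  obtain ⟨a, ha, -, rfl⟩ := hy
  ext v
  rw [Finsupp.mem_support_iff, Finsupp.finsetSum_apply]
  constructor
  · intro h
    obtain ⟨σ, hσ, hne⟩ := Finset.exists_ne_zero_of_sum_ne_zero h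
    by_contra hv
    refine hne ?_
    rw [Finsupp.smul_apply, faceBarycentre_of_notMem fun h => hv ((hρ σ hσ).2 h), smul_zero]
  · intro hv
    refine (Finset.sum_pos' (fun σ hσ => ?_) ⟨τ, hτ, ?_⟩).ne'
    · exact smul_nonneg (ha σ hσ).le (faceBarycentre_nonneg σ v)
    · have : (0 : ℝ) < τ.card := by exact_mod_cast (hρ τ hτ).1.card_pos
      rw [Finsupp.smul_apply, faceBarycentre_of_mem hv]
      exact smul_pos (ha τ hτ) (inv_pos.2 this)

theorem exists_next_largest (hch : ∀ σ ∈ ρ, ∀ τ ∈ ρ, σ ⊆ τ ∨ τ ⊆ σ)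
    (hex : ∃ σ ∈ ρ, σ ≠ τ) : ∃ σ' ∈ ρ, σ' ≠ τ ∧ ∀ σ ∈ ρ, σ ≠ τ → σ ⊆ σ' := by
  classical
  obtain ⟨σ₀, h₀, h₀'⟩ := hex
  obtain ⟨σ', hσ', hmax⟩ := (ρ.erase τ).exists_max_image Finset.card
    ⟨σ₀, Finset.mem_erase.2 ⟨h₀', h₀⟩⟩
  refine ⟨σ', Finset.mem_of_mem_erase hσ', Finset.ne_of_mem_erase hσ', fun σ hσ hσne => ?_⟩
  rcases hch σ hσ σ' (Finset.mem_of_mem_erase hσ') with h | h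
  · exact h
  · rw [Finset.eq_of_subset_of_card_le h (hmax σ (Finset.mem_erase.2 ⟨hσne, hσ⟩))]

/-- Let `v` be a vertex of `τ`, the largest vertex of `ρ`, that is not in the next largest one.
Each point of `ρ` has its smallest coordinate in `τ` at `v`, and if `p q` is, among the points
`p x` with `x ∈ κ`, as close as possible to the face of `ρ` opposite to `τ`, then its coordinate at
`v` is the smallest one. -/
theorem exists_minimal_coordinate {W : Type w} {p : W → V →₀ ℝ} {κ : Finset W} {q : W}
    (hq : q ∈ κ) (hτX : τ ∈ X.faces) (hτ : τ ∈ ρ) (hρ : ∀ σ ∈ ρ, σ.Nonempty ∧ σ ⊆ τ)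
    (hch : ∀ σ ∈ ρ, ∀ τ ∈ ρ, σ ⊆ τ ∨ τ ⊆ σ)
    (hsub : openSimplex p κ ⊆ openSimplex faceBarycentre ρ)
    (hcl : ∀ x ∈ κ, p x ∈ closedSimplex faceBarycentre ρ)
    (hnear : (∃ σ ∈ ρ, σ ≠ τ) → ∀ x ∈ κ,
      stdDistTo X (p q) (convexHull ℝ (faceBarycentre '' {σ : Finset V | σ ∈ ρ ∧ σ ≠ τ})) ≤
      stdDistTo X (p x) (convexHull ℝ (faceBarycentre '' {σ : Finset V | σ ∈ ρ ∧ σ ≠ τ}))) :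
    ∃ v ∈ (barycentre p κ).support,
      (∀ x ∈ κ, ∀ w ∈ (barycentre p κ).support, p x v ≤ p x w) ∧ ∀ x ∈ κ, p q v ≤ p x v := by
  classical
  have hsupp : (barycentre p κ).support = τ :=
    support_of_mem_openSimplex hτ hρ (hsub (barycentre_mem_openSimplex _ ⟨q, hq⟩))
  rw [hsupp]
  by_cases hex : ∃ σ ∈ ρ, σ ≠ τ
  · obtain ⟨σ', hσ', hne, hmax'⟩ := exists_next_largest hch hex
    obtain ⟨v, hv, hvσ'⟩ : ∃ v ∈ τ, v ∉ σ' := by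
      by_contra! h
      exact hne (Finset.Subset.antisymm (hρ σ' hσ').2 h)
    have hpos : 0 < euclNorm (faceBarycentre τ - faceBarycentre σ') := by
      refine lt_of_lt_of_le ?_ (abs_apply_le_euclNorm _ v)
      have : (0 : ℝ) < τ.card := by exact_mod_cast (hρ τ hτ).1.card_pos
      rw [Finsupp.sub_apply, faceBarycentre_of_mem hv, faceBarycentre_of_notMem hvσ', sub_zero]
      positivity
    choose! a ha ha1 hpa using hcl
    have hdist : ∀ x ∈ κ, stdDistTo X (p x)
        (convexHull ℝ (faceBarycentre '' {σ : Finset V | σ ∈ ρ ∧ σ ≠ τ})) =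
        ENNReal.ofReal (a x τ * euclNorm (faceBarycentre τ - faceBarycentre σ')) := fun x hx => by
      rw [hpa x hx]
      exact stdDistTo_opposite_face hτX hτ hρ hσ' hne hmax' (ha x hx) (ha1 x hx)
    have hcoord : ∀ x ∈ κ, ∀ w, p x w = ∑ σ ∈ ρ, a x σ * faceBarycentre σ w := fun x hx w => by
      rw [hpa x hx]
      exact Finsupp.finsetSum_apply _ _ _
    have hcoordv : ∀ x ∈ κ, p x v = a x τ * (τ.card : ℝ)⁻¹ := fun x hx => by
      rw [hcoord x hx, Finset.sum_eq_single_of_mem τ hτ fun σ hσ hσne => ?_,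
        faceBarycentre_of_mem hv]
      rw [faceBarycentre_of_notMem fun h => hvσ' (hmax' σ hσ hσne h), mul_zero]
    refine ⟨v, hv, fun x hx w hw => ?_, fun x hx => ?_⟩
    · rw [hcoordv x hx, hcoord x hx, ← faceBarycentre_of_mem hw]
      exact Finset.single_le_sum (f := fun σ => a x σ * faceBarycentre σ w)
        (fun σ hσ => mul_nonneg (ha x hx σ hσ) (faceBarycentre_nonneg σ w)) hτ
    · have := hnear hex x hx
      rw [hdist x hx, hdist q hq] at this
      have hle := le_of_mul_le_mul_right ((ENNReal.ofReal_le_ofReal_iff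
        (mul_nonneg (ha x hx τ hτ) hpos.le)).1 this) hpos
      rw [hcoordv x hx, hcoordv q hq]
      exact mul_le_mul_of_nonneg_right hle (by positivity)
  · push Not at hex
    have hρτ : ρ = {τ} := Finset.eq_singleton_iff_unique_mem.2 ⟨hτ, hex⟩
    have hp : ∀ x ∈ κ, p x = faceBarycentre τ := fun x hx => by
      obtain ⟨a, -, ha1, hpa⟩ := hcl x hx
      rw [hρτ, Finset.sum_singleton] at ha1 hpa
      rw [hpa, ha1, one_smul]
    obtain ⟨v, hv⟩ := (hρ τ hτ).1
    refine ⟨v, hv, fun x hx w hw => ?_, fun x hx => ?_⟩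
    · rw [hp x hx, faceBarycentre_of_mem hv, faceBarycentre_of_mem hw]
    · rw [hp x hx, hp q hq]

/-- The retractions of the family do not increase the coordinate at a vertex of `X` which, among
the vertices of the carrier of `κ`, has the smallest coordinates on `κ`. -/
theorem RetractionFamily.exists_minimal_coordinate (hX : IsFDLF X) (r : RetractionFamily X) {j : ℕ}
    (hj : 1 ≤ j) (κ : Face (sdIter X j)) :
    ∃ v ∈ (barycentre (position V j) κ.1).support,
      (∀ x ∈ κ.1, ∀ w ∈ (barycentre (position V j) κ.1).support,
        position V j x v ≤ position V j x w) ∧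
      ∀ x ∈ κ.1, position V j ((r.r j).vertex κ) v ≤ position V j x v := by
  obtain ⟨k, rfl⟩ : ∃ k, j = k + 1 := ⟨j - 1, by omega⟩
  obtain ⟨ρ, hρX, hsub, hcl⟩ := exists_carrier_sd_one hX k κ.2
  obtain ⟨τ, hτ, hτX, hmax⟩ := exists_carrier (isFDLF_sdIter hX 0) hρX
  obtain ⟨-, hρf, hch⟩ := (mem_sd_iff (isFDLF_sdIter hX 0) ρ).1 hρX
  exact _root_.exists_minimal_coordinate (p := position V (k + 1)) (X := X)
    ((r.r (k + 1)).vertex_mem κ) hτX hτ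
    (fun σ hσ => ⟨Face.nonempty (hρf σ hσ), hmax σ hσ⟩) hch hsub hcl
    fun hex => r.nearest (k + 1) (by omega) κ ⟨ρ, hρX⟩ hsub τ hτ hmax hex

end Distance

/-! ### Predicates which are preserved by subdivision -/

section Predicates

variable {V : Type w} {W : Type w}

/-- The vertices of `X` at which some point of the simplex spanned by the points `p x`, `x ∈ s`,
has a nonzero coordinate: the carrier in `X` of that simplex. -/
def carrier (p : W → V →₀ ℝ) (s : Finset W) : Finset V := (barycentre p s).support

theorem mem_carrier {p : W → V →₀ ℝ} (hp : ∀ x v, 0 ≤ p x v) {s : Finset W} {v : V} :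
    v ∈ carrier p s ↔ ∃ x ∈ s, v ∈ (p x).support :=
  mem_support_barycentre hp

theorem carrier_mono {p : W → V →₀ ℝ} (hp : ∀ x v, 0 ≤ p x v) {s t : Finset W} (h : s ⊆ t) :
    carrier p s ⊆ carrier p t := fun v hv => by
  obtain ⟨x, hx, hv⟩ := (mem_carrier hp).1 hv
  exact (mem_carrier hp).2 ⟨x, h hx, hv⟩

theorem mem_carrier_barycentre {p : W → V →₀ ℝ} (hp : ∀ x v, 0 ≤ p x v) {S : Finset (Finset W)}
    {v : V} : v ∈ carrier (barycentre p) S ↔ ∃ x ∈ S, v ∈ carrier p x :=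
  mem_carrier fun x v => barycentre_nonneg hp x v

theorem apply_eq_zero_of_notMem_carrier {p : W → V →₀ ℝ} (hp : ∀ x v, 0 ≤ p x v) {s : Finset W}
    {v : V} (hv : v ∉ carrier p s) {x : W} (hx : x ∈ s) : p x v = 0 :=
  Finsupp.notMem_support_iff.1 fun h => hv ((mem_carrier hp).2 ⟨x, hx, h⟩)

variable [DecidableEq W] {K : PreAbstractSimplicialComplex W} (c : VertexChoice K)

theorem carrier_vertexSimplex {p : W → V →₀ ℝ} (hp : ∀ x v, 0 ≤ p x v) (s : Finset W) :
    carrier (barycentre p) (vertexSimplex s) = carrier p s := by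
  ext v
  rw [mem_carrier_barycentre hp, mem_carrier hp]
  simp only [mem_vertexSimplex]
  constructor
  · rintro ⟨_, ⟨x, hx, rfl⟩, hv⟩
    rw [carrier, barycentre_singleton] at hv
    exact ⟨x, hx, hv⟩
  · rintro ⟨x, hx, hv⟩
    refine ⟨{x}, ⟨x, hx, rfl⟩, ?_⟩
    rwa [carrier, barycentre_singleton]

theorem carrier_insert_of_vertexSimplex_subset {p : W → V →₀ ℝ} (hp : ∀ x v, 0 ≤ p x v)
    {x : Finset W} {S : Finset (Finset W)} (hx : vertexSimplex x ⊆ S) :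
    carrier (barycentre p) (insert x S) = carrier (barycentre p) S := by
  refine Finset.Subset.antisymm (fun v hv => ?_)
    (carrier_mono (fun x v => barycentre_nonneg hp x v) (Finset.subset_insert _ _))
  obtain ⟨y, hy, hvy⟩ := (mem_carrier_barycentre hp).1 hv
  rcases Finset.mem_insert.1 hy with rfl | hy
  · rw [← carrier_vertexSimplex hp] at hvy
    exact carrier_mono (fun x v => barycentre_nonneg hp x v) hx hvy
  · exact (mem_carrier_barycentre hp).2 ⟨y, hy, hvy⟩

theorem carrier_insert_singleton {p : W → V →₀ ℝ} (hp : ∀ x v, 0 ≤ p x v) {x : Finset W}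
    {S : Finset (Finset W)} (hx : x ∈ S) {y : W} (hy : y ∈ x) :
    carrier (barycentre p) (insert {y} S) = carrier (barycentre p) S := by
  refine Finset.Subset.antisymm (fun v hv => ?_)
    (carrier_mono (fun x v => barycentre_nonneg hp x v) (Finset.subset_insert _ _))
  obtain ⟨z, hz, hv⟩ := (mem_carrier_barycentre hp).1 hv
  rcases Finset.mem_insert.1 hz with rfl | hz
  · exact (mem_carrier_barycentre hp).2
      ⟨x, hx, carrier_mono hp (Finset.singleton_subset_iff.2 hy) hv⟩
  · exact (mem_carrier_barycentre hp).2 ⟨z, hz, hv⟩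

/-- Hereditary conditions on the carrier are compatible with all subdivisions. -/
theorem levelClosed_carrier {p : W → V →₀ ℝ} (hp : ∀ x v, 0 ≤ p x v) {Z : Finset V → Prop}
    (hZ : ∀ {s t}, t ⊆ s → Z s → Z t) :
    LevelClosed c (fun s => Z (carrier p s)) (fun S => Z (carrier (barycentre p) S)) where
  mono h := hZ (carrier_mono (fun x v => barycentre_nonneg hp x v) h)
  rename s := by rw [carrier_vertexSimplex hp]
  star x S hx h := by rwa [carrier_insert_of_vertexSimplex_subset hp hx]
  retr x S hx h := by rwa [carrier_insert_singleton hp hx (c.vertex_mem x)]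

/-- The predicate that distinguishes the simplices near the boundary of the simplex `τ` of `X`:
each vertex has a coordinate `≤ δ` in `τ`, and the carrier does not contain `τ` properly. -/
structure NearBoundary (p : W → V →₀ ℝ) (τ : Finset V) (δ : ℝ) (s : Finset W) : Prop where
  exists_le : ∀ x ∈ s, ∃ w ∈ τ, p x w ≤ δ
  eq_of_subset : τ ⊆ carrier p s → carrier p s = τ

/-- If the retraction does not increase a minimal coordinate, it moves simplices towards the
boundary. -/
theorem levelClosed_nearBoundary {p : W → V →₀ ℝ} (hp : ∀ x v, 0 ≤ p x v)
    (hc : ∀ x : Face K, ∃ v ∈ carrier p x.1, (∀ y ∈ x.1, ∀ w ∈ carrier p x.1, p y v ≤ p y w) ∧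
      ∀ y ∈ x.1, p (c.vertex x) v ≤ p y v) (τ : Finset V) {δ : ℝ} (hδ : 0 ≤ δ) :
    LevelClosed c (NearBoundary p τ δ) (NearBoundary (barycentre p) τ δ) where
  mono {s t} h hs :=
    have hts := carrier_mono (fun x v => barycentre_nonneg hp x v) h
    ⟨fun x hx => hs.exists_le x (h hx), fun hτ =>
      Finset.Subset.antisymm (hts.trans_eq (hs.eq_of_subset (hτ.trans hts))) hτ⟩
  rename s := by
    constructor
    · rintro ⟨h1, h2⟩
      rw [carrier_vertexSimplex hp] at h2
      refine ⟨fun x hx => ?_, h2⟩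
      have := h1 {x} (mem_vertexSimplex.2 ⟨x, hx, rfl⟩)
      rwa [barycentre_singleton] at this
    · rintro ⟨h1, h2⟩
      rw [← carrier_vertexSimplex hp] at h2
      refine ⟨fun y hy => ?_, h2⟩
      obtain ⟨x, hx, rfl⟩ := mem_vertexSimplex.1 hy
      rw [barycentre_singleton]
      exact h1 x hx
  star x S hx hS := by
    have hcar := carrier_insert_of_vertexSimplex_subset hp hx
    refine ⟨fun y hy => ?_, hcar ▸ hS.eq_of_subset⟩
    rcases Finset.mem_insert.1 hy with rfl | hy
    swap
    · exact hS.exists_le y hy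
    by_cases hτ : τ ⊆ carrier p x.1
    · have hxS : carrier p x.1 ⊆ carrier (barycentre p) S := by
        rw [← carrier_vertexSimplex hp]
        exact carrier_mono (fun x v => barycentre_nonneg hp x v) hx
      have heq : carrier p x.1 = τ :=
        Finset.Subset.antisymm (hxS.trans_eq (hS.eq_of_subset (hτ.trans hxS))) hτ
      obtain ⟨v, hv, hmin, -⟩ := hc x
      rw [heq] at hv hmin
      refine ⟨v, hv, barycentre_le (Face.nonempty x.2) fun y hy => ?_⟩
      obtain ⟨w, hw, hle⟩ := hS.exists_le {y} (hx (mem_vertexSimplex.2 ⟨y, hy, rfl⟩))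
      rw [barycentre_singleton] at hle
      exact (hmin y hy w hw).trans hle
    · obtain ⟨w, hw, hwx⟩ := Finset.not_subset.1 hτ
      exact ⟨w, hw, (Finsupp.notMem_support_iff.1 hwx).trans_le hδ⟩
  retr x S hx hS := by
    have hcar := carrier_insert_singleton hp hx (c.vertex_mem x)
    refine ⟨fun y hy => ?_, hcar ▸ hS.eq_of_subset⟩
    rcases Finset.mem_insert.1 hy with rfl | hy
    swap
    · exact hS.exists_le y hy
    rw [barycentre_singleton]
    by_cases hτ : τ ⊆ carrier p x.1
    · have hxS : carrier p x.1 ⊆ carrier (barycentre p) S := fun v hv =>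
        (mem_carrier_barycentre hp).2 ⟨x.1, hx, hv⟩
      have heq : carrier p x.1 = τ :=
        Finset.Subset.antisymm (hxS.trans_eq (hS.eq_of_subset (hτ.trans hxS))) hτ
      obtain ⟨v, hv, hmin, hr⟩ := hc x
      rw [heq] at hv hmin
      obtain ⟨w, hw, hle⟩ := hS.exists_le x.1 hx
      refine ⟨v, hv, (le_barycentre (Face.nonempty x.2) fun y hy => ?_).trans hle⟩
      exact (hr y hy).trans (hmin y hy w hw)
    · obtain ⟨w, hw, hwx⟩ := Finset.not_subset.1 hτ
      exact ⟨w, hw, (apply_eq_zero_of_notMem_carrier hp hwx (c.vertex_mem x)).trans_le hδ⟩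

/-- A simplex of the subdivision satisfies the lift of a hereditary predicate `P` if it lies in a
simplex satisfying `P`. -/
theorem levelClosed_lift {P : Finset W → Prop} (hP : ∀ {s t}, t ⊆ s → P s → P t) :
    LevelClosed c P (fun S => ∃ κ, (∀ x ∈ S, x ⊆ κ) ∧ P κ) where
  mono h := fun ⟨κ, hκ, hPκ⟩ => ⟨κ, fun x hx => hκ x (h hx), hPκ⟩
  rename s := by
    constructor
    · rintro ⟨κ, hκ, hPκ⟩
      refine hP (fun x hx => ?_) hPκ
      exact hκ {x} (mem_vertexSimplex.2 ⟨x, hx, rfl⟩) (Finset.mem_singleton_self x)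
    · intro hs
      refine ⟨s, fun y hy => ?_, hs⟩
      obtain ⟨x, hx, rfl⟩ := mem_vertexSimplex.1 hy
      exact Finset.singleton_subset_iff.2 hx
  star x S hx := by
    rintro ⟨κ, hκ, hPκ⟩
    refine ⟨κ, fun y hy => ?_, hPκ⟩
    rcases Finset.mem_insert.1 hy with rfl | hy
    · exact fun z hz => hκ {z} (hx (mem_vertexSimplex.2 ⟨z, hz, rfl⟩)) (Finset.mem_singleton_self z)
    · exact hκ y hy
  retr x S hx := by
    rintro ⟨κ, hκ, hPκ⟩
    refine ⟨κ, fun y hy => ?_, hPκ⟩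
    rcases Finset.mem_insert.1 hy with rfl | hy
    · exact Finset.singleton_subset_iff.2 (hκ x.1 hx (c.vertex_mem x))
    · exact hκ y hy

end Predicates

section Iterated

variable {V : Type w} {X : PreAbstractSimplicialComplex V}

/-- The carrier of a simplex of an iterated subdivision is a simplex. -/
theorem carrier_mem (hX : IsFDLF X) : ∀ (j : ℕ) {s : Finset (SdVertex V j)},
    s ∈ (sdIter X j).faces → ∃ τ ∈ X.faces, carrier (position V j) s ⊆ τ
  | 0, s, hs => ⟨s, hs, fun v hv => by
      obtain ⟨x, hx, hv⟩ := (mem_carrier (position_nonneg V 0)).1 hv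
      have : v = x := by
        by_contra h
        exact Finsupp.mem_support_iff.1 hv (Finsupp.single_eq_of_ne h)
      exact this ▸ hx⟩
  | j + 1, S, hS => by
    obtain ⟨x, hx, hxK, hmax⟩ := exists_carrier (isFDLF_sdIter hX j) hS
    obtain ⟨τ, hτ, h⟩ := carrier_mem hX j hxK
    refine ⟨τ, hτ, fun v hv => h ?_⟩
    obtain ⟨y, hy, hv⟩ := (mem_carrier_barycentre (position_nonneg V j)).1 hv
    exact carrier_mono (position_nonneg V j) (hmax y hy) hv

theorem carrier_position_zero (s : Finset V) : carrier (position V 0) s = s := by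
  ext v
  refine (mem_carrier (position_nonneg V 0)).trans ⟨?_, fun hv => ⟨v, hv, ?_⟩⟩
  · rintro ⟨x, hx, hv⟩
    have : v = x := by
      by_contra h
      exact Finsupp.mem_support_iff.1 hv (Finsupp.single_eq_of_ne h)
    exact this ▸ hx
  · exact Finsupp.mem_support_iff.2 ((Finsupp.single_eq_same (M := ℝ)).trans_ne one_ne_zero)

/-- The simplices of the `(J + k)`-th subdivision that lie in a simplex of the `J`-th subdivision
satisfying `P`. -/
def liftPred {J : ℕ} (P : Finset (SdVertex V J) → Prop) :
    ∀ k : ℕ, Finset (SdVertex V (J + k)) → Prop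
  | 0 => P
  | k + 1 => fun S : Finset (Finset (SdVertex V (J + k))) =>
      ∃ κ, (∀ x ∈ S, x ⊆ κ) ∧ liftPred P k κ

theorem liftPred_mono {J : ℕ} {P : Finset (SdVertex V J) → Prop}
    (hP : ∀ {s t}, t ⊆ s → P s → P t) : ∀ (k : ℕ) {s t : Finset (SdVertex V (J + k))}, t ⊆ s →
    liftPred P k s → liftPred P k t
  | 0, _, _, h, hs => hP h hs
  | _ + 1, _, _, h, ⟨κ, hκ, hPκ⟩ => ⟨κ, fun x hx => hκ x (h hx), hPκ⟩

theorem apply_le_of_liftPred {J : ℕ} {v : V} {b : ℝ} (hb : 0 ≤ b) : ∀ (k : ℕ)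
    {s : Finset (SdVertex V (J + k))}, liftPred (fun κ => ∀ x ∈ κ, position V J x v ≤ b) k s →
    ∀ x ∈ s, position V (J + k) x v ≤ b
  | 0, _, hs => hs
  | k + 1, s, ⟨κ, hκ, hPκ⟩ => fun x hx => by
    have h := apply_le_of_liftPred hb k hPκ
    have key : ∀ y : Finset (SdVertex V (J + k)), y ⊆ κ → barycentre (position V (J + k)) y v ≤ b :=
      fun y hy => by
        rcases y.eq_empty_or_nonempty with rfl | hne
        · simpa [barycentre] using hb
        · exact barycentre_le hne fun z hz => h z (hy hz)
    exact key x (hκ x hx)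

/-- Each simplex of the `(J + k)`-th subdivision lies in a simplex of the `J`-th subdivision, and
its coordinates are close to those of the latter. -/
theorem exists_carrier_add (hX : IsFDLF X) (J : ℕ) : ∀ (k : ℕ) {s : Finset (SdVertex V (J + k))},
    s ∈ (sdIter X (J + k)).faces → ∃ κ ∈ (sdIter X J).faces,
      (∀ P : Finset (SdVertex V J) → Prop, P κ → liftPred P k s) ∧
      ∀ v, ∀ x ∈ κ, ∀ y ∈ s, position V J x v ≤ position V (J + k) y v +
        ((complexDim X : ℝ) / (complexDim X + 1)) ^ J
  | 0, s, hs => ⟨s, hs, fun _ h => h, fun v x hx y hy => by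
      have := (abs_le.1 (mesh_sdIter hX v J hs x hx y hy)).2
      exact sub_le_iff_le_add'.1 this⟩
  | k + 1, s, hs => by
    obtain ⟨z, hz, hzK, hmax⟩ := exists_carrier (isFDLF_sdIter hX (J + k)) hs
    have hne : ∀ y ∈ s, Finset.Nonempty (α := SdVertex V (J + k)) y := fun y hy =>
      Face.nonempty (((mem_sd_iff (isFDLF_sdIter hX (J + k)) s).1 hs).2.1 y hy)
    obtain ⟨κ, hκ, hP, hle⟩ := exists_carrier_add hX J k hzK
    refine ⟨κ, hκ, fun P hPκ => ⟨z, hmax, hP P hPκ⟩, fun v x hx y hy => ?_⟩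
    refine sub_le_iff_le_add.1 ?_
    exact le_barycentre (p := position V (J + k)) (hne y hy) fun y' hy' =>
      sub_le_iff_le_add.2 (hle v x hx y' (hmax y hy hy'))

end Iterated

/-! ### Squeezing the control -/

section Squeezing

variable {W : Type w} {K : PreAbstractSimplicialComplex W}

/-- The relation `M₁` stands for the nonzero components of a chain equivalence and of its inverse,
`M₂` for those of the two homotopies.  They respect the triple of predicates `P`, `Q`, `R` if the
maps go from `P` to `Q` and from `Q` to `R`, and the homotopies from `P` to `R`. -/
structure MovesControlled (M₁ M₂ : Face K → Face K → Prop) (P Q R : Finset W → Prop) : Prop where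
  fst : ∀ {s t}, M₁ s t → P s.1 → Q t.1
  snd : ∀ {s t}, M₁ s t → Q s.1 → R t.1
  homotopy : ∀ {s t}, M₂ s t → P s.1 → R t.1

variable {V : Type w} {X : PreAbstractSimplicialComplex V}

/-- Relations on the simplices of the complexes `Sd^j X`, `j ≤ i`, standing for the components of a
chain equivalence and of its homotopies over each of them (see `MovesControlled`), such that control
by predicates which are closed under subdivision is inherited from each level by the one below. -/
structure IsSqueezingSequence (r : ∀ j, VertexChoice (sdIter X j)) (i : ℕ)
    (M₁ M₂ : ∀ j, Face (sdIter X j) → Face (sdIter X j) → Prop) : Prop where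
  inherit : ∀ j < i, ∀ P P' Q Q' R R', LevelClosed (r j) P P' → LevelClosed (r j) Q Q' →
    LevelClosed (r j) R R' → MovesControlled (K := sdIter X (j + 1)) (M₁ (j + 1)) (M₂ (j + 1))
      P' Q' R' → MovesControlled (M₁ j) (M₂ j) P Q R

variable {r : ∀ j, VertexChoice (sdIter X j)} {i : ℕ}
  {M₁ M₂ : ∀ j, Face (sdIter X j) → Face (sdIter X j) → Prop}

theorem IsSqueezingSequence.descend (h : IsSqueezingSequence r i M₁ M₂)
    {P Q R : ∀ j, Finset (SdVertex V j) → Prop} {a b : ℕ} (hab : a ≤ b) (hbi : b ≤ i)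
    (hP : ∀ j, a ≤ j → j < b → LevelClosed (r j) (P j) (P (j + 1)))
    (hQ : ∀ j, a ≤ j → j < b → LevelClosed (r j) (Q j) (Q (j + 1)))
    (hR : ∀ j, a ≤ j → j < b → LevelClosed (r j) (R j) (R (j + 1)))
    (hM : MovesControlled (M₁ b) (M₂ b) (P b) (Q b) (R b)) :
    MovesControlled (M₁ a) (M₂ a) (P a) (Q a) (R a) := by
  induction b, hab using Nat.le_induction with
  | base => exact hM
  | succ b hab ih =>
    refine ih (by omega) (fun j h1 h2 => hP j h1 (by omega)) (fun j h1 h2 => hQ j h1 (by omega))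
      (fun j h1 h2 => hR j h1 (by omega)) ?_
    exact h.inherit b (by omega) _ _ _ _ _ _ (hP b hab (by omega)) (hQ b hab (by omega))
      (hR b hab (by omega)) hM

theorem IsSqueezingSequence.descend_lift (h : IsSqueezingSequence r i M₁ M₂) {J : ℕ}
    {P Q R : Finset (SdVertex V J) → Prop} (hP : ∀ {s t}, t ⊆ s → P s → P t)
    (hQ : ∀ {s t}, t ⊆ s → Q s → Q t) (hR : ∀ {s t}, t ⊆ s → R s → R t) : ∀ k, J + k ≤ i →
    MovesControlled (M₁ (J + k)) (M₂ (J + k)) (liftPred P k) (liftPred Q k) (liftPred R k) →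
    MovesControlled (M₁ J) (M₂ J) P Q R
  | 0, _, hM => hM
  | k + 1, hk, hM => h.descend_lift hP hQ hR k (by omega)
      (h.inherit (J + k) (by omega) _ _ _ _ _ _ (levelClosed_lift _ (liftPred_mono hP k))
        (levelClosed_lift _ (liftPred_mono hQ k)) (levelClosed_lift _ (liftPred_mono hR k)) hM)

/-- Control at level `i` yields control at level `J`: each coordinate grows by at most `η` under
the equivalences, and by `2 η` under the homotopies. -/
theorem IsSqueezingSequence.apply_le (hX : IsFDLF X) (h : IsSqueezingSequence r i M₁ M₂) {ε : ℝ}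
    (hε : 0 ≤ ε) (hM : ∀ s t, M₁ i s t ∨ M₂ i s t → ∀ v, |barycentre (position V i) s.1 v -
      barycentre (position V i) t.1 v| ≤ ε) {J : ℕ} (hJ : J ≤ i) {η : ℝ}
    (hη : ε + 2 * ((complexDim X : ℝ) / (complexDim X + 1)) ^ J ≤ η) (v : V) :
    (∀ s t, M₁ J s t → ∀ x ∈ s.1, ∀ y ∈ t.1, position V J y v ≤ position V J x v + η) ∧
    ∀ s t, M₂ J s t → ∀ x ∈ s.1, ∀ y ∈ t.1, position V J y v ≤ position V J x v + 2 * η := by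
  obtain ⟨k, rfl⟩ := Nat.exists_eq_add_of_le hJ
  set μ : ℝ := ((complexDim X : ℝ) / (complexDim X + 1)) ^ J
  have hμ : 0 ≤ μ := by positivity
  let U : ℝ → Finset (SdVertex V J) → Prop := fun a κ => ∀ x ∈ κ, position V J x v ≤ a
  have hU : ∀ a {s t : Finset (SdVertex V J)}, t ⊆ s → U a s → U a t :=
    fun a s t hts hs x hx => hs x (hts hx)
  have hstep : ∀ {a b : ℝ}, 0 ≤ a → a + (ε + μ) ≤ b → ∀ {s t}, M₁ (J + k) s t ∨ M₂ (J + k) s t →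
      liftPred (U a) k s.1 → liftPred (U b) k t.1 := by
    intro a b ha hab s t hst hs
    have h1 : barycentre (position V (J + k)) s.1 v ≤ a :=
      barycentre_le (Face.nonempty s.2) (apply_le_of_liftPred ha k hs)
    obtain ⟨κ, -, hκ, hle⟩ := exists_carrier_add hX J k t.2
    refine hκ (U b) fun x hx => ?_
    have h2 : position V J x v - μ ≤ barycentre (position V (J + k)) t.1 v :=
      le_barycentre (Face.nonempty t.2) fun y hy => sub_le_iff_le_add.2 (hle v x hx y hy)
    have h3 := (abs_le.1 (hM s t hst v)).1
    linarith
  -- At level `J + k` the homotopies move a coordinate by a single step, but not so further down.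
  have hctl : ∀ a : ℝ, 0 ≤ a →
      MovesControlled (M₁ J) (M₂ J) (U a) (U (a + (ε + μ))) (U (a + 2 * (ε + μ))) := by
    intro a ha
    refine h.descend_lift (hU _) (hU _) (hU _) k le_rfl ⟨?_, ?_, ?_⟩
    · exact fun hst => hstep ha le_rfl (Or.inl hst)
    · exact fun hst => hstep (by positivity) (by linarith) (Or.inl hst)
    · exact fun hst => hstep ha (by linarith) (Or.inr hst)
  have hmesh : ∀ (s : Face (sdIter X J)), ∀ x ∈ s.1, U (position V J x v + μ) s.1 :=
    fun s x hx x' hx' => by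
      have := (abs_le.1 (mesh_sdIter hX v J s.2 x' hx' x hx)).2
      linarith
  constructor
  · intro s t hst x hx y hy
    have := (hctl _ (add_nonneg (position_nonneg V J x v) hμ)).fst hst (hmesh s x hx) y hy
    linarith
  · intro s t hst x hx y hy
    have := (hctl _ (add_nonneg (position_nonneg V J x v) hμ)).homotopy hst (hmesh s x hx) y hy
    linarith

/-- The components of the equivalences and homotopies only enlarge the carrier of a simplex
if the new carrier has at most `m` vertices. -/
def SqueezedAbove (M₁ M₂ : ∀ j, Face (sdIter X j) → Face (sdIter X j) → Prop) (m j : ℕ) : Prop :=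
  ∀ s t, M₁ j s t ∨ M₂ j s t → m < (carrier (position V j) t.1).card →
    carrier (position V j) t.1 ⊆ carrier (position V j) s.1

theorem SqueezedAbove.descend {m a b : ℕ} (h : IsSqueezingSequence r i M₁ M₂)
    (hm : SqueezedAbove M₁ M₂ m b) (hab : a ≤ b) (hbi : b ≤ i) : SqueezedAbove M₁ M₂ m a := by
  intro s t hst hcard
  let Z : ∀ j, Finset (SdVertex V j) → Prop := fun j s' =>
    carrier (position V j) s' ⊆ carrier (position V a) s.1 ∨ (carrier (position V j) s').card ≤ m
  have hZ : ∀ j, LevelClosed (r j) (Z j) (Z (j + 1)) := fun j =>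
    levelClosed_carrier (r j) (position_nonneg V j)
      (Z := fun T => T ⊆ carrier (position V a) s.1 ∨ T.card ≤ m)
      fun hts => Or.imp hts.trans (Finset.card_le_card hts).trans
  have hstep : ∀ s' t', M₁ b s' t' ∨ M₂ b s' t' → Z b s'.1 → Z b t'.1 := by
    intro s' t' hst' hs'
    by_cases hc : m < (carrier (position V b) t'.1).card
    · have hsub := hm s' t' hst' hc
      exact Or.inl (hsub.trans (hs'.resolve_right fun h => by
        have := Finset.card_le_card hsub
        omega))
    · exact Or.inr (not_lt.1 hc)
  have := h.descend hab hbi (fun j _ _ => hZ j) (fun j _ _ => hZ j) (fun j _ _ => hZ j)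
    ⟨fun h => hstep _ _ (Or.inl h), fun h => hstep _ _ (Or.inl h),
      fun h => hstep _ _ (Or.inr h)⟩
  have hs : Z a s.1 := Or.inl subset_rfl
  have ht : Z a t.1 := hst.elim (fun h => this.fst h hs) (fun h => this.homotopy h hs)
  exact ht.resolve_right (not_le.2 hcard)

/-- The inductive step of the squeezing.  The control at level `J` shows that simplices with a
small coordinate in an `(m + 1)`-element set `τ` only move to such simplices.  As the retractions
move such simplices towards the boundary of `τ`, this persists down to level `J'`, where small
coordinates vanish: a simplex that does not meet the interior of `τ` cannot move there. -/
theorem SqueezedAbove.step (hX : IsFDLF X) (r : RetractionFamily X)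
    (h : IsSqueezingSequence r.r i M₁ M₂) {m J J' : ℕ} (hJ' : 1 ≤ J') (hJJ : J' ≤ J) (hJi : J ≤ i)
    {η : ℝ} (hη : 0 ≤ η) (hsmall : 2 * η < (((complexDim X : ℝ) + 1)⁻¹) ^ J')
    (hM : ∀ v, (∀ s t, M₁ J s t → ∀ x ∈ s.1, ∀ y ∈ t.1,
      position V J y v ≤ position V J x v + η) ∧
      ∀ s t, M₂ J s t → ∀ x ∈ s.1, ∀ y ∈ t.1, position V J y v ≤ position V J x v + 2 * η)
    (hm : SqueezedAbove M₁ M₂ (m + 1) J) : SqueezedAbove M₁ M₂ m J' := by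
  intro s t hst hcard
  rcases Nat.lt_or_ge (m + 1) (carrier (position V J') t.1).card with hlt | hge
  · exact hm.descend h hJJ hJi s t hst hlt
  set τ := carrier (position V J') t.1 with hτ
  have hτm : τ.card = m + 1 := by omega
  by_contra hns
  have hstep : ∀ {δ δ' : ℝ} {s' t' : Face (sdIter X J)}, (M₁ J s' t' ∨ M₂ J s' t') →
      (∀ v, ∀ x ∈ s'.1, ∀ y ∈ t'.1, position V J y v ≤ position V J x v + (δ' - δ)) →
      NearBoundary (position V J) τ δ s'.1 → NearBoundary (position V J) τ δ' t'.1 := by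
    intro δ δ' s' t' hst' hle hs'
    refine ⟨fun y hy => ?_, fun hsub => ?_⟩
    · obtain ⟨x, hx⟩ := Face.nonempty s'.2
      obtain ⟨w, hw, hxw⟩ := hs'.exists_le x hx
      exact ⟨w, hw, by linarith [hle w x hx y hy]⟩
    · have hc : (carrier (position V J) t'.1).card ≤ m + 1 := by
        by_contra! hlt
        have hts := hm s' t' hst' hlt
        have := Finset.card_le_card (hts.trans_eq (hs'.eq_of_subset (hsub.trans hts)))
        omega
      exact (Finset.eq_of_subset_of_card_le hsub (by omega)).symm
  have hclosed : ∀ δ : ℝ, 0 ≤ δ → ∀ j, J' ≤ j → j < J → LevelClosed (r.r j)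
      (NearBoundary (position V j) τ δ) (NearBoundary (position V (j + 1)) τ δ) :=
    fun δ hδ j hj _ => levelClosed_nearBoundary (r.r j) (position_nonneg V j)
      (r.exists_minimal_coordinate hX (hJ'.trans hj)) τ hδ
  have hctl := h.descend (P := fun j => NearBoundary (position V j) τ 0)
    (Q := fun j => NearBoundary (position V j) τ η)
    (R := fun j => NearBoundary (position V j) τ (2 * η)) hJJ hJi
    (hclosed 0 le_rfl) (hclosed η hη) (hclosed (2 * η) (by positivity))
    ⟨fun hst => hstep (Or.inl hst) fun v x hx y hy => by
        linarith [(hM v).1 _ _ hst x hx y hy],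
      fun hst => hstep (Or.inl hst) fun v x hx y hy => by
        linarith [(hM v).1 _ _ hst x hx y hy],
      fun hst => hstep (Or.inr hst) fun v x hx y hy => by
        linarith [(hM v).2 _ _ hst x hx y hy]⟩
  -- As the carrier of `s` does not contain `τ`, all its vertices have a zero coordinate in `τ`.
  obtain ⟨u, hu, hus⟩ := Finset.not_subset.1 hns
  have hs : NearBoundary (position V J') τ 0 s.1 :=
    ⟨fun x hx => ⟨u, hu, (apply_eq_zero_of_notMem_carrier (position_nonneg V J') hus hx).le⟩,
      fun hτs => (hus (hτs hu)).elim⟩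
  have ht : NearBoundary (position V J') τ (2 * η) t.1 := by
    rcases hst with hst | hst
    · have h1 : NearBoundary (position V J') τ η t.1 := hctl.fst hst hs
      exact ⟨fun x hx => (h1.exists_le x hx).imp fun w hw => ⟨hw.1, hw.2.trans (by linarith)⟩,
        h1.eq_of_subset⟩
    · exact hctl.homotopy hst hs
  -- The coordinates of `t` are minimal at a common `v ∈ τ`, hence `≤ 2 η` there, hence zero.
  obtain ⟨v, hv, hmin, -⟩ := r.exists_minimal_coordinate hX hJ' t
  obtain ⟨y, hy, hvy⟩ := (mem_carrier (position_nonneg V J')).1 hv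
  obtain ⟨w, hw, hle⟩ := ht.exists_le y hy
  have h1 := hmin y hy w hw
  rcases position_eq_zero_or_le hX v J' t.2 y hy with h0 | h0
  · exact Finsupp.mem_support_iff.1 hvy h0
  · linarith

/-- Levels `1 = J₀ ≤ J₁ ≤ …` such that the simplices at level `J_{m+1}` are small in comparison with
the nonzero coordinates at level `J_m`. -/
theorem exists_levels (n : ℕ) : ∃ J : ℕ → ℕ, J 0 = 1 ∧ Monotone J ∧
    ∀ m, 8 * ((n : ℝ) / (n + 1)) ^ J (m + 1) < (((n : ℝ) + 1)⁻¹) ^ J m := by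
  have h1 : (n : ℝ) / (n + 1) < 1 := (div_lt_one (by positivity)).2 (by linarith)
  have h0 : (0 : ℝ) ≤ n / (n + 1) := by positivity
  have key : ∀ a : ℕ, ∃ b, a ≤ b ∧ 8 * ((n : ℝ) / (n + 1)) ^ b < (((n : ℝ) + 1)⁻¹) ^ a := by
    intro a
    have hpos : (0 : ℝ) < (((n : ℝ) + 1)⁻¹) ^ a / 8 := by positivity
    obtain ⟨b, hb⟩ := exists_pow_lt_of_lt_one hpos h1
    refine ⟨max a b, le_max_left _ _, ?_⟩
    have := pow_le_pow_of_le_one h0 h1.le (le_max_right a b)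
    linarith
  choose f hf1 hf2 using key
  exact ⟨fun m => f^[m] 1, rfl, monotone_nat_of_le_succ fun m => by
    rw [Function.iterate_succ_apply']; exact hf1 _, fun m => by
    simp only [Function.iterate_succ_apply']; exact hf2 _⟩

/-- Sufficiently controlled equivalences at a sufficiently high level give rise to equivalences on
`X` which do not enlarge simplices. -/
theorem exists_squeezing (hX : IsFDLF X) : ∃ ε : ℝ, 0 < ε ∧ ∃ i₀ : ℕ, ∀ (r : RetractionFamily X)
    (i : ℕ), i₀ ≤ i → ∀ M₁ M₂ : ∀ j, Face (sdIter X j) → Face (sdIter X j) → Prop,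
    IsSqueezingSequence r.r i M₁ M₂ →
    (∀ s t, M₁ i s t ∨ M₂ i s t → ∀ v, |barycentre (position V i) s.1 v -
      barycentre (position V i) t.1 v| ≤ ε) →
    ∀ s t : Face X, M₁ 0 s t ∨ M₂ 0 s t → t.1 ⊆ s.1 := by
  obtain ⟨J, hJ0, hJmono, hJ⟩ := exists_levels (complexDim X)
  set n := complexDim X with hn
  -- The sum of `2 ε` and four times the mesh at level `J (m + 1)` has to be smaller than the
  -- nonzero coordinates at level `J m`, for all `m ≤ n`.
  set ε : ℝ := (((n : ℝ) + 1)⁻¹) ^ J (n + 1) / 8 with hε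
  have hε0 : 0 < ε := by positivity
  refine ⟨ε, hε0, J (n + 1), fun r i hi M₁ M₂ h hM => ?_⟩
  have hJ1 : ∀ m, 1 ≤ J m := fun m => hJ0 ▸ hJmono m.zero_le
  -- Downward induction on the number of vertices of the carriers.
  have hA : ∀ k m, m + k = n + 1 → SqueezedAbove M₁ M₂ m (J m) := by
    intro k
    induction k with
    | zero =>
      rintro m rfl s t - hlt
      obtain ⟨τ, hτ, hsub⟩ := carrier_mem hX _ t.2
      have h1 := Finset.card_le_card hsub
      have h2 := card_le_complexDim hX hτ
      omega
    | succ k ih =>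
      intro m hm
      have hle : J (m + 1) ≤ i := (hJmono (by omega)).trans hi
      have hεm : ε ≤ (((n : ℝ) + 1)⁻¹) ^ J m / 8 := by
        have h1 : ((n : ℝ) + 1)⁻¹ ≤ 1 := inv_le_one_of_one_le₀ (by
          have : (0 : ℝ) ≤ n := n.cast_nonneg
          linarith)
        have := pow_le_pow_of_le_one (by positivity) h1 (hJmono (show m ≤ n + 1 by omega))
        linarith
      have hJm := hJ m
      refine SqueezedAbove.step hX r h (hJ1 m) (hJmono m.le_succ) hle
        (η := ε + 2 * ((n : ℝ) / (n + 1)) ^ J (m + 1)) (by positivity) ?_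
        (fun v => h.apply_le hX hε0.le hM hle le_rfl v) (ih (m + 1) (by omega))
      rw [← hn]
      linarith
  intro s t hst
  have h0 : SqueezedAbove M₁ M₂ 0 0 :=
    (hA (n + 1) 0 (by omega)).descend h (by omega) ((hJmono (by omega)).trans hi)
  have := h0 s t hst
  rw [carrier_position_zero t.1, carrier_position_zero s.1] at this
  exact this (Face.nonempty t.2).card_pos

end Squeezing

/-! ### From controlled equivalences to relations and back -/

section Lift

variable {𝒞 : Type u} [Category.{v} 𝒞] [Preadditive 𝒞] {𝒟 : Type*} [Category* 𝒟] [Preadditive 𝒟]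

/-- A homotopy between the images under a faithful functor can be lifted if its components can. -/
def Homotopy.ofFaithful (F : 𝒞 ⥤ 𝒟) [F.Additive] [F.Faithful]
    {C D : HomologicalComplex 𝒞 (ComplexShape.down ℤ)} {f g : C ⟶ D}
    (H : Homotopy ((F.mapHomologicalComplex _).map f) ((F.mapHomologicalComplex _).map g))
    (h : ∀ i j, C.X i ⟶ D.X j) (hh : ∀ i j, F.map (h i j) = H.hom i j) : Homotopy f g where
  hom := h
  zero i j hij := F.map_injective
    ((hh i j).trans ((H.zero i j hij).trans (F.map_zero _ _).symm))
  comm i :=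
    F.map_injective <| (H.comm i).trans <| Eq.symm <| F.map_add.trans <| congrArg₂ (· + ·)
      (F.map_add.trans <| congrArg₂ (· + ·)
        ((F.map_comp _ _).trans (congrArg (F.map (C.d _ _) ≫ ·) (hh _ _)))
        ((F.map_comp _ _).trans (congrArg (· ≫ F.map (D.d _ _)) (hh _ _)))) rfl

end Lift

section Relations

variable {W : Type w} {A : Type u} [Category.{v} A] [Preadditive A]
  {K : PreAbstractSimplicialComplex W} {var : Variance}

instance Graded.forget_additive (I : Type w) (R : I → I → Prop) [IsPreorder I R] :
    (Graded.forget I R A).Additive where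
  map_add := rfl

instance Graded.forget_faithful (I : Type w) (R : I → I → Prop) [IsPreorder I R] :
    (Graded.forget I R A).Faithful where
  map_injective {M N _ _} h := Graded.hom_ext fun i j =>
    congrFun (congrFun (congrArg (Graded.Hom.comp (M := ⟨M.obj⟩) (N := ⟨N.obj⟩)) h) i) j

instance Graded.toFam_faithful (I : Type w) : (Graded.toFam (A := A) I).Faithful where
  map_injective h := Graded.hom_ext fun i j => congrArg (fun f => Fam.Hom.comp f i j) h

/-- The relation `M`, read backwards for `upper` variance. -/
def orient (var : Variance) (M : Face K → Face K → Prop) (s t : Face K) : Prop :=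
  match var with
  | .lower => M s t
  | .upper => M t s

/-- The nonzero components of the two chain maps of an equivalence. -/
def mapMoves {C D : ACplx A var K} (e : HomotopyEquiv (famCplx C) (famCplx D)) :
    Face K → Face K → Prop :=
  orient var fun s t => ∃ n, (e.hom.f n).comp s t ≠ 0 ∨ (e.inv.f n).comp s t ≠ 0

/-- The nonzero components of the two homotopies of an equivalence. -/
def homotopyMoves {C D : ACplx A var K} (e : HomotopyEquiv (famCplx C) (famCplx D)) :
    Face K → Face K → Prop :=
  orient var fun s t => ∃ n m, (e.homotopyHomInvId.hom n m).comp s t ≠ 0 ∨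
    (e.homotopyInvHomId.hom n m).comp s t ≠ 0

/-- With `upper` variance the order of the three predicates is reversed. -/
theorem movesControlled_iff {C D : ACplx A var K} (e : HomotopyEquiv (famCplx C) (famCplx D))
    (P Q R : Finset W → Prop) : MovesControlled (mapMoves e) (homotopyMoves e) P Q R ↔
      match var with
      | .lower => Controlled P Q R e
      | .upper => Controlled R Q P e := by
  cases var
  · constructor
    · rintro ⟨h1, h2, h3⟩
      exact ⟨fun n s t h => h1 ⟨n, Or.inl h⟩, fun n s t h => h2 ⟨n, Or.inl h⟩,
        fun n s t h => h1 ⟨n, Or.inr h⟩, fun n s t h => h2 ⟨n, Or.inr h⟩,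
        fun n m s t h => h3 ⟨n, m, Or.inl h⟩, fun n m s t h => h3 ⟨n, m, Or.inr h⟩⟩
    · rintro ⟨h1, h2, h3, h4, h5, h6⟩
      exact ⟨fun ⟨n, h⟩ => h.elim (h1 n _ _) (h3 n _ _),
        fun ⟨n, h⟩ => h.elim (h2 n _ _) (h4 n _ _),
        fun ⟨n, m, h⟩ => h.elim (h5 n m _ _) (h6 n m _ _)⟩
  · constructor
    · rintro ⟨h1, h2, h3⟩
      exact ⟨fun n s t h => h2 ⟨n, Or.inl h⟩, fun n s t h => h1 ⟨n, Or.inl h⟩,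
        fun n s t h => h2 ⟨n, Or.inr h⟩, fun n s t h => h1 ⟨n, Or.inr h⟩,
        fun n m s t h => h3 ⟨n, m, Or.inl h⟩, fun n m s t h => h3 ⟨n, m, Or.inr h⟩⟩
    · rintro ⟨h1, h2, h3, h4, h5, h6⟩
      exact ⟨fun ⟨n, h⟩ => h.elim (h2 n _ _) (h4 n _ _),
        fun ⟨n, h⟩ => h.elim (h1 n _ _) (h3 n _ _),
        fun ⟨n, m, h⟩ => h.elim (h5 n m _ _) (h6 n m _ _)⟩

theorem exists_moves_of_subdiv [DecidableEq W] (hK : IsFDLF K) (c : VertexChoice K)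
    {C D : ACplx A var K} (e : HomotopyEquiv (famCplx (subdiv hK c C)) (famCplx (subdiv hK c D))) :
    ∃ e' : HomotopyEquiv (famCplx C) (famCplx D), ∀ P P' Q Q' R R', LevelClosed c P P' →
      LevelClosed c Q Q' → LevelClosed c R R' →
      MovesControlled (mapMoves e) (homotopyMoves e) P' Q' R' →
      MovesControlled (mapMoves e') (homotopyMoves e') P Q R := by
  obtain ⟨e', he'⟩ := exists_controlled_of_subdiv hK c e
  refine ⟨e', fun P P' Q Q' R R' hP hQ hR h => ?_⟩
  rw [movesControlled_iff] at h ⊢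
  cases var
  · exact he' P P' Q Q' R R' hP hQ hR h
  · exact he' R R' Q Q' P P' hR hQ hP h

/-- A morphism of families with allowed components is a morphism of graded objects. -/
def liftHom {M N : ACat A var K} (f : (Graded.forget _ _ A ⋙ Graded.toFam (Face K)).obj M ⟶
    (Graded.forget _ _ A ⋙ Graded.toFam (Face K)).obj N)
    (h : ∀ s t : Face K, f.comp s t ≠ 0 → var.rel K s t) : M ⟶ N :=
  Graded.Hom.mk (M := M) (N := N) f.comp f.finite_column h

/-- An equivalence all of whose components are allowed in `A(K)` is one in `A(K)`. -/
theorem nonempty_homotopyEquiv_of_moves {C D : ACplx A var K}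
    (e : HomotopyEquiv (famCplx C) (famCplx D))
    (he : ∀ s t, mapMoves e s t ∨ homotopyMoves e s t → t.1 ⊆ s.1) :
    Nonempty (HomotopyEquiv C D) := by
  let Φ := Graded.forget (Face K) (var.rel K) A ⋙ Graded.toFam (Face K)
  have h1 : ∀ n (s t : Face K), (e.hom.f n).comp s t ≠ 0 → var.rel K s t := fun n s t h => by
    cases var
    · exact he s t (Or.inl ⟨n, Or.inl h⟩)
    · exact he t s (Or.inl ⟨n, Or.inl h⟩)
  have h2 : ∀ n (s t : Face K), (e.inv.f n).comp s t ≠ 0 → var.rel K s t := fun n s t h => by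
    cases var
    · exact he s t (Or.inl ⟨n, Or.inr h⟩)
    · exact he t s (Or.inl ⟨n, Or.inr h⟩)
  have h3 : ∀ n m (s t : Face K), (e.homotopyHomInvId.hom n m).comp s t ≠ 0 → var.rel K s t :=
    fun n m s t h => by
      cases var
      · exact he s t (Or.inr ⟨n, m, Or.inl h⟩)
      · exact he t s (Or.inr ⟨n, m, Or.inl h⟩)
  have h4 : ∀ n m (s t : Face K), (e.homotopyInvHomId.hom n m).comp s t ≠ 0 → var.rel K s t :=
    fun n m s t h => by
      cases var
      · exact he s t (Or.inr ⟨n, m, Or.inr h⟩)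
      · exact he t s (Or.inr ⟨n, m, Or.inr h⟩)
  let f : C ⟶ D :=
    { f := fun n => liftHom (e.hom.f n) (h1 n)
      comm' := fun i j _ => Φ.map_injective (e.hom.comm i j) }
  let g : D ⟶ C :=
    { f := fun n => liftHom (e.inv.f n) (h2 n)
      comm' := fun i j _ => Φ.map_injective (e.inv.comm i j) }
  let H₁ : Homotopy ((Φ.mapHomologicalComplex _).map (f ≫ g))
    ((Φ.mapHomologicalComplex _).map (𝟙 C)) := e.homotopyHomInvId
  let H₂ : Homotopy ((Φ.mapHomologicalComplex _).map (g ≫ f))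
    ((Φ.mapHomologicalComplex _).map (𝟙 D)) := e.homotopyInvHomId
  exact ⟨⟨f, g, Homotopy.ofFaithful Φ H₁ (fun n m => liftHom (H₁.hom n m) (h3 n m))
      fun _ _ => rfl,
    Homotopy.ofFaithful Φ H₂ (fun n m => liftHom (H₂.hom n m) (h4 n m)) fun _ _ => rfl⟩⟩

end Relations

section Iterated

variable {V : Type w} {X : PreAbstractSimplicialComplex V} {A : Type u} [Category.{v} A]
  [Preadditive A] {var : Variance}

/-- An equivalence over `Sd^i X` induces equivalences over all `Sd^j X` with `j ≤ i`, and their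
nonzero components form a squeezing sequence.  The relations for `j > i` play no role. -/
theorem exists_isSqueezingSequence (hX : IsFDLF X) (r : ∀ j, VertexChoice (sdIter X j))
    (C D : ACplx A var X) : ∀ (i : ℕ) (e : HomotopyEquiv (famCplx (subdivIter hX r C i))
      (famCplx (subdivIter hX r D i))), ∃ (e₀ : HomotopyEquiv (famCplx C) (famCplx D))
      (M₁ M₂ : ∀ j, Face (sdIter X j) → Face (sdIter X j) → Prop),
      IsSqueezingSequence r i M₁ M₂ ∧ (M₁ i = mapMoves e ∧ M₂ i = homotopyMoves e) ∧
      M₁ 0 = mapMoves e₀ ∧ M₂ 0 = homotopyMoves e₀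
  | 0, e => ⟨e, fun j => match j with | 0 => mapMoves e | _ + 1 => fun _ _ => False,
      fun j => match j with | 0 => homotopyMoves e | _ + 1 => fun _ _ => False,
      ⟨fun j hj => (j.not_lt_zero hj).elim⟩, ⟨rfl, rfl⟩, rfl, rfl⟩
  | i + 1, e => by
    obtain ⟨e', he'⟩ := exists_moves_of_subdiv (isFDLF_sdIter hX i) (r i) e
    obtain ⟨e₀, M₁, M₂, hM, ⟨h1, h2⟩, h3, h4⟩ := exists_isSqueezingSequence hX r C D i e'
    refine ⟨e₀, Function.update M₁ (i + 1) (mapMoves e), Function.update M₂ (i + 1)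
      (homotopyMoves e), ⟨fun j hj => ?_⟩, ⟨Function.update_self _ _ _,
        Function.update_self _ _ _⟩, ?_, ?_⟩
    · rw [Function.update_of_ne (show j ≠ i + 1 by omega),
        Function.update_of_ne (show j ≠ i + 1 by omega)]
      rcases Nat.lt_succ_iff_lt_or_eq.1 hj with hj | rfl
      · rw [Function.update_of_ne (show j + 1 ≠ i + 1 by omega),
          Function.update_of_ne (show j + 1 ≠ i + 1 by omega)]
        exact hM.inherit j hj
      · rw [Function.update_self, Function.update_self, h1, h2]
        exact he'
    · rw [Function.update_of_ne (by omega), h3]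
    · rw [Function.update_of_ne (by omega), h4]

theorem le_of_bound_le {I : Type w} {R : I → I → Prop} [IsPreorder I R] {d : I → I → ENNReal}
    {M N : Graded I R A} {f : M ⟶ N} {ε : ENNReal} (h : bound d f ≤ ε) {s t : I}
    (hst : f.comp s t ≠ 0) : d s t ≤ ε :=
  (le_iSup_of_le s (le_iSup_of_le t (le_iSup (fun _ : f.comp s t ≠ 0 => d s t) hst))).trans h

theorem HasControl.abs_sub_le {i : ℕ} {C D : ACplx A var (sdIter X i)} {ε : ℝ} (hε : 0 ≤ ε)
    {e : HomotopyEquiv ((toG A var (sdIter X i)).obj C) ((toG A var (sdIter X i)).obj D)}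
    (he : HasControl (controlDist X i) (ENNReal.ofReal ε) e) (s t : Face (sdIter X i))
    (hst : mapMoves (var := var) (C := C) (D := D) ((Graded.toFam _).mapHomotopyEquiv e) s t ∨
      homotopyMoves (var := var) (C := C) (D := D) ((Graded.toFam _).mapHomotopyEquiv e) s t)
    (v : V) :
    |barycentre (position V i) s.1 v - barycentre (position V i) t.1 v| ≤ ε := by
  have key : ∀ s t : Face (sdIter X i),
      (∃ n, (e.hom.f n).comp s t ≠ 0 ∨ (e.inv.f n).comp s t ≠ 0) ∨
      (∃ n m, (e.homotopyHomInvId.hom n m).comp s t ≠ 0 ∨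
        (e.homotopyInvHomId.hom n m).comp s t ≠ 0) →
      |barycentre (position V i) s.1 v - barycentre (position V i) t.1 v| ≤ ε := by
    intro s t h
    refine abs_apply_sub_le_of_stdDist_le hε (X := X) ?_ v
    rcases h with ⟨n, h | h⟩ | ⟨n, m, h | h⟩
    · exact le_of_bound_le (he.hom n) h
    · exact le_of_bound_le (he.inv n) h
    · exact le_of_bound_le (he.homotopy_hom_inv n m) h
    · exact le_of_bound_le (he.homotopy_inv_hom n m) h
  cases var
  · exact key s t hst
  · rw [abs_sub_comm]
    exact key t s hst

end Iterated

end

theorem mainTheorem3 {V : Type w} (X : PreAbstractSimplicialComplex V) (hX : IsFDLF X) :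
    ∃ ε : ℝ, 0 < ε ∧ ∃ i₀ : ℕ,
      ∀ (A : Type u) [Category.{v} A] [Preadditive A] [HasFiniteBiproducts A]
        (r : RetractionFamily X) (i : ℕ), i₀ ≤ i →
      ∀ (var : Variance) (C D : ACplx A var X), IsFiniteComplex C → IsFiniteComplex D →
        (∃ e : HomotopyEquiv ((toG A var (sdIter X i)).obj (subdivIter hX r.r C i))
            ((toG A var (sdIter X i)).obj (subdivIter hX r.r D i)),
          HasControl (controlDist X i) (ENNReal.ofReal ε) e) →
        Nonempty (HomotopyEquiv C D) := by
  obtain ⟨ε, hε, i₀, h⟩ := exists_squeezing hX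
  refine ⟨ε, hε, i₀, fun A _ _ _ r i hi var C D _ _ ⟨e, he⟩ => ?_⟩
  obtain ⟨e₀, M₁, M₂, hM, ⟨h1, h2⟩, h3, h4⟩ := exists_isSqueezingSequence hX r.r C D i
    ((Graded.toFam _).mapHomotopyEquiv e)
  refine nonempty_homotopyEquiv_of_moves e₀ ?_
  rw [← h3, ← h4]
  refine h r i hi M₁ M₂ hM ?_
  rw [h1, h2]
  exact he.abs_sub_le hε.le
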